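/- Let $W\in\mathbb{C}[x_1,\dots,x_N]$ be quasi-homogeneous of degree $d$ with positive integer weights $w_1,\dots,w_N$, $\gcd(w_1,\dots,w_N)=1$, whose only critical point is the origin. Assume the hypersurface $\mathcal{X}_W=\{W=0\}\subset\mathbb{P}(w_1,\dots,w_N)$ is Gorenstein, i.e. $w_j\mid d$ for all $j$, and Fano, i.e. $\kappa_{\mathcal X}:=d-\sum_j w_j<0$; put $r:=-\kappa_{\mathcal X}$, $q_j:=w_j/d$, and let $\langle a\rangle$ denote the fractional part of $a$. Let $F:=\{k/w_j : 1\le j\le N,\ 0\le k<w_j\}$ and, for $f\in F$, $N_f:=\#\{j: w_jf\in\mathbb{Z}\}$. The ambient Chen–Ruan cohomology is $H^{amb}_{CR}(\mathcal{X}_W;\mathbb{C})=\bigoplus_{f\in F}\bigoplus_{i=0}^{N_f-2}\mathbb{C}\,P^i\mathbf{1}_f$, where $P$ is the hyperplane class and $P^{N_f-1}\mathbf 1_f=0$. The narrow FJRW state space of $(W,\langle J_W\rangle)$ is $H^{nar}_{FJRW}(W)=\bigoplus_{k\in\mathbf{Nar}}\mathbb{C}\phi_k$, where $\mathbf{Nar}:=\{0\le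 k\le d-1 : (k+1)w_j\notin d\mathbb{Z}\text{ for all }j\}$. Let $$I_{GW}^{small}(q,z):=z\,q^{P/z}\sum_{\substack{n\in\mathbb{Q}_{\ge0}\\ \exists j:\ nw_j\in\mathbb{Z}}}q^n\,\frac{\prod_{0<b\le nd,\ \langle b\rangle=\langle nd\rangle}(dP+bz)}{\prod_{j=1}^N\prod_{0<b\le nw_j,\ \langle b\rangle=\langle nw_j\rangle}(w_jP+bz)}\,\mathbf{1}_{\langle -n\rangle},$$ regarded, because of the factors $q^{P/z}$ and $q^n$, as a function on the Riemann surface of $\log q$, and let $$I_{FJRW}^{small}(t,z):=z\sum_{k\in\mathbf{Nar}}\sum_{l=0}^\infty\frac{t^{dl+k+1}}{z^{dl+k}(dl+k)!}\prod_{j=1}^N\frac{z^{\lfloor q_j(dl+k)\rfloor}\,\Gamma(q_j(dl+k+1))}{\Gamma(q_j+\langle q_jk\rangle)}\,\phi_k,$$ regarded as a formal power series in $t$. Then the series defining $I_{GW}^{small}(q,1)$ converges absolutely for all $q$ on the Riemann surface of the logarithm, and there is a sector $D=\{a<\arg q<b\}$ of this surface, with $0<b-a\le 2\pi r$ (so that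 $u=q^{1/r}$ maps $D$ injectively to a sector of the complex plane), for which there exists a unique linear map $L_{GW}:H^{amb}_{CR}(\mathcal{X}_W;\mathbb{C})\to H^{nar}_{FJRW}(W)$ of rank equal to $\dim H^{nar}_{FJRW}(W)$ such that $$L_{GW}\cdot I_{GW}^{small}(q,1)\sim I_{FJRW}^{small}(t=q^{-1/d},-1)\qquad\text{as } q\to\infty\text{ from } D.$$ Here $g\sim\sum_{n\ge0}a_n\psi_n$ means that $\psi_{n+1}=o(\psi_n)$ for every $n\ge 0$ and $g-\sum_{n=0}^m a_n\psi_n=o(\psi_m)$ for every $m\ge0$; the asymptotic sequence is $\psi_n=q^{-(n+1)/d}$ and $a_n\in H^{nar}_{FJRW}(W)$ is the coefficient of $t^{n+1}$ in $I_{FJRW}^{small}(t,-1)$. -/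

import Mathlib

open Finset Filter Asymptotics

noncomputable section

namespace LGFano

/-! ## The hypersurface -/

/-- The canonical bundle index `κ = d - ∑ w_j` of a degree `d` hypersurface in the weighted
projective stack `ℙ(w_1, …, w_N)`. In the Fano case `κ < 0` the Fano index is `r = -κ`. -/
def canonicalIndex {N : ℕ} (d : ℕ) (w : Fin N → ℕ) : ℤ := (d : ℤ) - ∑ j, (w j : ℤ)

/-- The origin is the one and only critical point of `W : ℂ^N → ℂ`. -/
def HasUniqueSingularityAtOrigin {N : ℕ} (W : MvPolynomial (Fin N) ℂ) : Prop :=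
  ∀ x : Fin N → ℂ, (∀ j, MvPolynomial.eval x (MvPolynomial.pderiv j W) = 0) ↔ x = 0

/-! ## Gromov-Witten side: ambient Chen-Ruan state space and the small I-function -/

/-- The index set `F = {k / w_j | 0 ≤ k < w_j}` of the sectors of the inertia stack: `f ∈ F`
stands for `λ = exp(2πif)`, acting on `ℂ^N` by `(λ^{w_1}, …, λ^{w_N})`, and these are exactly the
`λ` with a nonzero fixed point. -/
def sectors {N : ℕ} (w : Fin N → ℕ) : Finset ℚ :=
  univ.biUnion fun j => (range (w j)).image fun k : ℕ => (k : ℚ) / (w j : ℚ)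

/-- `N_f`, the dimension of the fixed locus in `ℂ^N` of the diagonal action of `exp(2πif)`:
the number of `j` with `exp(2πif)^{w_j} = 1`, that is, with `w_j f ∈ ℤ`. -/
def fixedDim {N : ℕ} (w : Fin N → ℕ) (f : ℚ) : ℕ :=
  (univ.filter fun j => Int.fract ((w j : ℚ) * f) = 0).card

/-- The ambient part `⨁_{f ∈ F} ⨁_{0 ≤ i ≤ N_f - 2} ℂ · P^i 1_f` of the Chen-Ruan cohomology of
a Gorenstein hypersurface. In the `f`-sector, which is a hypersurface of dimension `N_f - 2` in a
weighted projective space of dimension `N_f - 1`, the powers of the hyperplane class `P` span the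
truncated polynomial ring `ℂ[P]/(P^{N_f - 1})`. A vector is given by its coordinates in the basis
`P^i 1_f`. -/
abbrev AmbientSpace {N : ℕ} (w : Fin N → ℕ) : Type :=
  (Σ f : sectors w, Fin (fixedDim w (f : ℚ) - 1)) → ℂ

/-- The product of `(c P + b z)` over all `b` with `0 < b ≤ n c` and `⟨b⟩ = ⟨n c⟩`, as a power
series in `P`. These `b` are the numbers `n c - i` with `i = 0, 1, …, ⌈n c⌉ - 1`. -/
def hypergeometricFactor (c : ℕ) (n : ℚ) (z : ℂ) : PowerSeries ℂ :=
  ∏ i ∈ range ⌈n * (c : ℚ)⌉₊,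
    (PowerSeries.C (c : ℂ) * PowerSeries.X
      + PowerSeries.C (((n * (c : ℚ) - (i : ℚ) : ℚ) : ℂ) * z))

/-- The summand of index `n` of the small Gromov-Witten I-function at `q = e^x`, as a power series
in `P` (to be read in `ℂ[P]/(P^{N_f - 1})`, `f = ⟨-n⟩`):
`z q^{P/z} q^n ∏_{b} (d P + b z) / ∏_j ∏_{b} (w_j P + b z)`. -/
def smallIGWTerm {N : ℕ} (d : ℕ) (w : Fin N → ℕ) (x z : ℂ) (n : ℚ) : PowerSeries ℂ :=
  PowerSeries.C z * PowerSeries.rescale (x / z) (PowerSeries.exp ℂ)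
    * PowerSeries.C (Complex.exp ((n : ℂ) * x))
    * hypergeometricFactor d n z * ∏ j, (hypergeometricFactor (w j) n z)⁻¹

/-- The exponents `n ≥ 0` that contribute to the `f`-sector, i.e. those with `⟨-n⟩ = f`, are
`n = ⟨1 - f⟩ + m` with `m = 0, 1, 2, …`. -/
def sectorExponent (f : ℚ) (m : ℕ) : ℚ := Int.fract (1 - f) + (m : ℚ)

/-- The small Gromov-Witten I-function `I_GW^small(q, z)` at the point `q = e^x` of the Riemann
surface of the logarithm (it involves `log q` and fractional powers of `q`). -/
def smallIGW {N : ℕ} (d : ℕ) (w : Fin N → ℕ) (x z : ℂ) : AmbientSpace w := fun p =>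
  ∑' m : ℕ, PowerSeries.coeff (p.2 : ℕ) (smallIGWTerm d w x z (sectorExponent (p.1 : ℚ) m))

/-! ## Landau-Ginzburg side: narrow FJRW state space and the small I-function -/

/-- `Nar`: the `k ∈ {0, …, d-1}` for which the sector of `J^{k+1}` is narrow, i.e. for which
`J^{k+1} = (exp(2πi(k+1)w_j/d))_j` fixes only the origin of `ℂ^N`. -/
def narrowSet {N : ℕ} (d : ℕ) (w : Fin N → ℕ) : Finset ℕ :=
  (range d).filter fun k => ∀ j, ¬ d ∣ (k + 1) * w j

/-- The narrow FJRW state space `⨁_{k ∈ Nar} ℂ φ_k` of `(W, ⟨J⟩)`, in coordinates in the basis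
`φ_k = 1`: a narrow sector is the cohomology `H^0(pt; ℂ) = ℂ`. -/
abbrev NarrowSpace {N : ℕ} (d : ℕ) (w : Fin N → ℕ) : Type := narrowSet d w → ℂ

/-- The charge `q_j = w_j / d`. -/
def charge {N : ℕ} (d : ℕ) (w : Fin N → ℕ) (j : Fin N) : ℚ := (w j : ℚ) / (d : ℚ)

/-- The coefficient of `t^{dl+k+1} φ_k` in the small FJRW I-function `I_FJRW^small(t, z)`:
`z · z^{-(dl+k)} / (dl+k)! · ∏_j z^{⌊q_j(dl+k)⌋} Γ(q_j(dl+k+1)) / Γ(q_j + ⟨q_j k⟩)`. -/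
def smallIFJRWCoeff {N : ℕ} (d : ℕ) (w : Fin N → ℕ) (z : ℂ) (k l : ℕ) : ℂ :=
  z / (z ^ (d * l + k) * ((d * l + k).factorial : ℂ)) *
    ∏ j, z ^ ⌊charge d w j * ((d * l + k : ℕ) : ℚ)⌋₊
      * Complex.Gamma ((charge d w j * ((d * l + k + 1 : ℕ) : ℚ) : ℚ) : ℂ)
      / Complex.Gamma ((charge d w j + Int.fract (charge d w j * (k : ℚ)) : ℚ) : ℂ)

/-- The small FJRW I-function as a formal power series in `t`: `I_FJRW^small(t, z)` is
`∑_{n ≥ 0} smallIFJRW d w z n · t^{n+1}`. The vector coefficient of `t^{n+1}`, where `n = dl + k`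
with `0 ≤ k < d`, is a multiple of `φ_k` if `k` is narrow and zero if not. -/
def smallIFJRW {N : ℕ} (d : ℕ) (w : Fin N → ℕ) (z : ℂ) (n : ℕ) : NarrowSpace d w := fun k =>
  if n % d = (k : ℕ) then smallIFJRWCoeff d w z (k : ℕ) (n / d) else 0

/-! ## Asymptotic expansions -/

/-- `∑_n a_n ψ_n` is an asymptotic expansion of `g` along the filter `F`: `(ψ_n)` is an asymptotic
sequence, and `g - ∑_{n ≤ m} a_n ψ_n = o(ψ_m)` for every `m`. -/
def IsAsymptoticExpansion {α E : Type*} [NormedAddCommGroup E] [NormedSpace ℂ E]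
    (F : Filter α) (ψ : ℕ → α → ℂ) (a : ℕ → E) (g : α → E) : Prop :=
  (∀ n, ψ (n + 1) =o[F] ψ n) ∧
    ∀ m, (fun x => g x - ∑ n ∈ range (m + 1), ψ n x • a n) =o[F] ψ m

/-- `q → ∞` in the sector `a < arg q < b` of the Riemann surface of the logarithm, in the
coordinate `x = log q`: `Re x → +∞` while `a < Im x < b`. -/
def atInftyInSector (a b : ℝ) : Filter ℂ :=
  comap Complex.re atTop ⊓ 𝓟 {x : ℂ | a < x.im ∧ x.im < b}

end LGFano

end

/-!
Let `r = ∑ w_j - d` be the Fano index and put `x = log q`. Every component of the Gromov-Witten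
I-function is a combination of the series `∑_m q^{n + m + P} H_{n + m}(P)`, expanded in powers of
`P`, whose coefficients `H` are ratios of hypergeometric products. By the Fano condition these
coefficients decay factorially in `m`, which gives convergence for all `q`.

*Existence.* Put `G(s) = e^{iπrs} ∏_j Γ(-w_j s) / Γ(-d s)` (`gammaRatio`) and, for a narrow `k` and
`ζ = e^{-2πi(k+1)/d}`, consider the Barnes integral of `G(s) q^s / (e^{2πis} - ζ)` over a vertical
line. It converges for `|arg q - (π - πr)| < πr/2 + π`. Closing the contour to the right picks up
the poles of the Gamma functions at the exponents of the sectors; the residues are combinations,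
with coefficients depending only on the sector, of the terms of the Gromov-Witten I-function
(`barnesIntegral_eq_sum_smallIGW`). Moving the line to the left crosses the points
`-(dl + k + 1)/d`, where the residues are the terms of the `φ_k`-component of the FJRW I-function
up to a constant, and the integral over the shifted line is the remainder of the asymptotic
expansion (`barnesIntegral_eq_sum_add`). So the connection matrix consists of Laurent coefficients
of `G(s) / (e^{2πis} - ζ)`. The resulting map is surjective because each `φ_k` occurs among the
coefficients of the FJRW I-function and an asymptotic expansion of zero is zero.

*Uniqueness.* The difference of two such maps gives combinations `y` of the components of the
I-function that are smaller than every power of `q` in the sector, of opening `πr + π`. Such a `y`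
is entire in `x`, grows slower than any exponential as `Re x → -∞`, and solves the hypergeometric
equation `D_w(q d/dq) y = q D_d(q d/dq) y`. Its Laplace transform `M(s)` exists for `Re s < 0`, can
be computed on every horizontal line of the strip, and satisfies the same recurrence as `G`.
Therefore `M / G` has period `1`, and since the opening exceeds `πr`, Stirling's formula shows that
`e^{iπs} M(s) / G(s)` tends to zero as `Im s → ±∞`; by Liouville's theorem `M = 0`, and `y = 0`
by Fourier inversion (`eq_zero_of_isFlat`). Finally the components of the I-function are linearly
independent, since the monodromy around `q = 0` has different eigenvalues on different
sectors and acts on the powers of `P` in one sector as a single Jordan block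
(`eq_zero_of_sum_smallIGW_eq_zero`).

The sector of the theorem has opening `πr + π`: more than `πr`, as needed for uniqueness, and at
most `2πr`, since `r` is a positive integer.
-/

noncomputable section

namespace LGFano

open scoped Topology

/-! ### Bounds for the Gamma function in vertical strips -/

open Complex in
/-- The reflection formula on the critical line. -/
theorem normSq_Gamma_half_add_mul_I (τ : ℝ) :
    ‖Gamma (1 / 2 + τ * I)‖ ^ 2 = Real.pi / Real.cosh (Real.pi * τ) := by
  have h := Gamma_mul_Gamma_one_sub (1 / 2 + τ * I)
  have h1 : (1 : ℂ) - (1 / 2 + τ * I) = (starRingEnd ℂ) (1 / 2 + τ * I) := by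
    apply Complex.ext <;> simp
    norm_num
  have h2 : Complex.sin (Real.pi * (1 / 2 + τ * I)) = (Real.cosh (Real.pi * τ) : ℂ) := by
    rw [show (Real.pi : ℂ) * (1 / 2 + τ * I) = (Real.pi * τ : ℂ) * I + Real.pi / 2 by ring,
      Complex.sin_add_pi_div_two, Complex.cos_mul_I]
    push_cast; rfl
  rw [h1, h2, Gamma_conj, Complex.mul_conj, Complex.normSq_eq_norm_sq] at h
  exact_mod_cast h

open Complex in
theorem norm_Gamma_half_add_mul_I_le (τ : ℝ) :
    ‖Gamma (1 / 2 + τ * I)‖ ≤ Real.sqrt (2 * Real.pi) * Real.exp (-(Real.pi / 2 * |τ|)) := by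
  refine le_of_sq_le_sq ?_ (by positivity)
  rw [normSq_Gamma_half_add_mul_I, mul_pow, Real.sq_sqrt (by positivity), ← Real.exp_nat_mul]
  have h : Real.exp (Real.pi * |τ|) / 2 ≤ Real.cosh (Real.pi * τ) := by
    rw [← Real.cosh_abs, abs_mul, abs_of_pos Real.pi_pos, Real.cosh_eq]
    have := Real.exp_pos (-(Real.pi * |τ|))
    linarith
  calc Real.pi / Real.cosh (Real.pi * τ) ≤ Real.pi / (Real.exp (Real.pi * |τ|) / 2) := by
        gcongr
    _ = _ := by
        rw [show ((2 : ℕ) : ℝ) * -(Real.pi / 2 * |τ|) = -(Real.pi * |τ|) by push_cast; ring,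
          Real.exp_neg]
        field_simp

/-- Comparison of `Γ` along a horizontal line, from Euler's Beta integral. -/
theorem norm_Gamma_le_mul_norm_Gamma_add {z : ℂ} (hz : 0 < z.re) {δ : ℝ} (hδ : 0 < δ) :
    ‖Complex.Gamma z‖ ≤
      Real.Gamma z.re / Real.Gamma (z.re + δ) * ‖Complex.Gamma (z + δ)‖ := by
  have hδ' : 0 < (δ : ℂ).re := by simpa
  have hsum : 0 < (z + δ).re := by simp; linarith
  have hre : 0 < (z.re : ℂ).re := by simpa
  have hb := Complex.betaIntegral_eq_Gamma_mul_div z δ hz hδ'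
  have hb' := Complex.betaIntegral_eq_Gamma_mul_div (z.re : ℂ) δ hre hδ'
  have hle : ‖Complex.betaIntegral z δ‖ ≤ ‖Complex.betaIntegral (z.re : ℂ) δ‖ := by
    have key : Complex.betaIntegral (z.re : ℂ) δ =
        ((∫ x in (0 : ℝ)..1, x ^ (z.re - 1) * (1 - x) ^ (δ - 1) : ℝ) : ℂ) := by
      rw [Complex.betaIntegral, ← intervalIntegral.integral_ofReal]
      refine intervalIntegral.integral_congr fun x hx => ?_
      rw [Set.uIcc_of_le zero_le_one] at hx
      push_cast
      rw [Complex.ofReal_cpow hx.1, Complex.ofReal_cpow (by linarith [hx.2])]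
      push_cast; rfl
    rw [key, Complex.norm_real, Complex.betaIntegral]
    refine (intervalIntegral.norm_integral_le_integral_norm zero_le_one).trans ?_
    refine le_trans (le_of_eq ?_) (le_abs_self _)
    refine intervalIntegral.integral_congr_ae ?_
    have : ∀ᵐ x : ℝ, x ≠ 1 := by simp [MeasureTheory.ae_iff]
    filter_upwards [this] with x hx1 hx
    rw [Set.uIoc_of_le zero_le_one] at hx
    have hx2 : 0 < 1 - x := by
      have := lt_of_le_of_ne hx.2 hx1
      linarith
    rw [norm_mul, Complex.norm_cpow_eq_rpow_re_of_pos hx.1,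
      show (1 : ℂ) - x = ((1 - x : ℝ) : ℂ) by push_cast; rfl,
      Complex.norm_cpow_eq_rpow_re_of_pos hx2]
    simp
  rw [hb, hb', norm_div, norm_div, norm_mul, norm_mul] at hle
  have hδpos : 0 < ‖Complex.Gamma δ‖ :=
    norm_pos_iff.2 (Complex.Gamma_ne_zero_of_re_pos hδ')
  have hspos : 0 < ‖Complex.Gamma (z + δ)‖ :=
    norm_pos_iff.2 (Complex.Gamma_ne_zero_of_re_pos hsum)
  rw [← Complex.ofReal_add, Complex.Gamma_ofReal, Complex.Gamma_ofReal, Complex.Gamma_ofReal,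
    Complex.norm_real, Complex.norm_real, Complex.norm_real,
    Real.norm_of_nonneg (Real.Gamma_pos_of_pos hz).le,
    Real.norm_of_nonneg (Real.Gamma_pos_of_pos (by linarith : 0 < z.re + δ)).le,
    div_le_div_iff₀ hspos (Real.Gamma_pos_of_pos (by linarith))] at hle
  have h2 := Real.Gamma_pos_of_pos (by linarith : 0 < z.re + δ)
  rw [div_mul_eq_mul_div, le_div_iff₀ h2]
  rw [Complex.Gamma_ofReal, Complex.norm_real] at hδpos
  have : ‖Complex.Gamma z‖ * Real.Gamma (z.re + δ) * ‖Real.Gamma δ‖ ≤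
      Real.Gamma z.re * ‖Complex.Gamma (z + δ)‖ * ‖Real.Gamma δ‖ := by linarith
  exact le_of_mul_le_mul_right this hδpos

theorem Gamma_add_natCast (s : ℂ) (n : ℕ) (hs : ∀ i < n, s + i ≠ 0) :
    Complex.Gamma (s + n) = (∏ i ∈ range n, (s + i)) * Complex.Gamma s := by
  induction n with
  | zero => simp
  | succ n ih =>
    rw [prod_range_succ, Nat.cast_succ, ← add_assoc,
      Complex.Gamma_add_one _ (hs n (Nat.lt_succ_self n)),
      ih fun i hi => hs i (hi.trans (Nat.lt_succ_self n))]
    ring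

theorem pow_le_const_mul_exp (m : ℕ) {ε : ℝ} (hε : 0 < ε) :
    ∃ C : ℝ, 0 < C ∧ ∀ t : ℝ, 0 ≤ t → t ^ m ≤ C * Real.exp (ε * t) := by
  refine ⟨(m.factorial : ℝ) / ε ^ m, by positivity, fun t ht => ?_⟩
  have h := Real.pow_div_factorial_le_exp (ε * t) (by positivity) m
  rw [mul_pow, div_le_iff₀ (by positivity)] at h
  rw [div_mul_eq_mul_div, le_div_iff₀ (by positivity)]
  linarith

/-- The exponential decay of `Γ` on vertical strips, a weak form of Stirling's formula. -/
theorem exists_norm_Gamma_le (A : ℕ) {ε : ℝ} (hε : 0 < ε) :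
    ∃ C : ℝ, 0 < C ∧ ∀ s : ℂ, |s.re| ≤ A → 1 ≤ |s.im| →
      ‖Complex.Gamma s‖ ≤ C * Real.exp ((ε - Real.pi / 2) * |s.im|) := by
  -- After moving to `1 ≤ Re s ≤ 2A + 1`, compare with the line `Re s = K + 1/2` further right,
  -- which the recurrence reduces to the critical line.
  set K : ℕ := 2 * A + 2 with hK
  obtain ⟨B, hB⟩ := (isCompact_Icc (a := (1 : ℝ)) (b := 2 * A + 1)).exists_bound_of_continuousOn
    (f := Real.Gamma) fun x hx => (Real.differentiableAt_Gamma
      fun m => by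
        have := hx.1
        have := m.cast_nonneg (α := ℝ)
        linarith).continuousAt.continuousWithinAt
  obtain ⟨C, hC, hCb⟩ := pow_le_const_mul_exp K hε
  have hB0 : 0 ≤ B := (norm_nonneg _).trans (hB 1 (by simp))
  have hGK : 0 < Real.Gamma (K + 1 / 2) := Real.Gamma_pos_of_pos (by positivity)
  refine ⟨(B + 1) / Real.Gamma (K + 1 / 2) * ((K + 1) ^ K * C * Real.sqrt (2 * Real.pi)),
    by positivity, fun s hs ht => ?_⟩
  rw [abs_le] at hs
  -- Move to the right of `Re s = 1` by the recurrence, which only increases the norm.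
  have hne : ∀ i : ℕ, s + i ≠ 0 := fun i h => by
    have : s.im = 0 := by simpa using congrArg Complex.im h
    rw [this, abs_zero] at ht
    linarith
  have h1 : ‖Complex.Gamma s‖ ≤ ‖Complex.Gamma (s + (A + 1 : ℕ))‖ := by
    rw [Gamma_add_natCast s (A + 1) fun i _ => hne i, norm_mul, norm_prod]
    refine le_mul_of_one_le_left (norm_nonneg _) ?_
    rw [← Finset.prod_const_one (s := range (A + 1)) (M := ℝ)]
    refine Finset.prod_le_prod (fun i _ => zero_le_one) fun i _ => ht.trans ?_
    have := Complex.abs_im_le_norm (s + i)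
    simpa using this
  set z : ℂ := s + (A + 1 : ℕ) with hz
  have hzre : z.re = s.re + (A + 1) := by simp [hz]
  have hzim : z.im = s.im := by simp [hz]
  have hz1 : 1 ≤ z.re := by rw [hzre]; linarith [hs.1]
  have hz2 : z.re ≤ 2 * A + 1 := by rw [hzre]; linarith [hs.2]
  have hKr : (K : ℝ) = 2 * A + 2 := by rw [hK]; push_cast; ring
  have h2 := norm_Gamma_le_mul_norm_Gamma_add (z := z) (by linarith)
    (δ := K + 1 / 2 - z.re) (by linarith)
  rw [show z.re + (K + 1 / 2 - z.re) = K + 1 / 2 by ring] at h2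
  have hzδ : z + ((K + 1 / 2 - z.re : ℝ) : ℂ) = (1 / 2 + (s.im : ℂ) * Complex.I) + (K : ℕ) := by
    apply Complex.ext <;> simp [hzim]; ring
  have hne2 : ∀ i < K, (1 / 2 + (s.im : ℂ) * Complex.I) + (i : ℕ) ≠ 0 := fun i _ h => by
    have : s.im = 0 := by simpa using congrArg Complex.im h
    rw [this, abs_zero] at ht
    linarith
  rw [hzδ, Gamma_add_natCast _ K hne2, norm_mul] at h2
  have h3 : ‖∏ i ∈ range K, ((1 / 2 + (s.im : ℂ) * Complex.I) + (i : ℕ))‖ ≤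
      ((K + 1) * |s.im|) ^ K := by
    rw [norm_prod]
    rw [← card_range K, ← Finset.prod_const, card_range K]
    refine Finset.prod_le_prod (fun i _ => norm_nonneg _) fun i hi => ?_
    have hi' : (i : ℝ) + 1 ≤ K := by exact_mod_cast mem_range.1 hi
    calc ‖(1 / 2 + (s.im : ℂ) * Complex.I) + (i : ℕ)‖
        ≤ ‖(1 / 2 + (s.im : ℂ) * Complex.I)‖ + ‖((i : ℕ) : ℂ)‖ := norm_add_le _ _
      _ ≤ (‖(1 / 2 : ℂ)‖ + ‖(s.im : ℂ) * Complex.I‖) + ‖((i : ℕ) : ℂ)‖ := by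
          gcongr; exact norm_add_le _ _
      _ = 1 / 2 + |s.im| + i := by simp
      _ ≤ (K + 1) * |s.im| := by nlinarith
  have h4 := norm_Gamma_half_add_mul_I_le s.im
  have h5 := hCb |s.im| (abs_nonneg _)
  calc ‖Complex.Gamma s‖ ≤ _ := h1
    _ ≤ _ := h2
    _ ≤ (B + 1) / Real.Gamma (K + 1 / 2) * (((K + 1) * |s.im|) ^ K *
          (Real.sqrt (2 * Real.pi) * Real.exp (-(Real.pi / 2 * |s.im|)))) := by
        gcongr
        have := hB z.re ⟨hz1, hz2⟩
        rw [Real.norm_eq_abs] at this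
        linarith [le_abs_self (Real.Gamma z.re)]
    _ ≤ (B + 1) / Real.Gamma (K + 1 / 2) * (((K + 1) ^ K * (C * Real.exp (ε * |s.im|))) *
          (Real.sqrt (2 * Real.pi) * Real.exp (-(Real.pi / 2 * |s.im|)))) := by
        rw [mul_pow]
        gcongr
    _ = _ := by
        rw [show (ε - Real.pi / 2) * |s.im| = ε * |s.im| + -(Real.pi / 2 * |s.im|) by ring,
          Real.exp_add]
        ring

/-- The bound for `1 / Γ` follows from that for `Γ` by the reflection formula. -/
theorem exists_norm_inv_Gamma_le (A : ℕ) {ε : ℝ} (hε : 0 < ε) :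
    ∃ C : ℝ, 0 < C ∧ ∀ s : ℂ, |s.re| ≤ A → 1 ≤ |s.im| →
      ‖(Complex.Gamma s)⁻¹‖ ≤ C * Real.exp ((ε + Real.pi / 2) * |s.im|) := by
  obtain ⟨C, hC, hb⟩ := exists_norm_Gamma_le (A + 1) hε
  refine ⟨C / Real.pi, by positivity, fun s hs ht => ?_⟩
  have him : s.im ≠ 0 := fun h => by rw [h, abs_zero] at ht; linarith
  have h0 : Complex.Gamma s ≠ 0 := Complex.Gamma_ne_zero fun m h => him (by simp [h])
  have h := Complex.Gamma_mul_Gamma_one_sub s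
  have h1 := hb (1 - s) (by
    rw [abs_le] at hs ⊢
    constructor <;> simp <;> linarith [hs.1, hs.2]) (by simpa using ht)
  have hsin : ‖Complex.sin (Real.pi * s)‖ ≤ Real.exp (Real.pi * |s.im|) := by
    rw [Complex.sin, norm_div, norm_mul, Complex.norm_I, mul_one, Complex.norm_ofNat]
    have e1 : ∀ z : ℂ, |z.re| ≤ Real.pi * |s.im| →
        ‖Complex.exp z‖ ≤ Real.exp (Real.pi * |s.im|) := fun z hz => by
      rw [Complex.norm_exp]
      exact Real.exp_le_exp.2 ((le_abs_self _).trans hz)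
    have := norm_sub_le (Complex.exp (-(Real.pi * s) * Complex.I))
      (Complex.exp (Real.pi * s * Complex.I))
    have a1 := e1 (-(Real.pi * s) * Complex.I) (by simp [abs_mul, abs_of_pos Real.pi_pos])
    have a2 := e1 (Real.pi * s * Complex.I) (by simp [abs_mul, abs_of_pos Real.pi_pos])
    linarith
  have hinv : (Complex.Gamma s)⁻¹ =
      Complex.Gamma (1 - s) * Complex.sin (Real.pi * s) / Real.pi := by
    have hs0 : Complex.sin (Real.pi * s) ≠ 0 := by
      intro h'
      rw [Complex.sin_eq_zero_iff] at h'
      obtain ⟨k, hk⟩ := h'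
      have := congrArg Complex.im hk
      simp [Real.pi_ne_zero, him] at this
    have hpi : (Real.pi : ℂ) ≠ 0 := by exact_mod_cast Real.pi_ne_zero
    rw [eq_div_iff hs0] at h
    rw [eq_div_iff hpi, inv_mul_eq_iff_eq_mul₀ h0]
    linear_combination -h
  rw [hinv, norm_div, norm_mul, Complex.norm_real, Real.norm_of_nonneg Real.pi_pos.le,
    div_le_iff₀ Real.pi_pos]
  rw [show |(1 - s).im| = |s.im| by simp] at h1
  calc _ ≤ (C * Real.exp ((ε - Real.pi / 2) * |s.im|)) * Real.exp (Real.pi * |s.im|) := by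
        gcongr
    _ = _ := by
        rw [mul_assoc, ← Real.exp_add, div_mul_eq_mul_div, div_mul_cancel₀ _ Real.pi_ne_zero]
        ring_nf

/-! ### Taylor series of analytic germs -/

/-- The Taylor series at the origin of a function of one complex variable. -/
def taylorAtZero (h : ℂ → ℂ) : PowerSeries ℂ :=
  PowerSeries.mk fun n => iteratedDeriv n h 0 / (n.factorial : ℂ)

theorem coeff_taylorAtZero (h : ℂ → ℂ) (n : ℕ) :
    PowerSeries.coeff n (taylorAtZero h) = iteratedDeriv n h 0 / (n.factorial : ℂ) :=
  PowerSeries.coeff_mk _ _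

theorem taylorAtZero_congr {f g : ℂ → ℂ} (h : f =ᶠ[𝓝 0] g) :
    taylorAtZero f = taylorAtZero g := by
  ext n
  rw [coeff_taylorAtZero, coeff_taylorAtZero, h.iteratedDeriv_eq]

theorem taylorAtZero_mul {f g : ℂ → ℂ} (hf : AnalyticAt ℂ f 0) (hg : AnalyticAt ℂ g 0) :
    taylorAtZero (fun P => f P * g P) = taylorAtZero f * taylorAtZero g := by
  ext n
  simp only [coeff_taylorAtZero, iteratedDeriv_fun_mul hf.contDiffAt hg.contDiffAt,
    PowerSeries.coeff_mul, Finset.Nat.sum_antidiagonal_eq_sum_range_succ_mk, Finset.sum_div]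
  refine Finset.sum_congr rfl fun i hi => ?_
  rw [Nat.cast_choose _ (by grind)]
  field_simp [Nat.factorial_ne_zero]

theorem taylorAtZero_const (c : ℂ) : taylorAtZero (fun _ => c) = PowerSeries.C c := by
  ext n
  rw [coeff_taylorAtZero, iteratedDeriv_const, PowerSeries.coeff_C]
  split_ifs with h <;> simp [h]

theorem taylorAtZero_id : taylorAtZero (fun P => P) = PowerSeries.X := by
  ext n
  rw [coeff_taylorAtZero, PowerSeries.coeff_X]
  match n with
  | 0 => simp
  | 1 => simp
  | n + 2 =>
    rw [iteratedDeriv_succ', deriv_id'', iteratedDeriv_const]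
    simp

theorem taylorAtZero_add {f g : ℂ → ℂ} (hf : AnalyticAt ℂ f 0) (hg : AnalyticAt ℂ g 0) :
    taylorAtZero (fun P => f P + g P) = taylorAtZero f + taylorAtZero g := by
  ext n
  rw [map_add, coeff_taylorAtZero, coeff_taylorAtZero, coeff_taylorAtZero,
    iteratedDeriv_fun_add hf.contDiffAt hg.contDiffAt, add_div]

theorem taylorAtZero_affine (c b : ℂ) :
    taylorAtZero (fun P => c * P + b) = PowerSeries.C c * PowerSeries.X + PowerSeries.C b := by
  rw [taylorAtZero_add (by fun_prop) (by fun_prop), taylorAtZero_mul (by fun_prop) (by fun_prop),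
    taylorAtZero_const, taylorAtZero_const, taylorAtZero_id]

theorem taylorAtZero_exp (a : ℂ) :
    taylorAtZero (fun P => Complex.exp (a * P)) =
      PowerSeries.rescale a (PowerSeries.exp ℂ) := by
  ext n
  rw [coeff_taylorAtZero, PowerSeries.coeff_rescale, PowerSeries.coeff_exp,
    iteratedDeriv_comp_const_mul Complex.contDiff_exp, iteratedDeriv_eq_iterate,
    Complex.iter_deriv_exp]
  simp [div_eq_mul_inv]

theorem taylorAtZero_prod {ι : Type*} (s : Finset ι) {f : ι → ℂ → ℂ}
    (hf : ∀ i ∈ s, AnalyticAt ℂ (f i) 0) :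
    taylorAtZero (fun P => ∏ i ∈ s, f i P) = ∏ i ∈ s, taylorAtZero (f i) := by
  classical
  induction s using Finset.induction_on with
  | empty => simpa using taylorAtZero_const 1
  | insert i s hi ih =>
    simp only [Finset.prod_insert hi]
    rw [taylorAtZero_mul (hf i (mem_insert_self _ _))
      (Finset.analyticAt_fun_prod _ fun j hj => hf j (mem_insert_of_mem hj)),
      ih fun j hj => hf j (mem_insert_of_mem hj)]

theorem taylorAtZero_inv {f : ℂ → ℂ} (hf : AnalyticAt ℂ f 0) (h0 : f 0 ≠ 0) :
    taylorAtZero (fun P => (f P)⁻¹) = (taylorAtZero f)⁻¹ := by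
  have hc : PowerSeries.constantCoeff (taylorAtZero f) ≠ 0 := by
    rw [← PowerSeries.coeff_zero_eq_constantCoeff_apply, coeff_taylorAtZero]
    simpa using h0
  rw [PowerSeries.eq_inv_iff_mul_eq_one hc,
    ← taylorAtZero_mul (f := fun P => (f P)⁻¹) (hf.inv h0) hf]
  rw [taylorAtZero_congr (g := fun _ => 1), taylorAtZero_const, map_one]
  filter_upwards [hf.continuousAt.eventually_ne h0] with P hP
  exact inv_mul_cancel₀ hP

theorem norm_coeff_taylorAtZero_le {f : ℂ → ℂ} {R C : ℝ} (hR : 0 < R)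
    (hf : DifferentiableOn ℂ f (Metric.closedBall 0 R))
    (hC : ∀ z ∈ Metric.sphere (0 : ℂ) R, ‖f z‖ ≤ C) (n : ℕ) :
    ‖PowerSeries.coeff n (taylorAtZero f)‖ ≤ C / R ^ n := by
  have h := Complex.norm_iteratedDeriv_le_of_forall_mem_sphere_norm_le n hR
    (hf.diffContOnCl_ball subset_rfl) hC
  rw [coeff_taylorAtZero, norm_div, Complex.norm_natCast, div_le_iff₀ (by positivity)]
  calc _ ≤ _ := h
    _ = _ := by ring

theorem coeff_succ_taylorAtZero {f : ℂ → ℂ} (hf : AnalyticAt ℂ f 0) (n : ℕ) :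
    PowerSeries.coeff (n + 1) (taylorAtZero f) =
      PowerSeries.coeff n (taylorAtZero (dslope f 0)) := by
  have hd : AnalyticAt ℂ (dslope f 0) 0 := by
    obtain ⟨s, hs, hsd⟩ := hf.eventually_analyticAt.exists_mem
    exact ((Complex.differentiableOn_dslope hs).2 fun z hz =>
      (hsd z hz).differentiableAt.differentiableWithinAt).analyticAt hs
  have : f = fun P => f 0 + P * dslope f 0 P := by
    funext P
    have := sub_smul_dslope f 0 P
    simp only [sub_zero, smul_eq_mul] at this
    rw [this]; ring
  conv_lhs => rw [this]
  rw [taylorAtZero_add (by fun_prop) (by fun_prop), taylorAtZero_mul (by fun_prop) hd,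
    taylorAtZero_const, taylorAtZero_id, map_add, PowerSeries.coeff_succ_X_mul,
    PowerSeries.coeff_C]
  simp

/-! ### Moving a vertical line of integration -/

/-- The function `g` tends to zero at the two ends of the strip `|Re s| ≤ δ`, uniformly in
`Re s`. -/
def VanishesAtStripEnds (δ : ℝ) (g : ℂ → ℂ) : Prop :=
  ∀ ε > 0, ∀ᶠ T : ℝ in atTop, ∀ σ : ℝ, |σ| ≤ δ →
    ‖g (σ + T * Complex.I)‖ ≤ ε ∧ ‖g (σ + (-T : ℝ) * Complex.I)‖ ≤ ε

/-- The integral of `g` over the segment from `σ - iT` to `σ + iT`, divided by `i`. -/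
def verticalIntegral (g : ℂ → ℂ) (σ T : ℝ) : ℂ := ∫ τ in (-T)..T, g (σ + τ * Complex.I)

/-- Cauchy's theorem on a strip. -/
theorem tendsto_verticalIntegral_sub_of_holomorphic {δ : ℝ} (hδ : 0 < δ) {g : ℂ → ℂ}
    (hg : DifferentiableOn ℂ g {s | |s.re| ≤ δ}) (hv : VanishesAtStripEnds δ g) :
    Tendsto (fun T => verticalIntegral g δ T - verticalIntegral g (-δ) T) atTop (𝓝 0) := by
  rw [Metric.tendsto_nhds]
  intro ε hε
  filter_upwards [hv (ε / (8 * δ)) (by positivity)] with T hT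
  have hrect := Complex.integral_boundary_rect_eq_zero_of_differentiableOn g
    (-δ + (-T : ℝ) * Complex.I) (δ + T * Complex.I) (hg.mono (by
      intro s hs
      rw [Complex.mem_reProdIm] at hs
      have := hs.1
      simp only [Complex.add_re, Complex.neg_re, Complex.ofReal_re, Complex.mul_re, Complex.I_re,
        mul_zero, Complex.ofReal_im, Complex.I_im, mul_one, sub_self, add_zero] at this
      rw [Set.uIcc_of_le (by linarith)] at this
      exact abs_le.2 this))
  simp only [Complex.add_re, Complex.neg_re, Complex.ofReal_re, Complex.mul_re, Complex.I_re,
    mul_zero, Complex.ofReal_im, Complex.I_im, mul_one, sub_self, add_zero, Complex.add_im,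
    Complex.neg_im, neg_zero, Complex.mul_im, zero_add, smul_eq_mul] at hrect
  have b1 : ‖∫ x in (-δ)..δ, g (x + (-T : ℝ) * Complex.I)‖ ≤ ε / (8 * δ) * |δ - -δ| :=
    intervalIntegral.norm_integral_le_of_norm_le_const fun x hx => (hT x (by
      rw [Set.uIoc_of_le (by linarith)] at hx
      exact abs_le.2 ⟨hx.1.le, hx.2⟩)).2
  have b2 : ‖∫ x in (-δ)..δ, g (x + T * Complex.I)‖ ≤ ε / (8 * δ) * |δ - -δ| :=
    intervalIntegral.norm_integral_le_of_norm_le_const fun x hx => (hT x (by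
      rw [Set.uIoc_of_le (by linarith)] at hx
      exact abs_le.2 ⟨hx.1.le, hx.2⟩)).1
  have e : ε / (8 * δ) * |δ - -δ| = ε / 4 := by
    rw [sub_neg_eq_add, abs_of_pos (by linarith)]; field_simp; norm_num
  rw [e] at b1 b2
  rw [dist_zero_right]
  have key : Complex.I * (verticalIntegral g δ T - verticalIntegral g (-δ) T) =
      (∫ x in (-δ)..δ, g (x + T * Complex.I)) -
        ∫ x in (-δ)..δ, g (x + (-T : ℝ) * Complex.I) := by
    unfold verticalIntegral
    push_cast at hrect ⊢
    linear_combination hrect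
  have := congrArg norm key
  rw [norm_mul, Complex.norm_I, one_mul] at this
  rw [this]
  linarith [norm_sub_le (∫ x in (-δ)..δ, g (x + T * Complex.I))
    (∫ x in (-δ)..δ, g (x + (-T : ℝ) * Complex.I))]

theorem line_ne_zero {σ : ℝ} (hσ : σ ≠ 0) (τ : ℝ) : (σ : ℂ) + τ * Complex.I ≠ 0 := fun h =>
  hσ (by simpa using congrArg Complex.re h)

theorem tendsto_verticalIntegral_sub_inv {δ : ℝ} (hδ : 0 < δ) :
    Tendsto (fun T => verticalIntegral (fun s => s⁻¹) δ T -
      verticalIntegral (fun s => s⁻¹) (-δ) T) atTop (𝓝 (2 * Real.pi)) := by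
  have hc : ∀ σ : ℝ, σ ≠ 0 → Continuous fun τ : ℝ => ((σ : ℂ) + τ * Complex.I)⁻¹ := fun σ hσ =>
    Continuous.inv₀ (by fun_prop) (line_ne_zero hσ)
  have key : ∀ T : ℝ, verticalIntegral (fun s => s⁻¹) δ T -
      verticalIntegral (fun s => s⁻¹) (-δ) T =
      ((2 * (Real.arctan (T / δ) - Real.arctan (-T / δ)) : ℝ) : ℂ) := by
    intro T
    unfold verticalIntegral
    have hn : -δ ≠ 0 := by linarith
    rw [← intervalIntegral.integral_sub ((hc δ hδ.ne').intervalIntegrable _ _)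
      ((hc (-δ) hn).intervalIntegrable _ _)]
    have : ∀ τ : ℝ, ((δ : ℂ) + τ * Complex.I)⁻¹ - (((-δ : ℝ) : ℂ) + τ * Complex.I)⁻¹ =
        ((2 * ((1 / (1 + (τ / δ) ^ 2)) * (1 / δ)) : ℝ) : ℂ) := by
      intro τ
      have h1 := line_ne_zero hδ.ne' τ
      have h2 := line_ne_zero hn τ
      have h3 : (δ : ℂ) ≠ 0 := by exact_mod_cast hδ.ne'
      have h4 : (1 : ℂ) + (τ / δ) ^ 2 ≠ 0 := by
        have : (1 : ℝ) + (τ / δ) ^ 2 ≠ 0 := by positivity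
        exact_mod_cast this
      have h5 : ((δ : ℂ) + τ * Complex.I) * (((-δ : ℝ) : ℂ) + τ * Complex.I) =
          -(δ ^ 2 * (1 + (τ / δ) ^ 2)) := by
        push_cast
        field_simp
        linear_combination (τ : ℂ) ^ 2 * Complex.I_sq
      rw [inv_sub_inv h1 h2, h5]
      push_cast
      field_simp
      ring
    simp_rw [this]
    rw [intervalIntegral.integral_ofReal, intervalIntegral.integral_const_mul]
    congr 2
    refine intervalIntegral.integral_eq_sub_of_hasDerivAt (f := fun x => Real.arctan (x / δ))
      (fun x _ => ((hasDerivAt_id x).div_const δ).arctan) ?_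
    refine Continuous.intervalIntegrable ?_ _ _
    refine Continuous.mul (Continuous.div (by fun_prop) (by fun_prop) fun x => ?_) (by fun_prop)
    positivity
  simp_rw [key]
  have h1 : Tendsto (fun T : ℝ => Real.arctan (T / δ)) atTop (𝓝 (Real.pi / 2)) :=
    (Real.tendsto_arctan_atTop.mono_right nhdsWithin_le_nhds).comp
      (tendsto_id.atTop_div_const hδ)
  have h2 : Tendsto (fun T : ℝ => 2 * (Real.arctan (T / δ) - Real.arctan (-T / δ))) atTop
      (𝓝 (2 * (Real.pi / 2 - -(Real.pi / 2)))) := by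
    simp_rw [neg_div, Real.arctan_neg]
    exact (h1.sub h1.neg).const_mul 2
  have := (Complex.continuous_ofReal.tendsto _).comp h2
  convert! this using 2
  push_cast; ring

theorem tendsto_verticalIntegral_inv_pow {σ : ℝ} (hσ : σ ≠ 0) (k : ℕ) :
    Tendsto (fun T => verticalIntegral (fun s => (s ^ (k + 2))⁻¹) σ T) atTop (𝓝 0) := by
  have hder : ∀ τ : ℝ, HasDerivAt
      (fun τ : ℝ => (Complex.I / (k + 1)) * ((((σ : ℂ) + τ * Complex.I) ^ (k + 1))⁻¹))
      (((σ : ℂ) + τ * Complex.I) ^ (k + 2))⁻¹ τ := by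
    intro τ
    have h1 : HasDerivAt (fun τ : ℝ => (σ : ℂ) + τ * Complex.I) Complex.I τ := by
      simpa using ((Complex.ofRealCLM.hasDerivAt (x := τ)).mul_const Complex.I).const_add (σ : ℂ)
    have h0 := line_ne_zero hσ τ
    have h2 := ((h1.fun_pow (k + 1)).fun_inv (pow_ne_zero _ h0)).const_mul (Complex.I / (k + 1))
    refine h2.congr_deriv ?_
    have hk : (k : ℂ) + 1 ≠ 0 := by exact_mod_cast Nat.succ_ne_zero k
    simp only [Nat.add_sub_cancel]
    generalize (σ : ℂ) + τ * Complex.I = L at h0 ⊢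
    push_cast
    field_simp
    linear_combination (-(L ^ 2 * L ^ (k * 2))) * Complex.I_sq
  have heq : ∀ T : ℝ, verticalIntegral (fun s => (s ^ (k + 2))⁻¹) σ T =
      (Complex.I / (k + 1)) * ((((σ : ℂ) + T * Complex.I) ^ (k + 1))⁻¹) -
      (Complex.I / (k + 1)) * ((((σ : ℂ) + (-T : ℝ) * Complex.I) ^ (k + 1))⁻¹) := fun T =>
    intervalIntegral.integral_eq_sub_of_hasDerivAt (fun x _ => hder x)
      ((Continuous.inv₀ (by fun_prop) fun τ =>
        pow_ne_zero _ (line_ne_zero hσ τ)).intervalIntegrable _ _)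
  have hlim : ∀ f : ℝ → ℝ, Tendsto (fun T => |f T|) atTop atTop →
      Tendsto (fun T : ℝ => (Complex.I / (k + 1)) * ((((σ : ℂ) + f T * Complex.I) ^ (k + 1))⁻¹))
        atTop (𝓝 0) := by
    intro f hf
    have : Tendsto (fun T : ℝ => ((((σ : ℂ) + f T * Complex.I) ^ (k + 1))⁻¹)) atTop (𝓝 0) := by
      refine tendsto_inv₀_cobounded.comp ?_
      rw [← tendsto_norm_atTop_iff_cobounded]
      simp_rw [norm_pow]
      refine (tendsto_pow_atTop (Nat.succ_ne_zero k)).comp ?_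
      refine tendsto_atTop_mono (fun T => ?_) hf
      have := Complex.abs_im_le_norm ((σ : ℂ) + f T * Complex.I)
      simpa using this
    simpa using this.const_mul (Complex.I / (k + 1))
  simp_rw [heq]
  simpa using (hlim id (by simpa using tendsto_abs_atTop_atTop)).sub
    (hlim (fun T => -T) (by simpa using tendsto_abs_atTop_atTop))

theorem vanishesAtStripEnds_inv_pow (δ : ℝ) (k : ℕ) (c : ℂ) :
    VanishesAtStripEnds δ fun s => c * (s ^ (k + 1))⁻¹ := by
  intro ε hε
  filter_upwards [eventually_ge_atTop 1, eventually_ge_atTop (‖c‖ / ε)] with T h1 h2 σ hσ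
  have main : ∀ s : ℂ, T ≤ ‖s‖ → ‖c * (s ^ (k + 1))⁻¹‖ ≤ ε := by
    intro s hs
    rw [norm_mul, norm_inv, norm_pow]
    have hs' : T ≤ ‖s‖ ^ (k + 1) := hs.trans (le_self_pow₀ (h1.trans hs) (Nat.succ_ne_zero k))
    rw [← div_eq_mul_inv, div_le_iff₀ (by linarith)]
    rw [div_le_iff₀ hε] at h2
    nlinarith
  constructor <;> refine main _ ?_
  · have := Complex.abs_im_le_norm ((σ : ℂ) + T * Complex.I)
    simp at this
    exact (le_abs_self T).trans this
  · have := Complex.abs_im_le_norm ((σ : ℂ) + (-T : ℝ) * Complex.I)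
    simp at this ⊢
    exact (le_abs_self T).trans this

/-- The residue theorem on a strip for a function with a single pole, of order at most `p`: moving
the line of integration from `Re s = -δ` to `Re s = δ` adds the residue. -/
theorem tendsto_verticalIntegral_sub {δ : ℝ} (hδ : 0 < δ) (p : ℕ) {h : ℂ → ℂ}
    (hh : DifferentiableOn ℂ h {s | |s.re| ≤ δ})
    (hv : VanishesAtStripEnds δ fun s => h s / s ^ p) :
    Tendsto (fun T => verticalIntegral (fun s => h s / s ^ p) δ T -
      verticalIntegral (fun s => h s / s ^ p) (-δ) T) atTop
      (𝓝 (if p = 0 then 0 else 2 * Real.pi * PowerSeries.coeff (p - 1) (taylorAtZero h))) := by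
  induction p generalizing h with
  | zero =>
    simp only [pow_zero, div_one] at hv ⊢
    exact tendsto_verticalIntegral_sub_of_holomorphic hδ hh hv
  | succ p ih =>
    have hnhds : {s : ℂ | |s.re| ≤ δ} ∈ 𝓝 (0 : ℂ) := by
      have : ContinuousAt (fun s : ℂ => |s.re|) 0 := by fun_prop
      filter_upwards [this.eventually_lt_const (show |(0 : ℂ).re| < δ by simpa)] with s hs
      exact hs.le
    have hd := (Complex.differentiableOn_dslope hnhds).2 hh
    -- Split off the leading term of the principal part.
    have hsplit : ∀ s : ℂ, s ≠ 0 →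
        h s / s ^ (p + 1) = h 0 * (s ^ (p + 1))⁻¹ + dslope h 0 s / s ^ p := by
      intro s hs
      have := sub_smul_dslope h 0 s
      simp only [sub_zero, smul_eq_mul] at this
      field_simp
      linear_combination (-(s ^ p)) * this
    have hv' : VanishesAtStripEnds δ fun s => dslope h 0 s / s ^ p := by
      intro ε hε
      filter_upwards [hv (ε / 2) (by positivity),
        vanishesAtStripEnds_inv_pow δ p (h 0) (ε / 2) (by positivity),
        eventually_gt_atTop 0] with T h1 h2 hT σ hσ
      have main : ∀ s : ℂ, s ≠ 0 → ‖h s / s ^ (p + 1)‖ ≤ ε / 2 →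
          ‖h 0 * (s ^ (p + 1))⁻¹‖ ≤ ε / 2 → ‖dslope h 0 s / s ^ p‖ ≤ ε := by
        intro s hs a b
        rw [← sub_eq_iff_eq_add'.2 (hsplit s hs)]
        linarith [norm_sub_le (h s / s ^ (p + 1)) (h 0 * (s ^ (p + 1))⁻¹)]
      refine ⟨main _ (fun h0 => ?_) (h1 σ hσ).1 (h2 σ hσ).1,
        main _ (fun h0 => ?_) (h1 σ hσ).2 (h2 σ hσ).2⟩
      · exact hT.ne' (by simpa using congrArg Complex.im h0)
      · exact hT.ne' (by simpa using congrArg Complex.im h0)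
    have hih := ih hd hv'
    have hline : ∀ σ : ℝ, |σ| ≤ δ → Continuous fun τ : ℝ => dslope h 0 (σ + τ * Complex.I) :=
      fun σ hσ => hd.continuousOn.comp_continuous (by fun_prop) fun τ => by simpa using hσ
    have hint : ∀ σ : ℝ, σ ≠ 0 → |σ| ≤ δ → ∀ T : ℝ,
        verticalIntegral (fun s => h s / s ^ (p + 1)) σ T =
          h 0 * verticalIntegral (fun s => (s ^ (p + 1))⁻¹) σ T +
            verticalIntegral (fun s => dslope h 0 s / s ^ p) σ T := by
      intro σ hσ hσδ T
      unfold verticalIntegral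
      rw [← intervalIntegral.integral_const_mul, ← intervalIntegral.integral_add]
      · exact intervalIntegral.integral_congr fun τ _ => hsplit _ (line_ne_zero hσ τ)
      · exact (Continuous.mul continuous_const (Continuous.inv₀ (by fun_prop) fun τ =>
          pow_ne_zero _ (line_ne_zero hσ τ))).intervalIntegrable _ _
      · exact (Continuous.div (hline σ hσδ) (by fun_prop) fun τ =>
          pow_ne_zero _ (line_ne_zero hσ τ)).intervalIntegrable _ _
    have hn : -δ ≠ 0 := by linarith
    simp_rw [hint δ hδ.ne' (abs_of_pos hδ).le, hint (-δ) hn (by rw [abs_neg, abs_of_pos hδ])]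
    have hfirst : Tendsto (fun T => verticalIntegral (fun s => (s ^ (p + 1))⁻¹) δ T -
        verticalIntegral (fun s => (s ^ (p + 1))⁻¹) (-δ) T) atTop
        (𝓝 (if p = 0 then 2 * Real.pi else 0)) := by
      match p with
      | 0 => simpa using tendsto_verticalIntegral_sub_inv hδ
      | p + 1 =>
        simpa using (tendsto_verticalIntegral_inv_pow hδ.ne' p).sub
          (tendsto_verticalIntegral_inv_pow hn p)
    have := (hfirst.const_mul (h 0)).add hih
    refine (this.congr fun T => by ring).trans_eq ?_
    congr 1
    have han : AnalyticAt ℂ h 0 := hh.analyticAt hnhds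
    match p with
    | 0 => simp [coeff_taylorAtZero, mul_comm]
    | p + 1 => simp [coeff_succ_taylorAtZero han]

/-! ### The ratio of Gamma functions in the Barnes integrand -/

/-- The Fano index `r = ∑ w_j - d`. -/
def fanoIndex {N : ℕ} (d : ℕ) (w : Fin N → ℕ) : ℝ := (∑ j, (w j : ℝ)) - d

/-- `∏_j ∏_{0 ≤ i < w_j} (w_j s - i)`, the indicial polynomial at `q = 0` of the hypergeometric
differential equation satisfied by the Gromov-Witten I-function. -/
def weightPoly {N : ℕ} (w : Fin N → ℕ) : Polynomial ℂ :=
  ∏ j, ∏ i ∈ range (w j), (Polynomial.C (w j : ℂ) * Polynomial.X - Polynomial.C (i : ℂ))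

/-- `∏_{0 < i ≤ d} (d s + i)`, the indicial polynomial at `q = ∞` of the hypergeometric
differential equation. -/
def degreePoly (d : ℕ) : Polynomial ℂ :=
  ∏ i ∈ range d, (Polynomial.C (d : ℂ) * Polynomial.X + Polynomial.C ((i : ℂ) + 1))

theorem eval_weightPoly {N : ℕ} (w : Fin N → ℕ) (s : ℂ) :
    (weightPoly w).eval s = ∏ j, ∏ i ∈ range (w j), ((w j : ℂ) * s - i) := by
  simp [weightPoly, Polynomial.eval_prod]

theorem eval_degreePoly (d : ℕ) (s : ℂ) :
    (degreePoly d).eval s = ∏ i ∈ range d, ((d : ℂ) * s + (i + 1)) := by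
  simp [degreePoly, Polynomial.eval_prod]

/-- The factors `d (s - 1) + i`, `0 < i ≤ d`, are the factors `d s - i`, `0 ≤ i < d`. -/
theorem eval_degreePoly_sub_one (d : ℕ) (s : ℂ) :
    (degreePoly d).eval (s - 1) = ∏ i ∈ range d, ((d : ℂ) * s - i) := by
  rw [eval_degreePoly, ← Finset.prod_range_reflect]
  refine Finset.prod_congr rfl fun i hi => ?_
  have h : i + 1 ≤ d := mem_range.1 hi
  rw [Nat.sub_sub, add_comm 1 i, Nat.cast_sub h]
  push_cast
  ring

/-- `e^{iπrs} ∏_j Γ(-w_j s) / Γ(-d s)`. The exponential makes the recurrence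
`gammaRatio_recurrence` free of signs. -/
def gammaRatio {N : ℕ} (d : ℕ) (w : Fin N → ℕ) (s : ℂ) : ℂ :=
  Complex.exp (Real.pi * Complex.I * fanoIndex d w * s) *
    (∏ j, Complex.Gamma (-((w j : ℂ) * s))) * (Complex.Gamma (-((d : ℂ) * s)))⁻¹

theorem exp_pi_I_mul_fanoIndex {N : ℕ} (d : ℕ) (w : Fin N → ℕ) :
    Complex.exp (Real.pi * Complex.I * fanoIndex d w) = (∏ j, (-1 : ℂ) ^ w j) * (-1) ^ d := by
  have h1 : (Real.pi * Complex.I * fanoIndex d w : ℂ) =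
      ((∑ j, w j : ℕ) : ℂ) * (Real.pi * Complex.I) - (d : ℂ) * (Real.pi * Complex.I) := by
    simp [fanoIndex]; ring
  rw [h1, Complex.exp_sub, Complex.exp_nat_mul, Complex.exp_nat_mul, Complex.exp_pi_mul_I,
    Finset.prod_pow_eq_pow_sum, div_eq_mul_inv, ← inv_pow]
  norm_num

theorem prod_neg_sub (n : ℕ) (a : ℂ) :
    ∏ i ∈ range n, (-a + (i : ℂ)) = (-1) ^ n * ∏ i ∈ range n, (a - i) := by
  rw [← card_range n, ← Finset.prod_const, card_range, ← Finset.prod_mul_distrib]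
  exact Finset.prod_congr rfl fun i _ => by ring

/-- `Γ(k - a)` in terms of `Γ(-a)`. -/
theorem Gamma_natCast_sub (k : ℕ) (a : ℂ) (h : ∀ i < k, a ≠ i) :
    Complex.Gamma (k - a) = (-1) ^ k * (∏ i ∈ range k, (a - i)) * Complex.Gamma (-a) := by
  rw [show (k : ℂ) - a = -a + k by ring, Gamma_add_natCast, prod_neg_sub]
  exact fun i hi h' => h i hi (by linear_combination -h')

theorem mul_ne_natCast_of_dvd {c d : ℕ} (hc : c ∣ d) (hd : 0 < d) {s : ℂ}
    (hs : ∀ i < d, (d : ℂ) * s ≠ i) : ∀ i < c, (c : ℂ) * s ≠ i := by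
  obtain ⟨e, rfl⟩ := hc
  have he : 0 < e := Nat.pos_of_mul_pos_left hd |> fun h => h
  intro i hi h
  refine hs (e * i) (by nlinarith) ?_
  push_cast
  linear_combination (e : ℂ) * h

/-- The recurrence satisfied by the coefficients of formal solutions `∑ c(s) q^s` of the
hypergeometric equation. -/
theorem gammaRatio_recurrence {N : ℕ} {d : ℕ} {w : Fin N → ℕ} (hd : 0 < d)
    (hdvd : ∀ j, w j ∣ d) {s : ℂ} (hs : ∀ i < d, (d : ℂ) * s ≠ i) :
    (weightPoly w).eval s * gammaRatio d w s =
      (degreePoly d).eval (s - 1) * gammaRatio d w (s - 1) := by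
  have h1 : ∀ j, Complex.Gamma (-((w j : ℂ) * (s - 1))) =
      (-1) ^ w j * (∏ i ∈ range (w j), ((w j : ℂ) * s - i)) *
        Complex.Gamma (-((w j : ℂ) * s)) := fun j => by
    rw [← Gamma_natCast_sub _ _ (mul_ne_natCast_of_dvd (hdvd j) hd hs)]
    ring_nf
  have h2 : Complex.Gamma (-((d : ℂ) * (s - 1))) =
      (-1) ^ d * (∏ i ∈ range d, ((d : ℂ) * s - i)) * Complex.Gamma (-((d : ℂ) * s)) := by
    rw [← Gamma_natCast_sub _ _ hs]
    ring_nf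
  have h3 : Complex.exp (Real.pi * Complex.I * fanoIndex d w * s) =
      Complex.exp (Real.pi * Complex.I * fanoIndex d w * (s - 1)) *
        ((∏ j, (-1 : ℂ) ^ w j) * (-1) ^ d) := by
    rw [← exp_pi_I_mul_fanoIndex, ← Complex.exp_add]
    ring_nf
  have hne : ∏ i ∈ range d, ((d : ℂ) * s - i) ≠ 0 :=
    Finset.prod_ne_zero_iff.2 fun i hi => sub_ne_zero.2 (hs i (mem_range.1 hi))
  unfold gammaRatio
  simp_rw [h1]
  rw [h2, h3, eval_weightPoly, eval_degreePoly_sub_one, Finset.prod_mul_distrib,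
    Finset.prod_mul_distrib, mul_inv, mul_inv]
  have hs2 : ((-1 : ℂ) ^ d)⁻¹ = (-1) ^ d := by rw [← inv_pow]; norm_num
  rw [hs2]
  generalize ∏ i ∈ range d, ((d : ℂ) * s - i) = Q at hne ⊢
  generalize (Complex.Gamma (-((d : ℂ) * s)))⁻¹ = Γd
  generalize ∏ j, ∏ i ∈ range (w j), ((w j : ℂ) * s - i) = V
  generalize ∏ j, Complex.Gamma (-((w j : ℂ) * s)) = Γw
  field_simp

theorem differentiableAt_gammaRatio {N : ℕ} (d : ℕ) {w : Fin N → ℕ} {s : ℂ}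
    (hs : ∀ j, ∀ m : ℕ, (w j : ℂ) * s ≠ m) : DifferentiableAt ℂ (gammaRatio d w) s := by
  unfold gammaRatio
  refine DifferentiableAt.mul (DifferentiableAt.mul (by fun_prop) ?_) ?_
  · refine DifferentiableAt.fun_finsetProd fun j _ => ?_
    refine DifferentiableAt.comp s (Complex.differentiableAt_Gamma _ fun m h => ?_) (by fun_prop)
    exact hs j m (neg_injective h)
  · exact DifferentiableAt.comp s (f := fun s : ℂ => -((d : ℂ) * s))
      (g := fun z => (Complex.Gamma z)⁻¹)
      Complex.differentiable_one_div_Gamma.differentiableAt (by fun_prop)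

theorem gammaRatio_ne_zero {N : ℕ} {d : ℕ} {w : Fin N → ℕ} (hd : 0 < d) (hw : ∀ j, 0 < w j)
    {s : ℂ} (hs : s.re < 0) : gammaRatio d w s ≠ 0 := by
  have : ∀ c : ℕ, 0 < c → Complex.Gamma (-((c : ℂ) * s)) ≠ 0 := fun c hc => by
    refine Complex.Gamma_ne_zero_of_re_pos ?_
    have : (0 : ℝ) < c := by exact_mod_cast hc
    simp
    nlinarith
  exact mul_ne_zero (mul_ne_zero (Complex.exp_ne_zero _)
    (Finset.prod_ne_zero_iff.2 fun j _ => this _ (hw j))) (inv_ne_zero (this d hd))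

theorem exists_norm_Gamma_natCast_mul_le {c : ℕ} (hc : 0 < c) (A : ℕ) {ε : ℝ} (hε : 0 < ε) :
    ∃ C : ℝ, 0 < C ∧ ∀ s : ℂ, |s.re| ≤ A → 1 ≤ |s.im| →
      ‖Complex.Gamma (-((c : ℂ) * s))‖ ≤ C * Real.exp (c * ((ε - Real.pi / 2) * |s.im|)) ∧
      ‖(Complex.Gamma (-((c : ℂ) * s)))⁻¹‖ ≤
        C * Real.exp (c * ((ε + Real.pi / 2) * |s.im|)) := by
  obtain ⟨C₁, h₁, b₁⟩ := exists_norm_Gamma_le (c * A) hε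
  obtain ⟨C₂, h₂, b₂⟩ := exists_norm_inv_Gamma_le (c * A) hε
  refine ⟨C₁ + C₂, by positivity, fun s hs ht => ?_⟩
  have hc' : (1 : ℝ) ≤ c := by exact_mod_cast hc
  have e1 : |(-((c : ℂ) * s)).re| ≤ (c * A : ℕ) := by
    simp [abs_mul]; gcongr
  have e2 : |(-((c : ℂ) * s)).im| = c * |s.im| := by simp [abs_mul]
  have e3 : 1 ≤ |(-((c : ℂ) * s)).im| := by rw [e2]; nlinarith
  have a1 := b₁ _ e1 e3
  have a2 := b₂ _ e1 e3
  rw [e2, mul_left_comm] at a1 a2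
  constructor
  · refine a1.trans ?_; gcongr; linarith
  · refine a2.trans ?_; gcongr; linarith

/-- Exponential decay and growth of `gammaRatio` and its inverse in vertical strips. -/
theorem exists_norm_gammaRatio_le {N : ℕ} {d : ℕ} {w : Fin N → ℕ} (hd : 0 < d)
    (hw : ∀ j, 0 < w j) (A : ℕ) {ε : ℝ} (hε : 0 < ε) :
    ∃ C : ℝ, 0 < C ∧ ∀ s : ℂ, |s.re| ≤ A → 1 ≤ |s.im| →
      ‖gammaRatio d w s‖ ≤ C * Real.exp (-(Real.pi * fanoIndex d w * s.im) +
        (ε - Real.pi / 2 * fanoIndex d w) * |s.im|) ∧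
      ‖(gammaRatio d w s)⁻¹‖ ≤ C * Real.exp (Real.pi * fanoIndex d w * s.im +
        (ε + Real.pi / 2 * fanoIndex d w) * |s.im|) := by
  set S : ℝ := ∑ j, (w j : ℝ) with hS
  have hS0 : 0 ≤ S := Finset.sum_nonneg fun j _ => Nat.cast_nonneg _
  have hd' : (0 : ℝ) < d := by exact_mod_cast hd
  set ε' : ℝ := ε / (S + d) with hε'
  have hε'0 : 0 < ε' := by positivity
  have hεeq : ε' * (S + d) = ε := by rw [hε']; field_simp
  choose C hC hb using fun j => exists_norm_Gamma_natCast_mul_le (hw j) A hε'0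
  obtain ⟨C', hC', hb'⟩ := exists_norm_Gamma_natCast_mul_le hd A hε'0
  have hP : 0 < ∏ j, C j := Finset.prod_pos fun j _ => hC j
  refine ⟨(∏ j, C j) * C', by positivity, fun s hs ht => ?_⟩
  have hexp : ‖Complex.exp (Real.pi * Complex.I * fanoIndex d w * s)‖ =
      Real.exp (-(Real.pi * fanoIndex d w * s.im)) := by
    rw [Complex.norm_exp]
    congr 1
    simp
  have hfano : fanoIndex d w = S - d := rfl
  constructor
  · have h1 : ‖∏ j, Complex.Gamma (-((w j : ℂ) * s))‖ ≤
        (∏ j, C j) * Real.exp (S * ((ε' - Real.pi / 2) * |s.im|)) := by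
      rw [norm_prod, hS, Finset.sum_mul, Real.exp_sum, ← Finset.prod_mul_distrib]
      exact Finset.prod_le_prod (fun j _ => norm_nonneg _) fun j _ => (hb j s hs ht).1
    unfold gammaRatio
    rw [norm_mul, norm_mul, hexp]
    calc _ ≤ Real.exp (-(Real.pi * fanoIndex d w * s.im)) *
          ((∏ j, C j) * Real.exp (S * ((ε' - Real.pi / 2) * |s.im|))) *
          (C' * Real.exp (d * ((ε' + Real.pi / 2) * |s.im|))) := by
          gcongr
          exact (hb' s hs ht).2
      _ = (∏ j, C j) * C' * (Real.exp (-(Real.pi * fanoIndex d w * s.im)) *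
          Real.exp (S * ((ε' - Real.pi / 2) * |s.im|)) *
          Real.exp (d * ((ε' + Real.pi / 2) * |s.im|))) := by ring
      _ = _ := by
          rw [← Real.exp_add, ← Real.exp_add]
          congr 2
          rw [hfano, ← hεeq]
          ring
  · have h1 : ‖(∏ j, Complex.Gamma (-((w j : ℂ) * s)))⁻¹‖ ≤
        (∏ j, C j) * Real.exp (S * ((ε' + Real.pi / 2) * |s.im|)) := by
      rw [← Finset.prod_inv_distrib, norm_prod, hS, Finset.sum_mul, Real.exp_sum,
        ← Finset.prod_mul_distrib]
      exact Finset.prod_le_prod (fun j _ => norm_nonneg _) fun j _ => (hb j s hs ht).2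
    unfold gammaRatio
    rw [mul_inv, mul_inv, norm_mul, norm_mul, norm_inv (Complex.exp _), hexp, inv_inv,
      ← Real.exp_neg, neg_neg]
    calc _ ≤ Real.exp (Real.pi * fanoIndex d w * s.im) *
          ((∏ j, C j) * Real.exp (S * ((ε' + Real.pi / 2) * |s.im|))) *
          (C' * Real.exp (d * ((ε' - Real.pi / 2) * |s.im|))) := by
          gcongr
          exact (hb' s hs ht).1
      _ = (∏ j, C j) * C' * (Real.exp (Real.pi * fanoIndex d w * s.im) *
          Real.exp (S * ((ε' + Real.pi / 2) * |s.im|)) *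
          Real.exp (d * ((ε' - Real.pi / 2) * |s.im|))) := by ring
      _ = _ := by
          rw [← Real.exp_add, ← Real.exp_add]
          congr 2
          rw [hfano, ← hεeq]
          ring

/-- The Fano condition makes the coefficient ratio of the hypergeometric series decay. -/
theorem exists_norm_degreePoly_le {N : ℕ} {d : ℕ} {w : Fin N → ℕ} (hd : 0 < d)
    (hw : ∀ j, 0 < w j) (hdvd : ∀ j, w j ∣ d) (hr : d < ∑ j, w j) :
    ∃ C : ℝ, 0 < C ∧ ∀ u : ℂ, 1 - 1 / (2 * d) ≤ u.re →
      (weightPoly w).eval u ≠ 0 ∧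
      ‖(degreePoly d).eval (u - 1)‖ ≤ C / u.re * ‖(weightPoly w).eval u‖ := by
  obtain ⟨e, he⟩ : ∃ e, ∑ j, w j = d + 1 + e := ⟨_, (Nat.add_sub_of_le hr).symm⟩
  have hd1 : (1 : ℝ) ≤ d := by exact_mod_cast hd
  refine ⟨(3 * d) ^ d * 2 ^ e * (2 * d) ^ (∑ j, w j), by positivity, fun u hu => ?_⟩
  have hinv : 1 / (2 * (d : ℝ)) ≤ 1 / 2 := by
    rw [div_le_div_iff₀ (by positivity) (by norm_num)]; linarith
  have hre : 1 / 2 ≤ u.re := by linarith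
  have hnorm : u.re ≤ ‖u‖ := Complex.re_le_norm u
  have hfac : ∀ j, ∀ i ∈ range (w j), ‖u‖ / (2 * d) ≤ ‖(w j : ℂ) * u - i‖ := by
    intro j i hi
    have hi' : (i : ℝ) + 1 ≤ w j := by exact_mod_cast mem_range.1 hi
    have hwd : (w j : ℝ) ≤ d := by exact_mod_cast Nat.le_of_dvd hd (hdvd j)
    have hw1 : (1 : ℝ) ≤ w j := by exact_mod_cast hw j
    have h1 : (w j : ℝ) * ‖u‖ - i ≤ ‖(w j : ℂ) * u - i‖ := by
      have := norm_sub_norm_le ((w j : ℂ) * u) (i : ℂ)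
      simpa using this
    refine le_trans ?_ h1
    -- `(1 - 1/(2d))² ≥ 1 - 1/d ≥ i / w_j`
    set b : ℝ := 1 / (2 * d) with hb
    have hbd : b * (2 * d) = 1 := by rw [hb]; field_simp
    have hb0 : 0 < b := by positivity
    have h2 : (1 - b) * (1 - b) ≤ ‖u‖ * (1 - b) := by gcongr; linarith; linarith
    have h3 : (w j : ℝ) * (1 - 2 * b) ≥ w j - 1 := by nlinarith
    rw [div_eq_mul_one_div, ← hb]
    nlinarith [sq_nonneg b]
  have hwp : (‖u‖ / (2 * d)) ^ (∑ j, w j) ≤ ‖(weightPoly w).eval u‖ := by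
    rw [eval_weightPoly, norm_prod, ← Finset.prod_pow_eq_pow_sum]
    refine Finset.prod_le_prod (fun j _ => by positivity) fun j _ => ?_
    rw [norm_prod]
    conv_lhs => rw [← card_range (w j), ← Finset.prod_const]
    exact Finset.prod_le_prod (fun i _ => by positivity) (hfac j)
  have hu0 : 0 < ‖u‖ := by linarith
  have hpos : 0 < ‖(weightPoly w).eval u‖ := lt_of_lt_of_le (by positivity) hwp
  refine ⟨norm_pos_iff.1 hpos, ?_⟩
  have hdp : ‖(degreePoly d).eval (u - 1)‖ ≤ (3 * d * ‖u‖) ^ d := by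
    rw [eval_degreePoly_sub_one, norm_prod]
    conv_rhs => rw [← card_range d, ← Finset.prod_const, card_range]
    refine Finset.prod_le_prod (fun i _ => norm_nonneg _) fun i hi => ?_
    have hi' : (i : ℝ) + 1 ≤ d := by exact_mod_cast mem_range.1 hi
    have := norm_sub_le ((d : ℂ) * u) (i : ℂ)
    simp only [norm_mul, Complex.norm_natCast] at this
    nlinarith
  rw [div_mul_eq_mul_div, le_div_iff₀ (by linarith)]
  have h2e : 1 ≤ 2 ^ e * ‖u‖ ^ e := by
    rw [← mul_pow]
    exact one_le_pow₀ (by linarith)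
  calc ‖(degreePoly d).eval (u - 1)‖ * u.re ≤ (3 * d * ‖u‖) ^ d * ‖u‖ := by gcongr
    _ ≤ (3 * d * ‖u‖) ^ d * ‖u‖ * (2 ^ e * ‖u‖ ^ e) := le_mul_of_one_le_right (by positivity) h2e
    _ = (3 * d) ^ d * 2 ^ e * (2 * d) ^ (∑ j, w j) * (‖u‖ / (2 * d)) ^ (∑ j, w j) := by
        have h2d : (2 * (d : ℝ)) ^ (∑ j, w j) ≠ 0 := by positivity
        rw [div_pow, mul_assoc ((3 * (d : ℝ)) ^ d * 2 ^ e), mul_div_cancel₀ _ h2d, he]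
        ring
    _ ≤ _ := by gcongr

/-! ### The periodic kernel -/

/-- The `1`-periodic function `1 / (e^{2πis} - ζ)` which selects the poles with `e^{2πis} = ζ`. -/
def periodicKernel (ζ s : ℂ) : ℂ := (Complex.exp (2 * Real.pi * Complex.I * s) - ζ)⁻¹

theorem periodicKernel_add_natCast (ζ s : ℂ) (n : ℕ) :
    periodicKernel ζ (s + n) = periodicKernel ζ s := by
  unfold periodicKernel
  rw [mul_add, Complex.exp_add, show (2 * Real.pi * Complex.I * (n : ℂ)) =
    n * (2 * Real.pi * Complex.I) by ring, Complex.exp_nat_mul_two_pi_mul_I, mul_one]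

theorem norm_periodicKernel_le {ζ : ℂ} (hζ : ‖ζ‖ = 1) {s : ℂ} (hs : 1 ≤ |s.im|) :
    ‖periodicKernel ζ s‖ ≤ 2 * Real.exp (Real.pi * (s.im - |s.im|)) := by
  have hY : ‖Complex.exp (2 * Real.pi * Complex.I * s)‖ = Real.exp (-(2 * Real.pi * s.im)) := by
    rw [Complex.norm_exp]; congr 1; simp
  have hbig : ∀ t : ℝ, 1 ≤ t → 2 ≤ Real.exp (2 * Real.pi * t) := fun t ht => by
    have := Real.add_one_le_exp (2 * Real.pi * t)
    nlinarith [Real.pi_gt_three]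
  unfold periodicKernel
  rw [norm_inv]
  rcases le_total 0 s.im with h | h
  · rw [abs_of_nonneg h] at hs ⊢
    rw [sub_self, mul_zero, Real.exp_zero, mul_one]
    have h1 := norm_sub_norm_le ζ (Complex.exp (2 * Real.pi * Complex.I * s))
    rw [hζ, hY, Real.exp_neg, norm_sub_rev] at h1
    have h2 := hbig _ hs
    have h3 : (Real.exp (2 * Real.pi * s.im))⁻¹ ≤ 2⁻¹ := by gcongr
    refine (inv_anti₀ (by norm_num : (0 : ℝ) < 1 / 2) (by linarith)).trans (by norm_num)
  · rw [abs_of_nonpos h] at hs ⊢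
    have h1 := norm_sub_norm_le (Complex.exp (2 * Real.pi * Complex.I * s)) ζ
    rw [hζ, hY] at h1
    have h2 := hbig _ hs
    rw [show 2 * Real.pi * -s.im = -(2 * Real.pi * s.im) by ring] at h2
    have h4 : Real.exp (-(2 * Real.pi * s.im)) / 2 ≤
        ‖Complex.exp (2 * Real.pi * Complex.I * s) - ζ‖ := by linarith
    refine (inv_anti₀ (by positivity) h4).trans ?_
    rw [inv_div, div_eq_mul_inv, ← Real.exp_neg]
    gcongr
    apply le_of_eq; ring

theorem differentiableAt_periodicKernel {ζ s : ℂ}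
    (h : Complex.exp (2 * Real.pi * Complex.I * s) ≠ ζ) :
    DifferentiableAt ℂ (periodicKernel ζ) s :=
  DifferentiableAt.inv (by fun_prop) (sub_ne_zero.2 h)

/-! ### The hypergeometric coefficients as functions of `P` -/

/-- `hypergeometricFactor c n 1` as a polynomial function of `P`. -/
def factorFun (c : ℕ) (n : ℚ) (P : ℂ) : ℂ :=
  ∏ i ∈ range ⌈n * (c : ℚ)⌉₊, ((c : ℂ) * P + ((n * (c : ℚ) - (i : ℚ) : ℚ) : ℂ))

/-- The coefficient of `q^{n+P}` in the I-function at `z = 1`, as a rational function of `P`. -/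
def hypergeometricTerm {N : ℕ} (d : ℕ) (w : Fin N → ℕ) (n : ℚ) (P : ℂ) : ℂ :=
  factorFun d n P * ∏ j, (factorFun (w j) n P)⁻¹

theorem factorFun_eq (c : ℕ) (n : ℚ) (P : ℂ) :
    factorFun c n P = ∏ i ∈ range ⌈n * (c : ℚ)⌉₊, ((c : ℂ) * (n + P) - i) := by
  refine Finset.prod_congr rfl fun i _ => ?_
  push_cast; ring

theorem differentiable_factorFun (c : ℕ) (n : ℚ) : Differentiable ℂ (factorFun c n) := by
  unfold factorFun
  fun_prop

/-- The numbers `n c - i` lie in `(c / d) ℤ` when `n ∈ (1 / d) ℤ` and `c ∣ d`. -/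
theorem div_le_sub_of_lt_ceil {c d a : ℕ} (hc : c ∣ d) (hd : 0 < d) {n : ℚ} (hn : n * d = a)
    {i : ℕ} (hi : i < ⌈n * (c : ℚ)⌉₊) : (c : ℚ) / d ≤ n * c - i := by
  obtain ⟨e, rfl⟩ := hc
  have he : 0 < e := Nat.pos_of_mul_pos_left hd
  have hc0 : 0 < c := Nat.pos_of_mul_pos_right hd
  have he' : (0 : ℚ) < e := by exact_mod_cast he
  have hc' : (0 : ℚ) < c := by exact_mod_cast hc0
  have h1 : (i : ℚ) < n * c := Nat.lt_ceil.1 hi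
  push_cast at hn ⊢
  have h2 : ((i * e : ℕ) : ℚ) < a := by push_cast; nlinarith
  have h3 : ((i * e + 1 : ℕ) : ℚ) ≤ a := by exact_mod_cast Nat.succ_le_of_lt (by exact_mod_cast h2)
  push_cast at h3
  rw [div_le_iff₀ (by positivity)]
  nlinarith

theorem div_le_ceil_sub {c d a : ℕ} (hc : c ∣ d) (hd : 0 < d) {n : ℚ} (hn : n * d = a)
    (h : (⌈n * (c : ℚ)⌉₊ : ℚ) ≠ n * c) : (c : ℚ) / d ≤ ⌈n * (c : ℚ)⌉₊ - n * c := by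
  obtain ⟨e, rfl⟩ := hc
  have he : 0 < e := Nat.pos_of_mul_pos_left hd
  have hc0 : 0 < c := Nat.pos_of_mul_pos_right hd
  have he' : (0 : ℚ) < e := by exact_mod_cast he
  have hc' : (0 : ℚ) < c := by exact_mod_cast hc0
  set k := ⌈n * (c : ℚ)⌉₊ with hk
  have h1 : n * c < k := lt_of_le_of_ne (Nat.le_ceil _) h.symm
  push_cast at hn ⊢
  have h2 : (a : ℚ) < ((k * e : ℕ) : ℚ) := by push_cast; nlinarith
  have h3 : ((a + 1 : ℕ) : ℚ) ≤ ((k * e : ℕ) : ℚ) := by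
    exact_mod_cast Nat.succ_le_of_lt (by exact_mod_cast h2)
  push_cast at h3
  rw [div_le_iff₀ (by positivity)]
  nlinarith

theorem factorFun_ne_zero {c d a : ℕ} (hc : c ∣ d) (hd : 0 < d) {n : ℚ} (hn : n * d = a)
    {P : ℂ} (hP : -(1 / (d : ℝ)) < P.re) : factorFun c n P ≠ 0 := by
  refine Finset.prod_ne_zero_iff.2 fun i hi h => ?_
  have h1 := div_le_sub_of_lt_ceil hc hd hn (mem_range.1 hi)
  have h2 : ((c : ℝ) / d) ≤ ((n * c - i : ℚ) : ℝ) := by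
    have := (Rat.cast_le (K := ℝ)).2 h1
    rwa [Rat.cast_div, Rat.cast_natCast, Rat.cast_natCast] at this
  have h3 := congrArg Complex.re h
  have hc0 : (0 : ℝ) < c := by exact_mod_cast Nat.pos_of_dvd_of_pos hc hd
  simp only [Complex.add_re, Complex.mul_re, Complex.natCast_re, Complex.natCast_im, zero_mul,
    sub_zero, Complex.ratCast_re, Complex.zero_re] at h3
  have h4 : (c : ℝ) * -(1 / (d : ℝ)) < c * P.re := by gcongr
  have h5 : (c : ℝ) * -(1 / (d : ℝ)) = -((c : ℝ) / d) := by ring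
  linarith

theorem differentiableAt_hypergeometricTerm {N : ℕ} {d a : ℕ} {w : Fin N → ℕ} (hd : 0 < d)
    (hdvd : ∀ j, w j ∣ d) {n : ℚ} (hn : n * d = a) {P : ℂ} (hP : -(1 / (d : ℝ)) < P.re) :
    DifferentiableAt ℂ (hypergeometricTerm d w n) P := by
  unfold hypergeometricTerm
  refine (differentiable_factorFun d n P).mul (DifferentiableAt.fun_finsetProd fun j _ => ?_)
  exact (differentiable_factorFun (w j) n P).inv (factorFun_ne_zero (hdvd j) hd hn hP)

theorem taylorAtZero_factorFun (c : ℕ) (n : ℚ) :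
    taylorAtZero (factorFun c n) = hypergeometricFactor c n 1 := by
  unfold factorFun hypergeometricFactor
  rw [taylorAtZero_prod _ fun i _ => by fun_prop]
  refine Finset.prod_congr rfl fun i _ => ?_
  rw [taylorAtZero_affine, mul_one]

theorem analyticAt_factorFun (c : ℕ) (n : ℚ) (P : ℂ) : AnalyticAt ℂ (factorFun c n) P :=
  (differentiable_factorFun c n).analyticAt P

theorem analyticAt_hypergeometricTerm {N : ℕ} {d a : ℕ} {w : Fin N → ℕ} (hd : 0 < d)
    (hdvd : ∀ j, w j ∣ d) {n : ℚ} (hn : n * d = a) :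
    AnalyticAt ℂ (hypergeometricTerm d w n) 0 := by
  refine (analyticAt_factorFun d n 0).mul (Finset.analyticAt_fun_prod _ fun j _ => ?_)
  exact (analyticAt_factorFun (w j) n 0).inv (factorFun_ne_zero (hdvd j) hd hn (by
    have : (0 : ℝ) < d := by exact_mod_cast hd
    simpa))

theorem taylorAtZero_hypergeometricTerm {N : ℕ} {d a : ℕ} {w : Fin N → ℕ} (hd : 0 < d)
    (hdvd : ∀ j, w j ∣ d) {n : ℚ} (hn : n * d = a) :
    taylorAtZero (hypergeometricTerm d w n) =
      hypergeometricFactor d n 1 * ∏ j, (hypergeometricFactor (w j) n 1)⁻¹ := by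
  have hne : ∀ j, factorFun (w j) n 0 ≠ 0 := fun j =>
    factorFun_ne_zero (hdvd j) hd hn (by
      have : (0 : ℝ) < d := by exact_mod_cast hd
      simpa)
  have han : ∀ j ∈ univ, AnalyticAt ℂ (fun P => (factorFun (w j) n P)⁻¹) 0 := fun j _ =>
    (analyticAt_factorFun (w j) n 0).inv (hne j)
  unfold hypergeometricTerm
  rw [taylorAtZero_mul (analyticAt_factorFun d n 0) (Finset.analyticAt_fun_prod _ han),
    taylorAtZero_prod _ han, taylorAtZero_factorFun]
  congr 1
  refine Finset.prod_congr rfl fun j _ => ?_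
  rw [taylorAtZero_inv (analyticAt_factorFun (w j) n 0) (hne j), taylorAtZero_factorFun]

theorem smallIGWTerm_eq_taylorAtZero {N : ℕ} {d a : ℕ} {w : Fin N → ℕ} (hd : 0 < d)
    (hdvd : ∀ j, w j ∣ d) {n : ℚ} (hn : n * d = a) (x : ℂ) :
    smallIGWTerm d w x 1 n =
      taylorAtZero fun P => hypergeometricTerm d w n P * Complex.exp ((n + P) * x) := by
  have h1 : (fun P => hypergeometricTerm d w n P * Complex.exp ((n + P) * x)) =
      fun P => hypergeometricTerm d w n P * (Complex.exp (x * P) * Complex.exp (n * x)) := by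
    funext P
    rw [← Complex.exp_add]
    ring_nf
  rw [h1, taylorAtZero_mul (analyticAt_hypergeometricTerm hd hdvd hn) (by fun_prop),
    taylorAtZero_hypergeometricTerm hd hdvd hn, taylorAtZero_mul (by fun_prop) (by fun_prop),
    taylorAtZero_exp, taylorAtZero_const]
  unfold smallIGWTerm
  rw [div_one, map_one, one_mul]
  ring

theorem ceil_add_one_mul {n : ℚ} (hn : 0 ≤ n) (c : ℕ) :
    ⌈(n + 1) * (c : ℚ)⌉₊ = c + ⌈n * (c : ℚ)⌉₊ := by
  rw [add_mul, one_mul, Nat.ceil_add_natCast (by positivity), add_comm]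

theorem factorFun_add_one {n : ℚ} (hn : 0 ≤ n) (c : ℕ) (P : ℂ) :
    factorFun c (n + 1) P =
      (∏ i ∈ range c, ((c : ℂ) * (n + 1 + P) - i)) * factorFun c n P := by
  rw [factorFun_eq, factorFun_eq, ceil_add_one_mul hn, Finset.prod_range_add]
  congr 1
  · push_cast; rfl
  · refine Finset.prod_congr rfl fun i _ => ?_
    push_cast; ring

/-- The coefficients of the I-function satisfy the recurrence of `gammaRatio`. -/
theorem hypergeometricTerm_add_one {N : ℕ} {d : ℕ} {w : Fin N → ℕ} {n : ℚ} (hn : 0 ≤ n) (P : ℂ) :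
    hypergeometricTerm d w (n + 1) P =
      (degreePoly d).eval (n + P) / (weightPoly w).eval (n + 1 + P) *
        hypergeometricTerm d w n P := by
  unfold hypergeometricTerm
  simp_rw [factorFun_add_one hn]
  rw [eval_weightPoly, show (n : ℂ) + P = (n + 1 + P) - 1 by ring, eval_degreePoly_sub_one]
  simp_rw [mul_inv, Finset.prod_mul_distrib, Finset.prod_inv_distrib]
  ring

/-- Factorial decay of the coefficients of the I-function, uniformly for `P` near the origin. -/
theorem exists_norm_hypergeometricTerm_le {N : ℕ} {d : ℕ} {w : Fin N → ℕ} (hd : 0 < d)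
    (hw : ∀ j, 0 < w j) (hdvd : ∀ j, w j ∣ d) (hr : d < ∑ j, w j) :
    ∃ C : ℝ, 0 < C ∧ ∀ (n : ℚ) (P : ℂ) (m : ℕ), 0 ≤ n → |P.re| ≤ 1 / (2 * d) →
      ‖hypergeometricTerm d w (n + m) P‖ ≤
        C ^ m / m.factorial * ‖hypergeometricTerm d w n P‖ := by
  obtain ⟨C, hC, hb⟩ := exists_norm_degreePoly_le hd hw hdvd hr
  refine ⟨2 * C, by positivity, fun n P m hn hP => ?_⟩
  have hd1 : (1 : ℝ) ≤ d := by exact_mod_cast hd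
  have hhalf : 1 / (2 * (d : ℝ)) ≤ 1 / 2 := by
    rw [div_le_div_iff₀ (by positivity) (by norm_num)]; linarith
  induction m with
  | zero => simp
  | succ m ih =>
    have hn' : (0 : ℝ) ≤ n := by exact_mod_cast hn
    have hPl := (abs_le.1 hP).1
    have hre : (((n + m : ℚ) : ℂ) + 1 + P).re = n + m + 1 + P.re := by simp
    have hm : (0 : ℝ) ≤ m := m.cast_nonneg
    obtain ⟨hne, hle⟩ := hb (((n + m : ℚ) : ℂ) + 1 + P) (by rw [hre]; linarith)
    rw [show (n + (m + 1 : ℕ) : ℚ) = (n + m) + 1 by push_cast; ring,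
      hypergeometricTerm_add_one (by positivity), norm_mul, norm_div]
    rw [show ((n + m : ℚ) : ℂ) + 1 + P - 1 = ((n + m : ℚ) : ℂ) + P by ring] at hle
    have h1 : ‖(degreePoly d).eval (((n + m : ℚ) : ℂ) + P)‖ /
        ‖(weightPoly w).eval (((n + m : ℚ) : ℂ) + 1 + P)‖ ≤ 2 * C / (m + 1) := by
      rw [div_le_iff₀ (norm_pos_iff.2 hne)]
      refine hle.trans (mul_le_mul_of_nonneg_right ?_ (norm_nonneg _))
      rw [hre, div_le_div_iff₀ (by linarith) (by positivity)]
      nlinarith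
    calc _ ≤ 2 * C / (m + 1) * ((2 * C) ^ m / m.factorial * ‖hypergeometricTerm d w n P‖) := by
          gcongr
      _ = _ := by
          rw [Nat.factorial_succ, pow_succ]
          push_cast
          field_simp

/-! ### The poles of the Barnes integrand on the right -/

/-- The regular part of `Γ(-c (n + P))` at `P = 0`, up to the factor `factorFun c n P`: it removes
the pole present when `n c` is an integer. -/
def regularGamma (c : ℕ) (n : ℚ) (P : ℂ) : ℂ :=
  (-1) ^ ⌈n * (c : ℚ)⌉₊ * if Int.fract ((c : ℚ) * n) = 0
    then Complex.Gamma (1 - c * P) / (-c)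
    else Complex.Gamma (((⌈n * (c : ℚ)⌉₊ - n * c : ℚ) : ℂ) - c * P)

/-- The regular part of `gammaRatio` at `n`, up to the factor `hypergeometricTerm d w n`. It depends
only on the class of `n` modulo `1`. -/
def regularRatio {N : ℕ} (d : ℕ) (w : Fin N → ℕ) (n : ℚ) (P : ℂ) : ℂ :=
  Complex.exp (Real.pi * Complex.I * fanoIndex d w * (n + P)) * (∏ j, regularGamma (w j) n P) *
    ((-1) ^ ⌈n * (d : ℚ)⌉₊ * (-d) * (Complex.Gamma (1 - d * P))⁻¹)

theorem ceil_eq_of_fract_eq_zero {c : ℕ} {n : ℚ} (hn : 0 ≤ n) (h : Int.fract ((c : ℚ) * n) = 0) :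
    (⌈n * (c : ℚ)⌉₊ : ℚ) = n * c := by
  rw [mul_comm] at h
  have h1 : ((⌊n * (c : ℚ)⌋ : ℤ) : ℚ) = n * c := by
    have := Int.self_sub_fract (n * (c : ℚ))
    rw [h] at this
    linarith
  have h2 : 0 ≤ ⌊n * (c : ℚ)⌋ := Int.floor_nonneg.2 (by positivity)
  obtain ⟨k, hk⟩ := Int.eq_ofNat_of_zero_le h2
  rw [hk] at h1
  have h3 : ((k : ℕ) : ℚ) = n * c := by exact_mod_cast h1
  rw [← h3, Nat.ceil_natCast]

theorem fract_eq_zero_of_ceil_eq {c : ℕ} {n : ℚ} (h : (⌈n * (c : ℚ)⌉₊ : ℚ) = n * c) :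
    Int.fract ((c : ℚ) * n) = 0 := by
  rw [mul_comm, ← h, Int.fract_natCast]

theorem Gamma_mul_factorFun {c d a : ℕ} (hc : c ∣ d) (hd : 0 < d) {n : ℚ} (hn0 : 0 ≤ n)
    (hn : n * d = a) {P : ℂ} (hP : |P.re| < 1 / d) (hP0 : P ≠ 0) :
    Complex.Gamma (-((c : ℂ) * (n + P))) *
      (if Int.fract ((c : ℚ) * n) = 0 then P else 1) * factorFun c n P = regularGamma c n P := by
  have hne := factorFun_ne_zero hc hd hn (P := P) (by linarith [(abs_lt.1 hP).1])
  have hc0 : (c : ℂ) ≠ 0 := by exact_mod_cast (Nat.pos_of_dvd_of_pos hc hd).ne'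
  set k := ⌈n * (c : ℚ)⌉₊ with hk
  have h1 := Gamma_natCast_sub k ((c : ℂ) * (n + P)) (by
    intro i hi h
    rw [factorFun_eq, Finset.prod_ne_zero_iff] at hne
    exact hne i (mem_range.2 hi) (by rw [h, sub_self]))
  rw [← factorFun_eq] at h1
  have hsq : ((-1 : ℂ) ^ k) * (-1) ^ k = 1 := by rw [← mul_pow]; norm_num
  unfold regularGamma
  rw [← hk]
  split_ifs with hf
  · have h2 : (k : ℂ) = n * c := by exact_mod_cast ceil_eq_of_fract_eq_zero hn0 hf
    rw [show (k : ℂ) - c * (n + P) = -(c * P) by rw [h2]; ring] at h1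
    have h3 := Complex.Gamma_add_one (-(c * P)) (neg_ne_zero.2 (mul_ne_zero hc0 hP0))
    rw [show 1 - (c : ℂ) * P = -(c * P) + 1 by ring, h3, h1]
    field_simp
    linear_combination (-Complex.Gamma (-((c : ℂ) * (n + P)))) * hsq
  · rw [show (((k - n * c : ℚ) : ℂ) - c * P) = k - c * (n + P) by push_cast; ring, h1]
    linear_combination (-Complex.Gamma (-((c : ℂ) * (n + P))) * factorFun c n P) * hsq

/-- Near a sector exponent `n`, `gammaRatio` is a pole of order `N_f - 1` (`N_f` of the Gamma
factors contribute one pole each and `1 / Γ(-d s)` a zero) times a factor periodic in `n` times the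
coefficient of the I-function. -/
theorem gammaRatio_mul_pow {N : ℕ} {d a : ℕ} {w : Fin N → ℕ} (hd : 0 < d)
    (hdvd : ∀ j, w j ∣ d) {n : ℚ} (hn0 : 0 ≤ n) (hn : n * d = a) {P : ℂ}
    (hP : |P.re| < 1 / d) (hP0 : P ≠ 0) :
    gammaRatio d w (n + P) * P ^ fixedDim w n =
      P * (regularRatio d w n P * hypergeometricTerm d w n P) := by
  have hpow : P ^ fixedDim w n = ∏ j, (if Int.fract ((w j : ℚ) * n) = 0 then P else 1) := by
    rw [Finset.prod_ite, Finset.prod_const, Finset.prod_const_one, mul_one]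
    rfl
  have hG : (∏ j, Complex.Gamma (-((w j : ℂ) * (n + P)))) * P ^ fixedDim w n =
      (∏ j, regularGamma (w j) n P) * ∏ j, (factorFun (w j) n P)⁻¹ := by
    rw [hpow, ← Finset.prod_mul_distrib, ← Finset.prod_mul_distrib]
    refine Finset.prod_congr rfl fun j _ => ?_
    rw [← Gamma_mul_factorFun (hdvd j) hd hn0 hn hP hP0, mul_inv_cancel_right₀]
    exact factorFun_ne_zero (hdvd j) hd hn (by linarith [(abs_lt.1 hP).1])
  have hne := factorFun_ne_zero dvd_rfl hd hn (P := P) (by linarith [(abs_lt.1 hP).1])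
  have hk : ⌈n * (d : ℚ)⌉₊ = a := by rw [hn, Nat.ceil_natCast]
  have h1 := Gamma_natCast_sub a ((d : ℂ) * (n + P)) (by
    intro i hi h
    rw [factorFun_eq, hk, Finset.prod_ne_zero_iff] at hne
    exact hne i (mem_range.2 hi) (by rw [h, sub_self]))
  have hf := factorFun_eq d n P
  rw [hk] at hf
  rw [← hf] at h1
  have h2 : (a : ℂ) = n * d := by exact_mod_cast hn.symm
  rw [show (a : ℂ) - d * (n + P) = -(d * P) by rw [h2]; ring] at h1
  have h3 := Complex.one_div_Gamma_eq_self_mul_one_div_Gamma_add_one (-((d : ℂ) * P))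
  have hs2 : ((-1 : ℂ) ^ a)⁻¹ = (-1) ^ a := by rw [← inv_pow]; norm_num
  have h4 : (Complex.Gamma (-((d : ℂ) * (n + P))))⁻¹ =
      (-1) ^ a * factorFun d n P * (-(d * P) * (Complex.Gamma (1 - d * P))⁻¹) := by
    rw [show (1 : ℂ) - d * P = -(d * P) + 1 by ring, ← h3, h1, mul_inv, mul_inv, hs2]
    have hsq : ((-1 : ℂ) ^ a) * (-1) ^ a = 1 := by rw [← mul_pow]; norm_num
    generalize (Complex.Gamma (-((d : ℂ) * (n + P))))⁻¹ = Y
    field_simp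
    linear_combination (-Y) * hsq
  unfold gammaRatio regularRatio hypergeometricTerm
  rw [h4, hk]
  linear_combination (Complex.exp (Real.pi * Complex.I * fanoIndex d w * (n + P)) *
    ((-1) ^ a * factorFun d n P * (-(d * P) * (Complex.Gamma (1 - d * P))⁻¹))) * hG

theorem fract_mul_add_natCast (c : ℕ) (n : ℚ) (m : ℕ) :
    Int.fract ((c : ℚ) * (n + m)) = Int.fract ((c : ℚ) * n) := by
  rw [mul_add, ← Nat.cast_mul, Int.fract_add_natCast]

theorem regularGamma_add_one {c : ℕ} {n : ℚ} (hn : 0 ≤ n) (P : ℂ) :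
    regularGamma c (n + 1) P = (-1) ^ c * regularGamma c n P := by
  have := fract_mul_add_natCast c n 1
  rw [Nat.cast_one] at this
  unfold regularGamma
  rw [this, ceil_add_one_mul hn, pow_add, mul_assoc]
  congr 3
  push_cast
  ring_nf

theorem regularRatio_add_one {N : ℕ} {d : ℕ} {w : Fin N → ℕ} {n : ℚ} (hn : 0 ≤ n) (P : ℂ) :
    regularRatio d w (n + 1) P = regularRatio d w n P := by
  unfold regularRatio
  simp_rw [regularGamma_add_one hn]
  rw [Finset.prod_mul_distrib, ceil_add_one_mul hn, pow_add]
  have h1 : Complex.exp (Real.pi * Complex.I * fanoIndex d w * (((n + 1 : ℚ) : ℂ) + P)) =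
      Complex.exp (Real.pi * Complex.I * fanoIndex d w * (n + P)) *
        ((∏ j, (-1 : ℂ) ^ w j) * (-1) ^ d) := by
    rw [← exp_pi_I_mul_fanoIndex, ← Complex.exp_add]
    push_cast
    ring_nf
  rw [h1]
  have hsq : ((-1 : ℂ) ^ d) * (-1) ^ d = 1 := by rw [← mul_pow]; norm_num
  have hsq2 : (∏ j, (-1 : ℂ) ^ w j) * ∏ j, (-1 : ℂ) ^ w j = 1 := by
    rw [← Finset.prod_mul_distrib]
    exact Finset.prod_eq_one fun j _ => by rw [← mul_pow]; norm_num
  generalize (∏ j, (-1 : ℂ) ^ w j) = A at hsq2 ⊢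
  generalize (-1 : ℂ) ^ d = B at hsq ⊢
  generalize (-1 : ℂ) ^ ⌈n * (d : ℚ)⌉₊ = B'
  linear_combination (Complex.exp (Real.pi * Complex.I * fanoIndex d w * (n + P)) *
    (∏ j, regularGamma (w j) n P) * (B' * (-d) * (Complex.Gamma (1 - d * P))⁻¹)) *
    (A * A * hsq + hsq2)

theorem regularRatio_add_natCast {N : ℕ} {d : ℕ} {w : Fin N → ℕ} {n : ℚ} (hn : 0 ≤ n) (m : ℕ) :
    regularRatio d w (n + m) = regularRatio d w n := by
  induction m with
  | zero => simp
  | succ m ih =>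
    rw [← ih]
    funext P
    rw [show (n + (m + 1 : ℕ) : ℚ) = (n + m) + 1 by push_cast; ring,
      regularRatio_add_one (by positivity)]

theorem differentiableAt_regularGamma {c d a : ℕ} (hc : c ∣ d) (hd : 0 < d) {n : ℚ}
    (hn : n * d = a) {P : ℂ} (hP : |P.re| < 1 / d) :
    DifferentiableAt ℂ (regularGamma c n) P := by
  have hd' : (0 : ℝ) < d := by exact_mod_cast hd
  have hc0 : (0 : ℝ) < c := by exact_mod_cast Nat.pos_of_dvd_of_pos hc hd
  have hcd : (c : ℝ) ≤ d := by exact_mod_cast Nat.le_of_dvd hd hc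
  have hcP : c * P.re < (c : ℝ) / d := by
    rw [div_eq_mul_one_div]
    gcongr
    exact (abs_lt.1 hP).2
  have hpole : ∀ z : ℂ, 0 < z.re → ∀ m : ℕ, z ≠ -m := fun z hz m h => by
    have : (0 : ℝ) ≤ m := m.cast_nonneg
    rw [h] at hz
    simp at hz
    linarith
  unfold regularGamma
  refine DifferentiableAt.const_mul ?_ _
  split_ifs with hf
  · refine DifferentiableAt.div_const ?_ _
    refine DifferentiableAt.comp P (Complex.differentiableAt_Gamma _ (hpole _ ?_)) (by fun_prop)
    have : (c : ℝ) / d ≤ 1 := by rw [div_le_one hd']; exact hcd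
    simp
    linarith
  · refine DifferentiableAt.comp P (Complex.differentiableAt_Gamma _ (hpole _ ?_)) (by fun_prop)
    have h1 := div_le_ceil_sub hc hd hn fun h => hf (fract_eq_zero_of_ceil_eq h)
    have h2 : ((c : ℝ) / d) ≤ ((⌈n * (c : ℚ)⌉₊ - n * c : ℚ) : ℝ) := by
      have := (Rat.cast_le (K := ℝ)).2 h1
      rwa [Rat.cast_div, Rat.cast_natCast, Rat.cast_natCast] at this
    rw [Complex.sub_re, Complex.ratCast_re]
    simp only [Complex.mul_re, Complex.natCast_re, Complex.natCast_im, zero_mul, sub_zero]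
    linarith

theorem differentiableAt_regularRatio {N : ℕ} {d a : ℕ} {w : Fin N → ℕ} (hd : 0 < d)
    (hdvd : ∀ j, w j ∣ d) {n : ℚ} (hn : n * d = a) {P : ℂ} (hP : |P.re| < 1 / d) :
    DifferentiableAt ℂ (regularRatio d w n) P := by
  unfold regularRatio
  refine DifferentiableAt.mul (DifferentiableAt.mul (by fun_prop) ?_) ?_
  · exact DifferentiableAt.fun_finsetProd fun j _ =>
      differentiableAt_regularGamma (hdvd j) hd hn hP
  · refine DifferentiableAt.const_mul ?_ _
    exact DifferentiableAt.comp P (f := fun s : ℂ => 1 - (d : ℂ) * s)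
      (g := fun z => (Complex.Gamma z)⁻¹)
      Complex.differentiable_one_div_Gamma.differentiableAt (by fun_prop)

/-! ### The Barnes integral -/

/-- The integrand of the Barnes integral, at `q = e^x`. -/
def barnesIntegrand {N : ℕ} (d : ℕ) (w : Fin N → ℕ) (ζ x s : ℂ) : ℂ :=
  gammaRatio d w s * periodicKernel ζ s * Complex.exp (s * x)

/-- The Barnes integral over the line `Re s = σ`, divided by `i`. -/
def barnesIntegral {N : ℕ} (d : ℕ) (w : Fin N → ℕ) (ζ x : ℂ) (σ : ℝ) : ℂ :=
  ∫ τ : ℝ, barnesIntegrand d w ζ x (σ + τ * Complex.I)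

/-- The argument of the bisector of the sector in which the Barnes integrals converge. -/
def sectorCenter {N : ℕ} (d : ℕ) (w : Fin N → ℕ) : ℝ := Real.pi - Real.pi * fanoIndex d w

/-- Half of the opening of the sector in which the asymptotic expansion is established. The Barnes
integrals converge in a larger sector, and every flat solution in a sector of opening more than
`π r` vanishes. -/
def sectorRadius {N : ℕ} (d : ℕ) (w : Fin N → ℕ) : ℝ :=
  Real.pi / 2 * fanoIndex d w + Real.pi / 2

theorem norm_exp_mul (s x : ℂ) :
    ‖Complex.exp (s * x)‖ = Real.exp (s.re * x.re - s.im * x.im) := by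
  rw [Complex.norm_exp, Complex.mul_re]

/-- In the sector, the exponential decay of `gammaRatio` and of the kernel beats
the growth of `q^s`. -/
theorem exists_norm_barnesIntegrand_le {N : ℕ} {d : ℕ} {w : Fin N → ℕ} (hd : 0 < d)
    (hw : ∀ j, 0 < w j) (A : ℕ) {ζ : ℂ} (hζ : ‖ζ‖ = 1) :
    ∃ C : ℝ, 0 < C ∧ ∀ s x : ℂ, |s.re| ≤ A → 1 ≤ |s.im| →
      |x.im - sectorCenter d w| ≤ sectorRadius d w →
      ‖barnesIntegrand d w ζ x s‖ ≤
        C * Real.exp (-(Real.pi / 4 * |s.im|)) * Real.exp (s.re * x.re) := by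
  obtain ⟨C, hC, hb⟩ := exists_norm_gammaRatio_le hd hw A (ε := Real.pi / 4) (by positivity)
  refine ⟨C * 2, by positivity, fun s x hs ht hx => ?_⟩
  unfold barnesIntegrand
  rw [norm_mul, norm_mul, norm_exp_mul]
  have hmul : -(s.im * (x.im - sectorCenter d w)) ≤ |s.im| * sectorRadius d w := by
    refine (neg_le_abs _).trans ?_
    rw [abs_mul]
    gcongr
  set r := fanoIndex d w
  have hc : sectorCenter d w = Real.pi - Real.pi * r := rfl
  have hR : sectorRadius d w = Real.pi / 2 * r + Real.pi / 2 := rfl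
  calc _ ≤ C * Real.exp (-(Real.pi * r * s.im) + (Real.pi / 4 - Real.pi / 2 * r) * |s.im|) *
        (2 * Real.exp (Real.pi * (s.im - |s.im|))) * Real.exp (s.re * x.re - s.im * x.im) := by
        gcongr
        · exact (hb s hs ht).1
        · exact norm_periodicKernel_le hζ ht
    _ = C * 2 * Real.exp ((-(Real.pi * r * s.im) + (Real.pi / 4 - Real.pi / 2 * r) * |s.im|) +
        Real.pi * (s.im - |s.im|) - s.im * x.im + s.re * x.re) := by
        rw [show (-(Real.pi * r * s.im) + (Real.pi / 4 - Real.pi / 2 * r) * |s.im|) +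
          Real.pi * (s.im - |s.im|) - s.im * x.im + s.re * x.re =
          (-(Real.pi * r * s.im) + (Real.pi / 4 - Real.pi / 2 * r) * |s.im|) +
          Real.pi * (s.im - |s.im|) + (s.re * x.re - s.im * x.im) by ring]
        simp only [Real.exp_add]
        ring
    _ ≤ C * 2 * Real.exp (-(Real.pi / 4 * |s.im|) + s.re * x.re) := by
        gcongr
        rw [hc, hR] at hmul
        linarith
    _ = _ := by rw [Real.exp_add]; ring

/-- At points `s` with `e^{2πis}` a `d`-th root of unity, `d s` is an integer. -/
theorem exists_int_of_exp_eq {ζ s : ℂ} {d : ℕ} (hζ : ζ ^ d = 1)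
    (h : Complex.exp (2 * Real.pi * Complex.I * s) = ζ) : ∃ m : ℤ, (d : ℂ) * s = m := by
  rw [← h, ← Complex.exp_nat_mul, Complex.exp_eq_one_iff] at hζ
  obtain ⟨m, hm⟩ := hζ
  refine ⟨m, ?_⟩
  have : (2 * Real.pi * Complex.I : ℂ) ≠ 0 := Complex.two_pi_I_ne_zero
  refine mul_left_cancel₀ this ?_
  linear_combination hm

theorem continuous_barnesIntegrand {N : ℕ} {d : ℕ} {w : Fin N → ℕ}
    (hdvd : ∀ j, w j ∣ d) {ζ : ℂ} (hζ : ζ ^ d = 1) {σ : ℝ} (hσ : ∀ m : ℤ, (d : ℝ) * σ ≠ m) :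
    Continuous fun τ : ℝ =>
      gammaRatio d w (σ + τ * Complex.I) * periodicKernel ζ (σ + τ * Complex.I) := by
  refine continuous_iff_continuousAt.2 fun τ => ?_
  have hline : ContinuousAt (fun τ : ℝ => (σ : ℂ) + τ * Complex.I) τ := by fun_prop
  have hre : ((σ : ℂ) + τ * Complex.I).re = σ := by simp
  refine ContinuousAt.mul ?_ ?_
  · refine ContinuousAt.comp (f := fun τ : ℝ => (σ : ℂ) + τ * Complex.I)
      (differentiableAt_gammaRatio d fun j m h => ?_).continuousAt hline
    obtain ⟨e, he⟩ := hdvd j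
    have h1 := congrArg Complex.re h
    simp only [Complex.mul_re, Complex.natCast_re, Complex.natCast_im, zero_mul, sub_zero,
      hre] at h1
    refine hσ (e * m) ?_
    rw [he]
    push_cast
    linear_combination (e : ℝ) * h1
  · refine ContinuousAt.comp (f := fun τ : ℝ => (σ : ℂ) + τ * Complex.I)
      (differentiableAt_periodicKernel fun h => ?_).continuousAt hline
    obtain ⟨m, hm⟩ := exists_int_of_exp_eq hζ h
    have h1 := congrArg Complex.re hm
    simp only [Complex.mul_re, Complex.natCast_re, Complex.natCast_im, zero_mul, sub_zero,
      hre, Complex.intCast_re] at h1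
    exact hσ m h1

theorem exists_norm_barnesIntegrand_line_le {N : ℕ} {d : ℕ} {w : Fin N → ℕ} (hd : 0 < d)
    (hw : ∀ j, 0 < w j) (hdvd : ∀ j, w j ∣ d) {ζ : ℂ} (hζ : ζ ^ d = 1) {σ : ℝ}
    (hσ : ∀ m : ℤ, (d : ℝ) * σ ≠ m) :
    ∃ C : ℝ, 0 < C ∧ ∀ x : ℂ, |x.im - sectorCenter d w| ≤ sectorRadius d w → ∀ τ : ℝ,
      ‖barnesIntegrand d w ζ x (σ + τ * Complex.I)‖ ≤
        C * Real.exp (-(Real.pi / 4 * |τ|)) * Real.exp (σ * x.re) := by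
  obtain ⟨A, hA⟩ := exists_nat_ge |σ|
  obtain ⟨C, hC, hb⟩ := exists_norm_barnesIntegrand_le hd hw A
    (Complex.norm_eq_one_of_pow_eq_one hζ hd.ne')
  obtain ⟨B, hB⟩ := (isCompact_Icc (a := (-1 : ℝ)) (b := 1)).exists_bound_of_continuousOn
    (continuous_barnesIntegrand hdvd hζ hσ).continuousOn
  have hB0 : 0 ≤ B := (norm_nonneg _).trans (hB 0 (by simp))
  set E : ℝ := |sectorCenter d w| + sectorRadius d w with hE
  refine ⟨C + B * Real.exp E * Real.exp (Real.pi / 4), by positivity, fun x hx τ => ?_⟩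
  have hre : ((σ : ℂ) + τ * Complex.I).re = σ := by simp
  have him : ((σ : ℂ) + τ * Complex.I).im = τ := by simp
  rcases le_total 1 |τ| with h | h
  · have := hb (σ + τ * Complex.I) x (by rwa [hre]) (by rwa [him]) hx
    rw [hre, him] at this
    refine this.trans ?_
    gcongr
    have : 0 ≤ B * Real.exp E * Real.exp (Real.pi / 4) := by positivity
    linarith
  · unfold barnesIntegrand
    rw [norm_mul, norm_exp_mul, hre, him]
    have h1 : -(τ * x.im) ≤ E := by
      refine (neg_le_abs _).trans ?_
      rw [abs_mul]
      have h2 : |x.im| ≤ E := by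
        have := abs_sub_abs_le_abs_sub x.im (sectorCenter d w)
        rw [hE]; linarith
      nlinarith [abs_nonneg x.im, abs_nonneg τ]
    have h2 : Real.exp (-(Real.pi / 4)) ≤ Real.exp (-(Real.pi / 4 * |τ|)) := by
      gcongr
      nlinarith [Real.pi_pos]
    have h3 : 1 ≤ Real.exp (Real.pi / 4) * Real.exp (-(Real.pi / 4 * |τ|)) := by
      rw [Real.exp_neg] at h2
      rwa [inv_le_iff_one_le_mul₀' (Real.exp_pos _)] at h2
    calc _ ≤ B * (Real.exp (σ * x.re) * Real.exp E) := by
          gcongr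
          · exact hB τ (abs_le.1 h)
          · rw [← Real.exp_add]
            gcongr
            linarith
      _ ≤ B * (Real.exp (σ * x.re) * Real.exp E) *
          (Real.exp (Real.pi / 4) * Real.exp (-(Real.pi / 4 * |τ|))) :=
          le_mul_of_one_le_right (by positivity) h3
      _ = (B * Real.exp E * Real.exp (Real.pi / 4)) * Real.exp (-(Real.pi / 4 * |τ|)) *
          Real.exp (σ * x.re) := by ring
      _ ≤ _ := by gcongr; linarith

theorem integrable_exp_neg_mul_abs {c : ℝ} (hc : 0 < c) :
    MeasureTheory.Integrable fun τ : ℝ => Real.exp (-(c * |τ|)) := by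
  rw [← MeasureTheory.integrableOn_univ, ← Set.Iic_union_Ioi (a := (0 : ℝ))]
  refine MeasureTheory.IntegrableOn.union ?_ ?_
  · refine (integrableOn_exp_mul_Iic hc 0).congr_fun (fun τ hτ => ?_) measurableSet_Iic
    simp only
    rw [abs_of_nonpos hτ, mul_neg, neg_neg]
  · refine (integrableOn_exp_mul_Ioi (neg_neg_of_pos hc) 0).congr_fun (fun τ hτ => ?_)
      measurableSet_Ioi
    simp only
    rw [abs_of_pos hτ, neg_mul]

theorem integrable_barnesIntegrand {N : ℕ} {d : ℕ} {w : Fin N → ℕ} (hd : 0 < d)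
    (hw : ∀ j, 0 < w j) (hdvd : ∀ j, w j ∣ d) {ζ : ℂ} (hζ : ζ ^ d = 1) {σ : ℝ}
    (hσ : ∀ m : ℤ, (d : ℝ) * σ ≠ m) {x : ℂ}
    (hx : |x.im - sectorCenter d w| ≤ sectorRadius d w) :
    MeasureTheory.Integrable fun τ : ℝ => barnesIntegrand d w ζ x (σ + τ * Complex.I) := by
  obtain ⟨C, hC, hb⟩ := exists_norm_barnesIntegrand_line_le hd hw hdvd hζ hσ
  refine MeasureTheory.Integrable.mono'
    (((integrable_exp_neg_mul_abs (c := Real.pi / 4) (by positivity)).const_mul C).mul_const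
      (Real.exp (σ * x.re))) ?_ (Eventually.of_forall fun τ => hb x hx τ)
  exact ((continuous_barnesIntegrand hdvd hζ hσ).mul (by fun_prop)).aestronglyMeasurable

/-- The Barnes integral over `Re s = σ` is of the order of `q^σ`, uniformly in the sector. -/
theorem exists_norm_barnesIntegral_le {N : ℕ} {d : ℕ} {w : Fin N → ℕ} (hd : 0 < d)
    (hw : ∀ j, 0 < w j) (hdvd : ∀ j, w j ∣ d) {ζ : ℂ} (hζ : ζ ^ d = 1) {σ : ℝ}
    (hσ : ∀ m : ℤ, (d : ℝ) * σ ≠ m) :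
    ∃ C : ℝ, ∀ x : ℂ, |x.im - sectorCenter d w| ≤ sectorRadius d w →
      ‖barnesIntegral d w ζ x σ‖ ≤ C * Real.exp (σ * x.re) := by
  obtain ⟨C, hC, hb⟩ := exists_norm_barnesIntegrand_line_le hd hw hdvd hζ hσ
  refine ⟨C * ∫ τ : ℝ, Real.exp (-(Real.pi / 4 * |τ|)), fun x hx => ?_⟩
  refine (MeasureTheory.norm_integral_le_of_norm_le
    (((integrable_exp_neg_mul_abs (c := Real.pi / 4) (by positivity)).const_mul C).mul_const
      (Real.exp (σ * x.re))) (Eventually.of_forall fun τ => hb x hx τ)).trans (le_of_eq ?_)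
  rw [MeasureTheory.integral_mul_const, MeasureTheory.integral_const_mul]

/-- Moving the line of integration of the Barnes integral across the point `s₀ ∈ (1 / d) ℤ`. -/
theorem barnesIntegral_sub {N : ℕ} {d : ℕ} {w : Fin N → ℕ} (hd : 0 < d)
    (hw : ∀ j, 0 < w j) (hdvd : ∀ j, w j ∣ d) {ζ : ℂ} (hζ : ζ ^ d = 1) {x : ℂ}
    (hx : |x.im - sectorCenter d w| ≤ sectorRadius d w) {s₀ : ℝ} {a : ℤ} (hs₀ : s₀ * d = a)
    (p : ℕ) {h : ℂ → ℂ} (hh : DifferentiableOn ℂ h {P | |P.re| ≤ 1 / (2 * d)})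
    (heq : ∀ P : ℂ, |P.re| ≤ 1 / (2 * d) → P ≠ 0 →
      barnesIntegrand d w ζ x (s₀ + P) = h P / P ^ p) :
    barnesIntegral d w ζ x (s₀ + 1 / (2 * d)) - barnesIntegral d w ζ x (s₀ - 1 / (2 * d)) =
      if p = 0 then 0 else 2 * Real.pi * PowerSeries.coeff (p - 1) (taylorAtZero h) := by
  have hd' : (0 : ℝ) < d := by exact_mod_cast hd
  set δ : ℝ := 1 / (2 * d) with hδ
  have hδ0 : 0 < δ := by positivity
  have hδd : δ * d = 1 / 2 := by rw [hδ]; field_simp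
  have hv : VanishesAtStripEnds δ fun P => h P / P ^ p := by
    obtain ⟨A, hA⟩ := exists_nat_ge (|s₀| + δ)
    obtain ⟨C, hC, hb⟩ := exists_norm_barnesIntegrand_le hd hw A
      (Complex.norm_eq_one_of_pow_eq_one hζ hd.ne')
    intro ε hε
    set E := Real.exp ((|s₀| + δ) * |x.re|)
    have hlim : Tendsto (fun T : ℝ => C * Real.exp (-(Real.pi / 4 * T)) * E) atTop (𝓝 0) := by
      have h1 : Tendsto (fun T : ℝ => Real.exp (-(Real.pi / 4 * T))) atTop (𝓝 0) :=
        Real.tendsto_exp_neg_atTop_nhds_zero.comp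
          (tendsto_id.const_mul_atTop (by positivity : 0 < Real.pi / 4))
      simpa using (h1.const_mul C).mul_const E
    filter_upwards [hlim.eventually_le_const hε, eventually_ge_atTop 1] with T hT hT1 σ hσ
    have main : ∀ P : ℂ, P.re = σ → |P.im| = T → ‖h P / P ^ p‖ ≤ ε := by
      intro P hPσ hPT
      have hP0 : P ≠ 0 := fun h0 => by rw [h0] at hPT; simp at hPT; linarith
      rw [← heq P (by rwa [hPσ]) hP0]
      have hsum : |s₀ + σ| ≤ |s₀| + δ := (abs_add_le _ _).trans (by gcongr)
      have h1 := hb (s₀ + P) x (by simpa [hPσ] using hsum.trans hA) (by simpa [hPT] using hT1) hx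
      refine h1.trans (le_trans ?_ hT)
      have e1 : ((s₀ : ℂ) + P).im = P.im := by simp
      have e2 : ((s₀ : ℂ) + P).re = s₀ + σ := by simp [hPσ]
      rw [e1, e2, hPT]
      gcongr
      refine Real.exp_le_exp.2 ((le_abs_self _).trans ?_)
      rw [abs_mul]
      gcongr
    constructor <;> refine main _ (by simp) ?_
    · simp; linarith
    · simp; linarith
  have key := tendsto_verticalIntegral_sub hδ0 p hh hv
  have hline : ∀ σ : ℝ, |σ| ≤ δ → σ ≠ 0 → (∀ m : ℤ, (d : ℝ) * (s₀ + σ) ≠ m) →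
      Tendsto (fun T => verticalIntegral (fun P => h P / P ^ p) σ T) atTop
        (𝓝 (barnesIntegral d w ζ x (s₀ + σ))) := by
    intro σ hσ hσ0 hσd
    have h1 := MeasureTheory.intervalIntegral_tendsto_integral
      (integrable_barnesIntegrand hd hw hdvd hζ hσd hx) tendsto_neg_atTop_atBot tendsto_id
    refine h1.congr fun T => ?_
    unfold verticalIntegral
    refine intervalIntegral.integral_congr fun τ _ => ?_
    simp only
    rw [← heq _ (by simpa using hσ) (line_ne_zero hσ0 τ)]
    congr 1
    push_cast
    ring
  have hhalf : ∀ m : ℤ, ∀ b : ℤ, (2 : ℝ) * m ≠ 2 * b + 1 := fun m b h => by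
    have : 2 * m = 2 * b + 1 := by exact_mod_cast h
    omega
  refine tendsto_nhds_unique ((hline δ (abs_of_pos hδ0).le hδ0.ne' fun m hm => ?_).sub
    (hline (-δ) (by rw [abs_neg, abs_of_pos hδ0]) (by linarith) fun m hm => ?_)) key
  · exact hhalf m a (by rw [← hm, ← hs₀]; linear_combination 2 * hδd)
  · refine hhalf m (a - 1) ?_
    push_cast
    rw [← hm, ← hs₀]; linear_combination (-2) * hδd

/-- No contribution is left at infinity when the contour is closed to the right: each unit step
multiplies the integrand by `O(1 / m)`. -/
theorem tendsto_barnesIntegral_atTop {N : ℕ} {d : ℕ} {w : Fin N → ℕ} (hd : 0 < d)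
    (hw : ∀ j, 0 < w j) (hdvd : ∀ j, w j ∣ d) (hr : d < ∑ j, w j) {ζ : ℂ} (hζ : ζ ^ d = 1)
    {x : ℂ} (hx : |x.im - sectorCenter d w| ≤ sectorRadius d w) :
    Tendsto (fun m : ℕ => barnesIntegral d w ζ x (m - 1 / (2 * d))) atTop (𝓝 0) := by
  obtain ⟨C, hC, hb⟩ := exists_norm_degreePoly_le hd hw hdvd hr
  have hd1 : (1 : ℝ) ≤ d := by exact_mod_cast hd
  set δ : ℝ := 1 / (2 * d) with hδ
  have hδd : δ * d = 1 / 2 := by rw [hδ]; field_simp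
  have hδ0 : 0 < δ := by positivity
  have hδ1 : δ ≤ 1 / 2 := by rw [hδ, div_le_div_iff₀ (by positivity) (by norm_num)]; linarith
  have hstep : ∀ (m : ℕ) (τ : ℝ),
      ‖barnesIntegrand d w ζ x (((m - δ : ℝ) : ℂ) + τ * Complex.I)‖ ≤
        (2 * C * Real.exp x.re) ^ m / m.factorial *
          ‖barnesIntegrand d w ζ x (((0 - δ : ℝ) : ℂ) + τ * Complex.I)‖ := by
    intro m τ
    induction m with
    | zero => simp
    | succ m ih =>
      set s : ℂ := ((m - δ : ℝ) : ℂ) + τ * Complex.I with hs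
      have hs1 : (((m + 1 : ℕ) - δ : ℝ) : ℂ) + τ * Complex.I = s + 1 := by
        rw [hs]; push_cast; ring
      have hre : (s + 1).re = m + 1 - δ := by rw [hs]; simp; ring
      have hm : (0 : ℝ) ≤ m := m.cast_nonneg
      obtain ⟨hne, hle⟩ := hb (s + 1) (by rw [hre]; linarith)
      have hrec := gammaRatio_recurrence (w := w) hd hdvd (s := s + 1) (by
        intro i _ h
        have h1 := congrArg Complex.re h
        rw [Complex.mul_re, hre] at h1
        simp only [Complex.natCast_re, Complex.natCast_im, zero_mul, sub_zero] at h1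
        have h2 : (2 * (d * (m + 1)) : ℝ) = 2 * i + 1 := by linear_combination 2 * h1 + 2 * hδd
        have : 2 * (d * (m + 1)) = 2 * i + 1 := by exact_mod_cast h2
        omega)
      rw [add_sub_cancel_right] at hrec hle
      have hG : ‖gammaRatio d w (s + 1)‖ ≤ 2 * C / (m + 1) * ‖gammaRatio d w s‖ := by
        have h1 := congrArg norm hrec
        rw [norm_mul, norm_mul] at h1
        have hpos := norm_pos_iff.2 hne
        refine le_of_mul_le_mul_left ?_ hpos
        rw [h1]
        calc _ ≤ C / (s + 1).re * ‖(weightPoly w).eval (s + 1)‖ * ‖gammaRatio d w s‖ := by gcongr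
          _ ≤ 2 * C / (m + 1) * ‖(weightPoly w).eval (s + 1)‖ * ‖gammaRatio d w s‖ := by
              refine mul_le_mul_of_nonneg_right (mul_le_mul_of_nonneg_right ?_ (norm_nonneg _))
                (norm_nonneg _)
              rw [hre, div_le_div_iff₀ (by linarith) (by positivity)]
              nlinarith
          _ = _ := by ring
      rw [hs1]
      unfold barnesIntegrand at ih ⊢
      have hK := periodicKernel_add_natCast ζ s 1
      rw [Nat.cast_one] at hK
      rw [norm_mul, norm_mul, hK, add_mul, one_mul, Complex.exp_add, norm_mul, Complex.norm_exp x]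
      rw [norm_mul, norm_mul] at ih
      refine le_trans (b := 2 * C / (m + 1) * Real.exp x.re *
        (‖gammaRatio d w s‖ * ‖periodicKernel ζ s‖ * ‖Complex.exp (s * x)‖)) ?_
        ((mul_le_mul_of_nonneg_left ih (by positivity)).trans (le_of_eq ?_))
      · calc _ ≤ 2 * C / (m + 1) * ‖gammaRatio d w s‖ * ‖periodicKernel ζ s‖ *
              (‖Complex.exp (s * x)‖ * Real.exp x.re) := by gcongr
          _ = _ := by ring
      · generalize ‖gammaRatio d w (((0 - δ : ℝ) : ℂ) + τ * Complex.I) * _ * _‖ = Z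
        rw [Nat.factorial_succ, pow_succ (2 * C * Real.exp x.re)]
        push_cast
        field_simp
  have hσ : ∀ m : ℤ, (d : ℝ) * (0 - δ) ≠ m := fun m h => by
    have h2 : (2 * m : ℝ) = -1 := by rw [← h]; linear_combination (-2) * hδd
    have : 2 * m = -1 := by exact_mod_cast h2
    omega
  have hint := (integrable_barnesIntegrand hd hw hdvd hζ hσ hx).norm
  refine squeeze_zero_norm (a := fun m : ℕ => (2 * C * Real.exp x.re) ^ m / m.factorial *
    ∫ τ : ℝ, ‖barnesIntegrand d w ζ x (((0 - δ : ℝ) : ℂ) + τ * Complex.I)‖) (fun m => ?_) ?_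
  · refine (MeasureTheory.norm_integral_le_of_norm_le (hint.const_mul _)
      (Eventually.of_forall fun τ => hstep m τ)).trans (le_of_eq ?_)
    rw [MeasureTheory.integral_const_mul]
  · simpa using (FloorSemiring.tendsto_pow_div_factorial_atTop (2 * C * Real.exp x.re)).mul_const _

/-! ### Exponential series with power series coefficients -/

/-- The power series `e^{xP}` in `P`. -/
abbrev expSeries (x : ℂ) : PowerSeries ℂ := PowerSeries.rescale x (PowerSeries.exp ℂ)

theorem coeff_expSeries (x : ℂ) (n : ℕ) :
    PowerSeries.coeff n (expSeries x) = x ^ n / (n.factorial : ℂ) := by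
  rw [PowerSeries.coeff_rescale, PowerSeries.coeff_exp]
  simp [div_eq_mul_inv]

theorem hasDerivAt_coeff_expSeries (n : ℕ) (x : ℂ) :
    HasDerivAt (fun x => PowerSeries.coeff n (expSeries x))
      (PowerSeries.coeff n (PowerSeries.X * expSeries x)) x := by
  simp_rw [coeff_expSeries]
  match n with
  | 0 => simpa using hasDerivAt_const x (1 : ℂ)
  | n + 1 =>
    rw [PowerSeries.coeff_succ_X_mul, coeff_expSeries]
    refine ((hasDerivAt_pow (n + 1) x).div_const _).congr_deriv ?_
    rw [Nat.factorial_succ]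
    have h1 : (n.factorial : ℂ) ≠ 0 := by exact_mod_cast n.factorial_ne_zero
    have h2 : (n : ℂ) + 1 ≠ 0 := by exact_mod_cast n.succ_ne_zero
    push_cast
    field_simp

theorem hasDerivAt_coeff_mul_expSeries (U : PowerSeries ℂ) (i : ℕ) (x : ℂ) :
    HasDerivAt (fun x => PowerSeries.coeff i (U * expSeries x))
      (PowerSeries.coeff i (PowerSeries.X * U * expSeries x)) x := by
  rw [mul_comm PowerSeries.X U, mul_assoc]
  simp_rw [PowerSeries.coeff_mul i U]
  exact HasDerivAt.fun_sum fun p _ => (hasDerivAt_coeff_expSeries p.2 x).const_mul _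

/-- The coefficients of the power series `U m` decrease faster than any exponential in `m`. -/
def IsRapid (U : ℕ → PowerSeries ℂ) : Prop :=
  ∀ (i : ℕ) (R : ℝ), 0 < R → ∃ C : ℝ, ∀ m, ‖PowerSeries.coeff i (U m)‖ * R ^ m ≤ C

theorem IsRapid.add {U V : ℕ → PowerSeries ℂ} (hU : IsRapid U) (hV : IsRapid V) :
    IsRapid (U + V) := fun i R hR => by
  obtain ⟨C, hC⟩ := hU i R hR
  obtain ⟨D, hD⟩ := hV i R hR
  refine ⟨C + D, fun m => ?_⟩
  rw [Pi.add_apply, map_add]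
  calc _ ≤ (‖PowerSeries.coeff i (U m)‖ + ‖PowerSeries.coeff i (V m)‖) * R ^ m := by
        gcongr; exact norm_add_le _ _
    _ ≤ _ := by rw [add_mul]; exact add_le_add (hC m) (hD m)

theorem IsRapid.smul {U : ℕ → PowerSeries ℂ} (hU : IsRapid U) (c : ℂ) : IsRapid (c • U) :=
  fun i R hR => by
  obtain ⟨C, hC⟩ := hU i R hR
  refine ⟨‖c‖ * C, fun m => ?_⟩
  rw [Pi.smul_apply, PowerSeries.coeff_smul, norm_smul, mul_assoc]
  gcongr
  exact hC m

/-- Multiplication of the `m`-th series by `n₀ + m + P`: the derivation `q d/dq` on coefficient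
sequences. -/
def eulerOp (n₀ : ℚ) : Module.End ℂ (ℕ → PowerSeries ℂ) where
  toFun U m := (PowerSeries.C ((n₀ : ℂ) + m) + PowerSeries.X) * U m
  map_add' U V := by funext m; simp [mul_add]
  map_smul' c U := by funext m; simp

theorem IsRapid.eulerOp {U : ℕ → PowerSeries ℂ} (hU : IsRapid U) (n₀ : ℚ) :
    IsRapid (eulerOp n₀ U) := fun i R hR => by
  obtain ⟨C, hC⟩ := hU i (2 * R) (by positivity)
  obtain ⟨D, hD⟩ : ∃ D : ℝ, ∀ m, ‖PowerSeries.coeff i (PowerSeries.X * U m)‖ * R ^ m ≤ D := by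
    match i with
    | 0 => exact ⟨0, fun m => by simp⟩
    | i + 1 => simpa only [PowerSeries.coeff_succ_X_mul] using hU i R hR
  have hC0 : 0 ≤ C := le_trans (by positivity) (hC 0)
  refine ⟨(‖(n₀ : ℂ)‖ + 1) * C + D, fun m => ?_⟩
  have h1 : ‖(n₀ : ℂ) + m‖ ≤ (‖(n₀ : ℂ)‖ + 1) * 2 ^ m := by
    have h2 : (m : ℝ) ≤ 2 ^ m := by exact_mod_cast (Nat.lt_two_pow_self (n := m)).le
    have h3 : (1 : ℝ) ≤ 2 ^ m := one_le_pow₀ (by norm_num)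
    have := norm_add_le (n₀ : ℂ) m
    rw [Complex.norm_natCast] at this
    nlinarith [norm_nonneg (n₀ : ℂ)]
  have e : LGFano.eulerOp n₀ U m = PowerSeries.C ((n₀ : ℂ) + m) * U m + PowerSeries.X * U m :=
    add_mul _ _ _
  rw [e, map_add, PowerSeries.coeff_C_mul]
  calc _ ≤ (‖((n₀ : ℂ) + m) * PowerSeries.coeff i (U m)‖ +
        ‖PowerSeries.coeff i (PowerSeries.X * U m)‖) * R ^ m := by
        gcongr; exact norm_add_le _ _
    _ ≤ ((‖(n₀ : ℂ)‖ + 1) * 2 ^ m * ‖PowerSeries.coeff i (U m)‖) * R ^ m +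
        ‖PowerSeries.coeff i (PowerSeries.X * U m)‖ * R ^ m := by
        rw [add_mul, norm_mul]
        gcongr
    _ = (‖(n₀ : ℂ)‖ + 1) * (‖PowerSeries.coeff i (U m)‖ * (2 * R) ^ m) +
        ‖PowerSeries.coeff i (PowerSeries.X * U m)‖ * R ^ m := by rw [mul_pow]; ring
    _ ≤ _ := by gcongr; exacts [hC m, hD m]

theorem IsRapid.aeval_eulerOp {U : ℕ → PowerSeries ℂ} (hU : IsRapid U) (n₀ : ℚ)
    (p : Polynomial ℂ) : IsRapid (Polynomial.aeval (LGFano.eulerOp n₀) p U) := by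
  induction p using Polynomial.induction_on' with
  | add p q hp hq => simpa using hp.add hq
  | monomial k c =>
    rw [Polynomial.aeval_monomial, Module.End.mul_apply, Module.algebraMap_end_apply]
    refine IsRapid.smul ?_ c
    induction k with
    | zero => simpa using hU
    | succ k ih =>
      rw [pow_succ', Module.End.mul_apply]
      exact ih.eulerOp n₀

theorem aeval_eulerOp_apply (n₀ : ℚ) (p : Polynomial ℂ) (U : ℕ → PowerSeries ℂ) (m : ℕ) :
    Polynomial.aeval (eulerOp n₀) p U m =
      Polynomial.aeval (PowerSeries.C ((n₀ : ℂ) + m) + PowerSeries.X) p * U m := by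
  induction p using Polynomial.induction_on' with
  | add p q hp hq => simp [hp, hq, add_mul]
  | monomial k c =>
    rw [Polynomial.aeval_monomial, Polynomial.aeval_monomial, Module.End.mul_apply,
      Module.algebraMap_end_apply, Pi.smul_apply]
    have : ((eulerOp n₀) ^ k) U m =
        (PowerSeries.C ((n₀ : ℂ) + m) + PowerSeries.X) ^ k * U m := by
      induction k with
      | zero => simp
      | succ k ih =>
        rw [pow_succ', Module.End.mul_apply, pow_succ', mul_assoc, ← ih]
        rfl
    rw [this, mul_assoc, ← Algebra.smul_def]

/-- The function `∑_m [P^i] (U_m(P) e^{(n₀ + m + P) x})`. -/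
def expSum (i : ℕ) (n₀ : ℚ) (U : ℕ → PowerSeries ℂ) (x : ℂ) : ℂ :=
  ∑' m : ℕ, PowerSeries.coeff i (U m * expSeries x) * Complex.exp (((n₀ : ℂ) + m) * x)

theorem IsRapid.exists_norm_coeff_mul_expSeries_le {U : ℕ → PowerSeries ℂ} (hU : IsRapid U)
    (i : ℕ) {ρ R : ℝ} (hρ : 0 < ρ) (hR : 0 < R) :
    ∃ B : ℝ, 0 ≤ B ∧ ∀ m x, ‖PowerSeries.coeff i (U m * expSeries x)‖ ≤
      B / R ^ m * Real.exp (ρ * ‖x‖) := by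
  choose C hC using fun a => hU a R hR
  have hC0 : ∀ a, 0 ≤ C a := fun a => le_trans (by positivity) (hC a 0)
  refine ⟨∑ p ∈ antidiagonal i, C p.1 / ρ ^ p.2,
    Finset.sum_nonneg fun p _ => div_nonneg (hC0 _) (by positivity), fun m x => ?_⟩
  rw [PowerSeries.coeff_mul, Finset.sum_div, Finset.sum_mul]
  refine (norm_sum_le _ _).trans (Finset.sum_le_sum fun p _ => ?_)
  rw [norm_mul, coeff_expSeries, norm_div, norm_pow, Complex.norm_natCast]
  have h1 : ‖PowerSeries.coeff p.1 (U m)‖ ≤ C p.1 / R ^ m := by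
    rw [le_div_iff₀ (by positivity)]; exact hC _ m
  have h2 : ‖x‖ ^ p.2 / p.2.factorial ≤ Real.exp (ρ * ‖x‖) / ρ ^ p.2 := by
    rw [le_div_iff₀ (by positivity)]
    have := Real.pow_div_factorial_le_exp (ρ * ‖x‖) (by positivity) p.2
    rw [mul_pow] at this
    refine le_trans (le_of_eq ?_) this
    ring
  calc _ ≤ C p.1 / R ^ m * (Real.exp (ρ * ‖x‖) / ρ ^ p.2) := by
        have := hC0 p.1
        gcongr
    _ = _ := by ring

/-- Locally uniform domination of the terms of `expSum`. -/
theorem IsRapid.exists_norm_expSum_term_le {U : ℕ → PowerSeries ℂ} (hU : IsRapid U)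
    (i : ℕ) (n₀ : ℚ) (X : ℝ) :
    ∃ B : ℝ, ∀ m x, ‖x‖ < X →
      ‖PowerSeries.coeff i (U m * expSeries x) * Complex.exp (((n₀ : ℂ) + m) * x)‖ ≤
        B * (1 / 2) ^ m := by
  obtain ⟨B, hB0, hB⟩ := hU.exists_norm_coeff_mul_expSeries_le i (ρ := 1) (R := 2 * Real.exp X)
    one_pos (by positivity)
  refine ⟨B * Real.exp X * Real.exp (‖(n₀ : ℂ)‖ * X), fun m x hx => ?_⟩
  have h1 : ‖Complex.exp (((n₀ : ℂ) + m) * x)‖ ≤ Real.exp (‖(n₀ : ℂ)‖ * X) * Real.exp X ^ m := by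
    rw [← Real.exp_nat_mul, ← Real.exp_add]
    refine (Complex.norm_exp_le_exp_norm _).trans (Real.exp_le_exp.2 ?_)
    rw [norm_mul, ← add_mul]
    gcongr
    refine (norm_add_le _ _).trans ?_
    rw [Complex.norm_natCast]
  rw [norm_mul]
  calc _ ≤ (B / (2 * Real.exp X) ^ m * Real.exp (1 * X)) *
        (Real.exp (‖(n₀ : ℂ)‖ * X) * Real.exp X ^ m) := by
        gcongr
        refine (hB m x).trans ?_
        gcongr
    _ = _ := by
        rw [mul_pow, one_mul, one_div, inv_pow]
        field_simp

theorem IsRapid.summable {U : ℕ → PowerSeries ℂ} (hU : IsRapid U) (i : ℕ) (n₀ : ℚ) (x : ℂ) :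
    Summable fun m : ℕ =>
      PowerSeries.coeff i (U m * expSeries x) * Complex.exp (((n₀ : ℂ) + m) * x) := by
  obtain ⟨B, hB⟩ := hU.exists_norm_expSum_term_le i n₀ (‖x‖ + 1)
  exact Summable.of_norm_bounded
    ((summable_geometric_of_lt_one (by norm_num) (by norm_num)).mul_left B)
    fun m => hB m x (by linarith)

theorem hasDerivAt_expSum_term (U : ℕ → PowerSeries ℂ) (i : ℕ) (n₀ : ℚ) (m : ℕ) (x : ℂ) :
    HasDerivAt
      (fun x => PowerSeries.coeff i (U m * expSeries x) * Complex.exp (((n₀ : ℂ) + m) * x))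
      (PowerSeries.coeff i (eulerOp n₀ U m * expSeries x) * Complex.exp (((n₀ : ℂ) + m) * x))
      x := by
  have h1 : HasDerivAt (fun x => Complex.exp (((n₀ : ℂ) + m) * x))
      (Complex.exp (((n₀ : ℂ) + m) * x) * (((n₀ : ℂ) + m) * 1)) x :=
    ((hasDerivAt_id x).const_mul _).cexp
  refine ((hasDerivAt_coeff_mul_expSeries (U m) i x).mul h1).congr_deriv ?_
  have e : eulerOp n₀ U m * expSeries x = PowerSeries.C ((n₀ : ℂ) + m) * (U m * expSeries x) +
      PowerSeries.X * U m * expSeries x := by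
    change (PowerSeries.C ((n₀ : ℂ) + m) + PowerSeries.X) * U m * expSeries x = _
    ring
  rw [e, map_add, PowerSeries.coeff_C_mul]
  ring

theorem IsRapid.hasDerivAt_expSum {U : ℕ → PowerSeries ℂ} (hU : IsRapid U) (i : ℕ) (n₀ : ℚ)
    (x : ℂ) : HasDerivAt (expSum i n₀ U) (expSum i n₀ (LGFano.eulerOp n₀ U) x) x := by
  obtain ⟨B, hB⟩ := hU.exists_norm_expSum_term_le i n₀ (‖x‖ + 1)
  have hsum : Summable fun m : ℕ => B * (1 / 2 : ℝ) ^ m :=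
    (summable_geometric_of_lt_one (by norm_num) (by norm_num)).mul_left B
  have hx : x ∈ Metric.ball (0 : ℂ) (‖x‖ + 1) := by simp
  have hd : ∀ m, DifferentiableOn ℂ (fun x => PowerSeries.coeff i (U m * expSeries x) *
      Complex.exp (((n₀ : ℂ) + m) * x)) (Metric.ball 0 (‖x‖ + 1)) := fun m y _ =>
    (hasDerivAt_expSum_term U i n₀ m y).differentiableAt.differentiableWithinAt
  have hb : ∀ m, ∀ y ∈ Metric.ball (0 : ℂ) (‖x‖ + 1), ‖PowerSeries.coeff i (U m * expSeries y) *
      Complex.exp (((n₀ : ℂ) + m) * y)‖ ≤ B * (1 / 2) ^ m := fun m y hy =>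
    hB m y (by simpa using hy)
  have h1 := Complex.hasSum_deriv_of_summable_norm hsum hd Metric.isOpen_ball hb hx
  have h2 := (Complex.differentiableOn_tsum_of_summable_norm hsum hd Metric.isOpen_ball
    hb).differentiableAt
    (Metric.isOpen_ball.mem_nhds hx)
  have h3 := h2.hasDerivAt
  refine h3.congr_deriv ?_
  rw [← h1.tsum_eq]
  exact tsum_congr fun m => (hasDerivAt_expSum_term U i n₀ m x).deriv

/-- At `q = 0` the exponents `n₀ + m` are harmless, and the powers of `log q` grow slower than any
power of `q`. -/
theorem IsRapid.exists_norm_expSum_le {U : ℕ → PowerSeries ℂ} (hU : IsRapid U) (i : ℕ) {n₀ : ℚ}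
    (hn : 0 ≤ n₀) {ρ : ℝ} (hρ : 0 < ρ) :
    ∃ B : ℝ, ∀ x : ℂ, x.re ≤ 0 → ‖expSum i n₀ U x‖ ≤ B * Real.exp (ρ * ‖x‖) := by
  obtain ⟨B, hB0, hB⟩ := hU.exists_norm_coeff_mul_expSeries_le i hρ (R := 2) (by norm_num)
  refine ⟨B * 2, fun x hx => ?_⟩
  have hn' : (0 : ℝ) ≤ n₀ := by exact_mod_cast hn
  have hterm : ∀ m : ℕ, ‖PowerSeries.coeff i (U m * expSeries x) *
      Complex.exp (((n₀ : ℂ) + m) * x)‖ ≤ B * Real.exp (ρ * ‖x‖) * (1 / 2) ^ m := fun m => by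
    have h1 : ‖Complex.exp (((n₀ : ℂ) + m) * x)‖ ≤ 1 := by
      rw [norm_exp_mul, Real.exp_le_one_iff]
      simp
      exact mul_nonpos_of_nonneg_of_nonpos (by positivity) hx
    rw [norm_mul]
    refine (mul_le_of_le_one_right (norm_nonneg _) h1).trans ((hB m x).trans (le_of_eq ?_))
    rw [one_div, inv_pow]
    ring
  have hs : HasSum (fun m : ℕ => B * Real.exp (ρ * ‖x‖) * (1 / 2 : ℝ) ^ m)
      (B * Real.exp (ρ * ‖x‖) * 2) := hasSum_geometric_two.mul_left _
  refine (tsum_of_norm_bounded hs hterm).trans (le_of_eq (by ring))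

theorem expSeries_add (x y : ℂ) : expSeries (x + y) = expSeries x * expSeries y :=
  (PowerSeries.exp_mul_exp_eq_exp_add x y).symm

theorem IsRapid.expSum_add_period {U : ℕ → PowerSeries ℂ} (hU : IsRapid U) (i : ℕ) (n₀ : ℚ)
    (x : ℂ) {T : ℂ} (hT : ∀ m : ℕ, Complex.exp (m * T) = 1) : expSum i n₀ U (x + T) =
      Complex.exp (n₀ * T) * ∑ p ∈ antidiagonal i,
        T ^ p.2 / (p.2.factorial : ℂ) * expSum p.1 n₀ U x := by
  have hterm : ∀ m : ℕ, PowerSeries.coeff i (U m * expSeries (x + T)) *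
      Complex.exp (((n₀ : ℂ) + m) * (x + T)) =
      Complex.exp (n₀ * T) * ∑ p ∈ antidiagonal i, T ^ p.2 / (p.2.factorial : ℂ) *
          (PowerSeries.coeff p.1 (U m * expSeries x) * Complex.exp (((n₀ : ℂ) + m) * x)) := by
    intro m
    have hE : Complex.exp (((n₀ : ℂ) + m) * (x + T)) =
        Complex.exp (n₀ * T) * Complex.exp (((n₀ : ℂ) + m) * x) := by
      rw [show ((n₀ : ℂ) + m) * (x + T) = m * T + (n₀ * T + ((n₀ : ℂ) + m) * x) by ring,
        Complex.exp_add, hT, one_mul, Complex.exp_add]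
    have hcomm : ∀ A B E E' : ℂ, A * B * (E' * E) = E' * (B * (A * E)) := fun A B E E' => by ring
    rw [hE, expSeries_add, ← mul_assoc (U m), PowerSeries.coeff_mul, Finset.sum_mul, Finset.mul_sum]
    simp only [hcomm, coeff_expSeries]
  unfold expSum
  have hs : ∀ p ∈ antidiagonal i, Summable fun m : ℕ => T ^ p.2 / (p.2.factorial : ℂ) *
      (PowerSeries.coeff p.1 (U m * expSeries x) * Complex.exp (((n₀ : ℂ) + m) * x)) :=
    fun p _ => (hU.summable p.1 n₀ x).mul_left _
  rw [tsum_congr hterm, tsum_mul_left, Summable.tsum_finsetSum hs]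
  simp_rw [tsum_mul_left]

/-- The monodromy of `expSum` around `q = 0`. -/
theorem IsRapid.expSum_add_two_pi_I {U : ℕ → PowerSeries ℂ} (hU : IsRapid U) (i : ℕ) (n₀ : ℚ)
    (x : ℂ) : expSum i n₀ U (x + 2 * Real.pi * Complex.I) =
      Complex.exp (n₀ * (2 * Real.pi * Complex.I)) * ∑ p ∈ antidiagonal i,
        (2 * Real.pi * Complex.I) ^ p.2 / (p.2.factorial : ℂ) * expSum p.1 n₀ U x :=
  hU.expSum_add_period i n₀ x Complex.exp_nat_mul_two_pi_mul_I

/-! ### The coefficients of the Gromov-Witten I-function -/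

/-- The coefficient of `q^{n+P}` in the `f`-sector of the I-function at `z = 1`, where
`n = sectorExponent f m`, as a power series in `P`. -/
def sectorSeries {N : ℕ} (d : ℕ) (w : Fin N → ℕ) (f : ℚ) (m : ℕ) : PowerSeries ℂ :=
  hypergeometricFactor d (sectorExponent f m) 1 *
    ∏ j, (hypergeometricFactor (w j) (sectorExponent f m) 1)⁻¹

theorem mem_sectors_iff {N : ℕ} {w : Fin N → ℕ} (hw : ∀ j, 0 < w j) {f : ℚ} :
    f ∈ sectors w ↔ (0 ≤ f ∧ f < 1) ∧ 0 < fixedDim w f := by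
  have hcard : 0 < fixedDim w f ↔ ∃ j, Int.fract ((w j : ℚ) * f) = 0 := by
    unfold fixedDim
    rw [Finset.card_pos]
    simp [Finset.Nonempty]
  rw [hcard]
  simp only [sectors, mem_biUnion, mem_univ, true_and, mem_image, mem_range]
  constructor
  · rintro ⟨j, k, hk, rfl⟩
    have hj : (0 : ℚ) < w j := by exact_mod_cast hw j
    refine ⟨⟨by positivity, ?_⟩, j, ?_⟩
    · rw [div_lt_one hj]; exact_mod_cast hk
    · rw [mul_div_cancel₀ _ hj.ne', Int.fract_natCast]
  · rintro ⟨⟨h0, h1⟩, j, hj⟩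
    have hwj : (0 : ℚ) < w j := by exact_mod_cast hw j
    rw [mul_comm] at hj
    have hk := ceil_eq_of_fract_eq_zero h0 (by rwa [mul_comm] at hj)
    refine ⟨j, ⌈f * (w j : ℚ)⌉₊, ?_, ?_⟩
    · have : (⌈f * (w j : ℚ)⌉₊ : ℚ) < w j := by rw [hk]; nlinarith
      exact_mod_cast this
    · rw [hk, mul_div_cancel_right₀ _ hwj.ne']

theorem sectorExponent_nonneg (f : ℚ) (m : ℕ) : 0 ≤ sectorExponent f m :=
  add_nonneg (Int.fract_nonneg _) m.cast_nonneg

theorem sectorExponent_zero (f : ℚ) : sectorExponent f 0 = Int.fract (1 - f) := by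
  simp [sectorExponent]

theorem sectorExponent_eq_add (f : ℚ) (m : ℕ) :
    sectorExponent f m = sectorExponent f 0 + m := by
  simp [sectorExponent]

theorem exists_natCast_eq_mul_of_fixedDim_pos {N : ℕ} {d : ℕ} {w : Fin N → ℕ}
    (hdvd : ∀ j, w j ∣ d) {n : ℚ} (hn : 0 ≤ n) (h : 0 < fixedDim w n) :
    ∃ a : ℕ, n * d = a := by
  obtain ⟨j, hj⟩ := Finset.card_pos.1 h
  obtain ⟨e, he⟩ := hdvd j
  have h1 := ceil_eq_of_fract_eq_zero hn (mem_filter.1 hj).2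
  refine ⟨⌈n * (w j : ℚ)⌉₊ * e, ?_⟩
  rw [he]
  push_cast
  rw [h1]; ring

theorem fract_natCast_mul_fract_one_sub (c : ℕ) (f : ℚ) :
    Int.fract ((c : ℚ) * Int.fract (1 - f)) = 0 ↔ Int.fract ((c : ℚ) * f) = 0 := by
  have e : (c : ℚ) * Int.fract (1 - f) = -(c * f) + ((c - c * ⌊1 - f⌋ : ℤ) : ℚ) := by
    rw [Int.fract]; push_cast; ring
  rw [e, Int.fract_add_intCast, Int.fract_neg_eq_zero]

theorem fixedDim_sectorExponent {N : ℕ} (w : Fin N → ℕ) (f : ℚ) (m : ℕ) :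
    fixedDim w (sectorExponent f m) = fixedDim w f := by
  unfold fixedDim
  congr 1
  refine Finset.filter_congr fun j _ => ?_
  rw [sectorExponent, fract_mul_add_natCast, fract_natCast_mul_fract_one_sub]

theorem exists_sectorExponent_mul_eq {N : ℕ} {d : ℕ} {w : Fin N → ℕ} (hw : ∀ j, 0 < w j)
    (hdvd : ∀ j, w j ∣ d) {f : ℚ} (hf : f ∈ sectors w) (m : ℕ) :
    ∃ a : ℕ, sectorExponent f m * d = a := by
  refine exists_natCast_eq_mul_of_fixedDim_pos hdvd (sectorExponent_nonneg f m) ?_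
  rw [fixedDim_sectorExponent]
  exact ((mem_sectors_iff hw).1 hf).2

theorem sectorSeries_eq_taylorAtZero {N : ℕ} {d : ℕ} {w : Fin N → ℕ} (hd : 0 < d)
    (hw : ∀ j, 0 < w j) (hdvd : ∀ j, w j ∣ d) {f : ℚ} (hf : f ∈ sectors w) (m : ℕ) :
    sectorSeries d w f m = taylorAtZero (hypergeometricTerm d w (sectorExponent f m)) := by
  obtain ⟨a, ha⟩ := exists_sectorExponent_mul_eq hw hdvd hf m
  rw [taylorAtZero_hypergeometricTerm hd hdvd ha]
  rfl

theorem coeff_smallIGWTerm {N : ℕ} (d : ℕ) (w : Fin N → ℕ) (x : ℂ) (f : ℚ) (m i : ℕ) :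
    PowerSeries.coeff i (smallIGWTerm d w x 1 (sectorExponent f m)) =
      PowerSeries.coeff i (sectorSeries d w f m * expSeries x) *
        Complex.exp (((sectorExponent f 0 : ℚ) + m : ℂ) * x) := by
  have e : smallIGWTerm d w x 1 (sectorExponent f m) =
      PowerSeries.C (Complex.exp ((sectorExponent f m : ℚ) * x)) *
        (sectorSeries d w f m * expSeries x) := by
    unfold smallIGWTerm sectorSeries
    rw [div_one, map_one, one_mul]
    ring
  rw [e, PowerSeries.coeff_C_mul, mul_comm, sectorExponent_eq_add f m]
  push_cast
  rfl

theorem smallIGW_eq_expSum {N : ℕ} (d : ℕ) (w : Fin N → ℕ) (x : ℂ)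
    (p : Σ f : sectors w, Fin (fixedDim w (f : ℚ) - 1)) :
    smallIGW d w x 1 p =
      expSum p.2 (sectorExponent (p.1 : ℚ) 0) (sectorSeries d w (p.1 : ℚ)) x :=
  tsum_congr fun m => coeff_smallIGWTerm d w x _ m _

/-- Cauchy estimates turn the decay of `hypergeometricTerm` near `P = 0` into decay of its Taylor
coefficients. -/
theorem isRapid_sectorSeries {N : ℕ} {d : ℕ} {w : Fin N → ℕ} (hd : 0 < d)
    (hw : ∀ j, 0 < w j) (hdvd : ∀ j, w j ∣ d) (hr : d < ∑ j, w j) {f : ℚ} (hf : f ∈ sectors w) :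
    IsRapid (sectorSeries d w f) := by
  intro i R hR
  have hd1 : (1 : ℝ) ≤ d := by exact_mod_cast hd
  obtain ⟨C, hC, hb⟩ := exists_norm_hypergeometricTerm_le hd hw hdvd hr
  set δ : ℝ := 1 / (2 * d) with hδ
  have hδ0 : 0 < δ := by positivity
  have hlt : δ < 1 / d := by
    rw [hδ, div_lt_div_iff₀ (by positivity) (by positivity)]; linarith
  have hball : ∀ P ∈ Metric.closedBall (0 : ℂ) δ, |P.re| ≤ δ := fun P hP =>
    (Complex.abs_re_le_norm P).trans (by simpa using hP)
  have hdiff : ∀ m, DifferentiableOn ℂ (hypergeometricTerm d w (sectorExponent f m))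
      (Metric.closedBall 0 δ) := fun m P hP => by
    obtain ⟨a, ha⟩ := exists_sectorExponent_mul_eq hw hdvd hf m
    exact (differentiableAt_hypergeometricTerm hd hdvd ha
      (by linarith [(abs_le.1 (hball P hP)).1])).differentiableWithinAt
  obtain ⟨B, hB⟩ := (isCompact_closedBall (0 : ℂ) δ).exists_bound_of_continuousOn
    (hdiff 0).continuousOn
  have hB0 : 0 ≤ B := (norm_nonneg _).trans (hB 0 (by simpa using hδ0.le))
  have hcoeff : ∀ m, ‖PowerSeries.coeff i (sectorSeries d w f m)‖ ≤
      C ^ m / m.factorial * B / δ ^ i := fun m => by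
    rw [sectorSeries_eq_taylorAtZero hd hw hdvd hf]
    refine norm_coeff_taylorAtZero_le hδ0 (hdiff m) (fun P hP => ?_) i
    have hP' := Metric.sphere_subset_closedBall hP
    rw [sectorExponent_eq_add]
    refine (hb _ P m (sectorExponent_nonneg f 0) (hball P hP')).trans ?_
    gcongr
    exact hB P hP'
  refine ⟨Real.exp (C * R) * B / δ ^ i, fun m => ?_⟩
  calc _ ≤ C ^ m / m.factorial * B / δ ^ i * R ^ m := by gcongr; exact hcoeff m
    _ = ((C * R) ^ m / m.factorial) * (B / δ ^ i) := by rw [mul_pow]; ring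
    _ ≤ Real.exp (C * R) * (B / δ ^ i) := by
        gcongr
        exact Real.pow_div_factorial_le_exp _ (by positivity) _
    _ = _ := by ring

/-! ### The residues of the Barnes integrand -/

/-- The value `e^{-2πi(k+1)/d}` of `e^{2πis}` at the poles `s = -(dl + k + 1)/d` which produce the
`φ_k`-component of the FJRW I-function. -/
def unityRoot (d k : ℕ) : ℂ := Complex.exp (-(2 * Real.pi * Complex.I * ((k + 1) / d)))

theorem unityRoot_pow {d : ℕ} (hd : 0 < d) (k : ℕ) : unityRoot d k ^ d = 1 := by
  have hd' : (d : ℂ) ≠ 0 := by exact_mod_cast hd.ne'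
  rw [unityRoot, ← Complex.exp_nat_mul, Complex.exp_eq_one_iff]
  refine ⟨-(k + 1), ?_⟩
  push_cast
  field_simp

theorem eq_zero_of_mul_eq_intCast {d : ℕ} (hd : 0 < d) {P : ℂ} (hP : |P.re| ≤ 1 / (2 * d)) {b : ℤ}
    (h : (d : ℂ) * P = b) : P = 0 := by
  have hd' : (0 : ℝ) < d := by exact_mod_cast hd
  have hd'' : (d : ℂ) ≠ 0 := by exact_mod_cast hd.ne'
  have h1 := congrArg Complex.re h
  simp only [Complex.mul_re, Complex.natCast_re, Complex.natCast_im, zero_mul, sub_zero,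
    Complex.intCast_re] at h1
  have h2 : |(b : ℝ)| ≤ 1 / 2 := by
    rw [← h1, abs_mul, abs_of_pos hd']
    calc (d : ℝ) * |P.re| ≤ d * (1 / (2 * d)) := by gcongr
      _ = 1 / 2 := by field_simp
  have h3 : b = 0 := by
    have : |b| < 1 := by
      have : ((|b| : ℤ) : ℝ) < 1 := by rw [Int.cast_abs]; linarith
      exact_mod_cast this
    exact Int.abs_lt_one_iff.1 this
  rw [h3, Int.cast_zero] at h
  exact (mul_eq_zero.1 h).resolve_left hd''

theorem eq_zero_of_exp_eq_unityRoot {d k : ℕ} (hd : 0 < d) {s₀ : ℂ} {a : ℤ} (hs₀ : s₀ * d = a)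
    {P : ℂ} (hP : |P.re| ≤ 1 / (2 * d))
    (h : Complex.exp (2 * Real.pi * Complex.I * (s₀ + P)) = unityRoot d k) :
    P = 0 ∧ (d : ℤ) ∣ a + k + 1 := by
  have hd' : (d : ℂ) ≠ 0 := by exact_mod_cast hd.ne'
  obtain ⟨n, hn⟩ := Complex.exp_eq_exp_iff_exists_int.1 h
  have h2 : (d : ℂ) * (s₀ + P) = n * d - (k + 1) := by
    refine mul_left_cancel₀ Complex.two_pi_I_ne_zero ?_
    rw [mul_left_comm, hn]
    field_simp
    ring
  have h3 : (d : ℂ) * P = ((n * d - (k + 1) - a : ℤ) : ℂ) := by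
    push_cast
    linear_combination h2 - hs₀
  have h4 := eq_zero_of_mul_eq_intCast hd hP h3
  refine ⟨h4, n, ?_⟩
  rw [h4, mul_zero] at h3
  have h5 : n * d - (k + 1) - a = 0 := by exact_mod_cast h3.symm
  linarith

theorem exp_eq_unityRoot_of_dvd {d k : ℕ} (hd : 0 < d) {s₀ : ℂ} {a : ℤ} (hs₀ : s₀ * d = a)
    (h : (d : ℤ) ∣ a + k + 1) :
    Complex.exp (2 * Real.pi * Complex.I * s₀) = unityRoot d k := by
  have hd' : (d : ℂ) ≠ 0 := by exact_mod_cast hd.ne'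
  obtain ⟨n, hn⟩ := h
  refine Complex.exp_eq_exp_iff_exists_int.2 ⟨n, ?_⟩
  have h1 : (a : ℂ) + k + 1 = d * n := by exact_mod_cast hn
  have h2 : s₀ = n - (k + 1) / d := by
    field_simp
    linear_combination hs₀ + h1
  rw [h2]; ring

theorem differentiableAt_gammaRatio_add {N : ℕ} {d : ℕ} {w : Fin N → ℕ} (hd : 0 < d)
    (hdvd : ∀ j, w j ∣ d) {s₀ : ℝ} {a : ℤ} (hs₀ : s₀ * d = a)
    (hnar : ∀ j, ∀ m : ℕ, (w j : ℝ) * s₀ ≠ m) {P : ℂ} (hP : |P.re| ≤ 1 / (2 * d)) :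
    DifferentiableAt ℂ (gammaRatio d w) (s₀ + P) := by
  refine differentiableAt_gammaRatio d fun j m h => ?_
  obtain ⟨e, he⟩ := hdvd j
  have hs₀' : (s₀ : ℂ) * d = a := by exact_mod_cast hs₀
  have h1 : (d : ℂ) * P = ((e * m - a : ℤ) : ℂ) := by
    rw [he] at hs₀' ⊢
    push_cast at hs₀' ⊢
    linear_combination (e : ℂ) * h - hs₀'
  have h2 := eq_zero_of_mul_eq_intCast hd hP h1
  rw [h2, add_zero] at h
  exact hnar j m (by exact_mod_cast h)

/-- The function `(e^{2πiP} - 1) / P`, extended to `P = 0`, has no zeros in the strip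
`|Re P| ≤ 1 / (2d)`. -/
theorem dslope_exp_ne_zero {d : ℕ} (hd : 0 < d) {P : ℂ} (hP : |P.re| ≤ 1 / (2 * d)) :
    dslope (fun P : ℂ => Complex.exp (2 * Real.pi * Complex.I * P)) 0 P ≠ 0 := by
  rcases eq_or_ne P 0 with rfl | h0
  · rw [dslope_same]
    have : HasDerivAt (fun P : ℂ => Complex.exp (2 * Real.pi * Complex.I * P))
        (Complex.exp (2 * Real.pi * Complex.I * 0) * (2 * Real.pi * Complex.I * 1)) 0 :=
      ((hasDerivAt_id (0 : ℂ)).const_mul _).cexp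
    rw [this.deriv]
    simp
  · rw [dslope_of_ne _ h0, slope_def_field]
    refine div_ne_zero (fun h => h0 ?_) (by simpa using h0)
    rw [mul_zero, Complex.exp_zero, sub_eq_zero] at h
    obtain ⟨n, hn⟩ := Complex.exp_eq_one_iff.1 h
    refine eq_zero_of_mul_eq_intCast hd hP (b := d * n) ?_
    have : P = n := mul_left_cancel₀ Complex.two_pi_I_ne_zero (by rw [hn]; ring)
    rw [this]; push_cast; rfl

theorem deriv_exp_two_pi_I : deriv (fun P : ℂ => Complex.exp (2 * Real.pi * Complex.I * P)) 0 =
    2 * Real.pi * Complex.I := by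
  have : HasDerivAt (fun P : ℂ => Complex.exp (2 * Real.pi * Complex.I * P))
      (Complex.exp (2 * Real.pi * Complex.I * 0) * (2 * Real.pi * Complex.I * 1)) 0 :=
    ((hasDerivAt_id (0 : ℂ)).const_mul _).cexp
  rw [this.deriv]
  simp

/-- At a point of `(1 / d) ℤ` where `gammaRatio` is regular, the only pole is that of the periodic
kernel. -/
theorem barnesIntegral_sub_of_narrow {N : ℕ} {d : ℕ} {w : Fin N → ℕ} (hd : 0 < d)
    (hw : ∀ j, 0 < w j) (hdvd : ∀ j, w j ∣ d) (k : ℕ) {x : ℂ}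
    (hx : |x.im - sectorCenter d w| ≤ sectorRadius d w) {s₀ : ℝ} {a : ℤ} (hs₀ : s₀ * d = a)
    (hnar : ∀ j, ∀ m : ℕ, (w j : ℝ) * s₀ ≠ m) :
    barnesIntegral d w (unityRoot d k) x (s₀ + 1 / (2 * d)) -
      barnesIntegral d w (unityRoot d k) x (s₀ - 1 / (2 * d)) =
      if (d : ℤ) ∣ a + k + 1 then
        (Complex.I * unityRoot d k)⁻¹ * (gammaRatio d w s₀ * Complex.exp (s₀ * x)) else 0 := by
  have hs₀' : (s₀ : ℂ) * d = a := by exact_mod_cast hs₀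
  have hζ := unityRoot_pow hd k
  have hζ0 : unityRoot d k ≠ 0 := Complex.exp_ne_zero _
  have hG : ∀ P : ℂ, |P.re| ≤ 1 / (2 * d) →
      DifferentiableAt ℂ (fun P => gammaRatio d w (s₀ + P)) P := fun P hP =>
    DifferentiableAt.comp P (f := fun P : ℂ => (s₀ : ℂ) + P)
      (differentiableAt_gammaRatio_add hd hdvd hs₀ hnar hP) (by fun_prop)
  split_ifs with hk
  · set E : ℂ → ℂ := fun P => Complex.exp (2 * Real.pi * Complex.I * P) with hE
    have hE0 : E 0 = 1 := by simp [hE]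
    have hEd : Differentiable ℂ (dslope E 0) := by
      rw [← differentiableOn_univ, Complex.differentiableOn_dslope univ_mem]
      fun_prop
    have := barnesIntegral_sub hd hw hdvd hζ hx hs₀ 1
      (h := fun P => gammaRatio d w (s₀ + P) * (unityRoot d k * dslope E 0 P)⁻¹ *
        Complex.exp ((s₀ + P) * x)) (fun P hP => ?_) (fun P hP hP0 => ?_)
    · rw [this, if_neg one_ne_zero, coeff_taylorAtZero]
      simp only [tsub_self, iteratedDeriv_zero, Nat.factorial_zero, Nat.cast_one, div_one,
        add_zero, dslope_same]
      rw [hE, deriv_exp_two_pi_I]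
      have hpi : (Real.pi : ℂ) ≠ 0 := by exact_mod_cast Real.pi_ne_zero
      field_simp
    · refine DifferentiableAt.differentiableWithinAt ?_
      refine ((hG P hP).mul (DifferentiableAt.inv (by fun_prop) ?_)).mul (by fun_prop)
      exact mul_ne_zero hζ0 (dslope_exp_ne_zero hd hP)
    · have h1 : Complex.exp (2 * Real.pi * Complex.I * (s₀ + P)) = unityRoot d k * E P := by
        rw [mul_add, Complex.exp_add, exp_eq_unityRoot_of_dvd hd hs₀' hk]
      have h2 : dslope E 0 P = (E P - 1) / P := by
        rw [dslope_of_ne _ hP0, slope_def_field, hE0, sub_zero]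
      unfold barnesIntegrand periodicKernel
      rw [h1, h2, pow_one]
      rw [show unityRoot d k * E P - unityRoot d k = unityRoot d k * (E P - 1) by ring]
      rw [mul_inv, mul_inv, inv_div]
      field_simp
  · have := barnesIntegral_sub hd hw hdvd hζ hx hs₀ 0
      (h := fun P => barnesIntegrand d w (unityRoot d k) x (s₀ + P)) (fun P hP => ?_)
      (fun P _ _ => by rw [pow_zero, div_one])
    · rw [this, if_pos rfl]
    · refine DifferentiableAt.differentiableWithinAt ?_
      unfold barnesIntegrand
      refine ((hG P hP).mul ?_).mul (by fun_prop)
      exact DifferentiableAt.comp P (f := fun P : ℂ => (s₀ : ℂ) + P)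
        (differentiableAt_periodicKernel fun h =>
          hk (eq_zero_of_exp_eq_unityRoot hd hs₀' hP h).2) (by fun_prop)

/-- The coefficients of the linear map `L_GW`, up to normalization: the Laurent coefficients at
`s = n` of `gammaRatio` times the periodic kernel, with the hypergeometric factor removed. -/
def connectionCoeff {N : ℕ} (d : ℕ) (w : Fin N → ℕ) (k : ℕ) (n : ℚ) (i : ℕ) : ℂ :=
  2 * Real.pi * PowerSeries.coeff (fixedDim w n - 2 - i)
    (taylorAtZero fun P => regularRatio d w n P * periodicKernel (unityRoot d k) (n + P))

theorem not_dvd_of_narrow {N : ℕ} {d a k : ℕ} {w : Fin N → ℕ} (hd : 0 < d)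
    (hk : k ∈ narrowSet d w) {n : ℚ} (hn0 : 0 ≤ n) (hn : n * d = a) (hN : 0 < fixedDim w n) :
    ¬ (d : ℤ) ∣ (a : ℤ) + k + 1 := by
  rintro ⟨z, hz⟩
  obtain ⟨j, hj⟩ := Finset.card_pos.1 hN
  have h1 := ceil_eq_of_fract_eq_zero hn0 (mem_filter.1 hj).2
  set b := ⌈n * (w j : ℚ)⌉₊
  refine (mem_filter.1 hk).2 j ?_
  have hd' : (d : ℚ) ≠ 0 := by exact_mod_cast hd.ne'
  have h2 : (a * w j : ℚ) = b * d := by rw [h1, ← hn]; ring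
  have h3 : (a * w j : ℤ) = b * d := by exact_mod_cast h2
  zify
  refine ⟨z * w j - b, ?_⟩
  linear_combination (w j : ℤ) * hz - h3

/-- At a sector exponent, the residue is a linear form in the coefficients of the I-function. -/
theorem barnesIntegral_sub_of_sector {N : ℕ} {d a k : ℕ} {w : Fin N → ℕ} (hd : 0 < d)
    (hw : ∀ j, 0 < w j) (hdvd : ∀ j, w j ∣ d) (hk : k ∈ narrowSet d w) {x : ℂ}
    (hx : |x.im - sectorCenter d w| ≤ sectorRadius d w) {n : ℚ} (hn0 : 0 ≤ n) (hn : n * d = a) :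
    barnesIntegral d w (unityRoot d k) x (n + 1 / (2 * d)) -
      barnesIntegral d w (unityRoot d k) x (n - 1 / (2 * d)) =
      ∑ i ∈ range (fixedDim w n - 1),
        connectionCoeff d w k n i * PowerSeries.coeff i (smallIGWTerm d w x 1 n) := by
  have hd' : (0 : ℝ) < d := by exact_mod_cast hd
  have hζ := unityRoot_pow hd k
  have hnR : ((n : ℚ) : ℝ) * d = (a : ℤ) := by exact_mod_cast hn
  have hnC : ((n : ℚ) : ℂ) * d = (a : ℤ) := by exact_mod_cast hn
  rcases Nat.eq_zero_or_pos (fixedDim w n) with hN | hN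
  · rw [hN]
    simp only [zero_tsub, range_zero, sum_empty]
    rw [barnesIntegral_sub_of_narrow hd hw hdvd k hx hnR]
    · split_ifs
      -- The zero of `1 / Γ(-d s)` cancels the pole of the periodic kernel.
      · have : gammaRatio d w ((n : ℝ) : ℂ) = 0 := by
          unfold gammaRatio
          have : -((d : ℂ) * ((n : ℝ) : ℂ)) = -(a : ℕ) := by
            have : (n : ℂ) * d = (a : ℕ) := by exact_mod_cast hn
            push_cast
            linear_combination -this
          rw [this, Complex.Gamma_neg_nat_eq_zero, inv_zero, mul_zero]
        rw [this]; ring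
      · rfl
    · intro j m h
      have h1 : (w j : ℚ) * n = m := by exact_mod_cast h
      unfold fixedDim at hN
      rw [Finset.card_eq_zero] at hN
      have : j ∈ univ.filter fun j => Int.fract ((w j : ℚ) * n) = 0 :=
        mem_filter.2 ⟨mem_univ j, by rw [h1, Int.fract_natCast]⟩
      rw [hN] at this
      simp at this
  · have hlt : 1 / (2 * (d : ℝ)) < 1 / d := by
      rw [div_lt_div_iff₀ (by positivity) (by positivity)]; linarith
    have hker : ∀ P : ℂ, |P.re| ≤ 1 / (2 * d) →
        DifferentiableAt ℂ (fun P => periodicKernel (unityRoot d k) (n + P)) P := fun P hP =>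
      DifferentiableAt.comp P (f := fun P : ℂ => (n : ℂ) + P)
        (differentiableAt_periodicKernel fun h => not_dvd_of_narrow hd hk hn0 hn hN
          (eq_zero_of_exp_eq_unityRoot hd hnC hP h).2) (by fun_prop)
    have hreg : ∀ P : ℂ, |P.re| ≤ 1 / (2 * d) → DifferentiableAt ℂ
        (fun P => regularRatio d w n P * periodicKernel (unityRoot d k) (n + P)) P := fun P hP =>
      (differentiableAt_regularRatio hd hdvd hn (hP.trans_lt hlt)).mul (hker P hP)
    have hhyp : ∀ P : ℂ, |P.re| ≤ 1 / (2 * d) → DifferentiableAt ℂ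
        (fun P => hypergeometricTerm d w n P * Complex.exp ((n + P) * x)) P := fun P hP =>
      (differentiableAt_hypergeometricTerm hd hdvd hn
        (by linarith [(abs_le.1 hP).1])).mul (by fun_prop)
    have hnhds : {s : ℂ | |s.re| ≤ 1 / (2 * d)} ∈ 𝓝 (0 : ℂ) := by
      have : ContinuousAt (fun s : ℂ => |s.re|) 0 := by fun_prop
      filter_upwards [this.eventually_lt_const (show |(0 : ℂ).re| < 1 / (2 * (d : ℝ)) by
        simpa using hd)] with s hs
      exact hs.le
    have han1 := DifferentiableOn.analyticAt
      (fun P hP => (hreg P hP).differentiableWithinAt) hnhds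
    have han2 := DifferentiableOn.analyticAt
      (fun P hP => (hhyp P hP).differentiableWithinAt) hnhds
    have key := barnesIntegral_sub hd hw hdvd hζ hx hnR (fixedDim w n - 1)
      (h := fun P => (regularRatio d w n P * periodicKernel (unityRoot d k) (n + P)) *
        (hypergeometricTerm d w n P * Complex.exp ((n + P) * x)))
      (fun P hP => ((hreg P hP).mul (hhyp P hP)).differentiableWithinAt) (fun P hP hP0 => ?_)
    · rw [key]
      rcases Nat.eq_zero_or_pos (fixedDim w n - 1) with h1 | h1
      · rw [if_pos h1, h1]; simp
      · rw [if_neg h1.ne', taylorAtZero_mul han1 han2,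
          ← smallIGWTerm_eq_taylorAtZero hd hdvd hn, mul_comm (taylorAtZero _),
          PowerSeries.coeff_mul, Finset.Nat.sum_antidiagonal_eq_sum_range_succ_mk,
          Nat.succ_eq_add_one, Nat.sub_add_cancel h1, Finset.mul_sum]
        refine Finset.sum_congr rfl fun i _ => ?_
        unfold connectionCoeff
        rw [Nat.sub_sub (fixedDim w n) 1 1]
        ring
    · have h1 := gammaRatio_mul_pow hd hdvd hn0 hn (hP.trans_lt hlt) hP0
      obtain ⟨p, hp⟩ : ∃ p, fixedDim w n = p + 1 := ⟨_, (Nat.succ_pred_eq_of_pos hN).symm⟩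
      rw [hp] at h1 ⊢
      have h2 : gammaRatio d w (n + P) * P ^ p =
          regularRatio d w n P * hypergeometricTerm d w n P :=
        mul_left_cancel₀ hP0 (by rw [← h1]; ring)
      rw [Nat.add_sub_cancel, eq_div_iff (pow_ne_zero _ hP0)]
      unfold barnesIntegrand
      push_cast
      linear_combination (periodicKernel (unityRoot d k) (n + P) *
        Complex.exp ((n + P) * x)) * h2

/-! ### The Barnes integral in terms of the Gromov-Witten I-function -/

/-- The connection coefficients depend on the sector only, not on the exponent in it. -/
theorem connectionCoeff_add_natCast {N : ℕ} (d : ℕ) (w : Fin N → ℕ) (k : ℕ) {n : ℚ} (hn : 0 ≤ n)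
    (m i : ℕ) : connectionCoeff d w k (n + m) i = connectionCoeff d w k n i := by
  have hN : fixedDim w (n + m) = fixedDim w n := by
    unfold fixedDim
    simp_rw [fract_mul_add_natCast]
  unfold connectionCoeff
  rw [hN, regularRatio_add_natCast hn]
  congr 4
  funext P
  rw [← periodicKernel_add_natCast (unityRoot d k) (n + P) m]
  push_cast
  ring_nf

/-- The exponents in `[0, 1) ∩ (1 / d) ℤ` with a nonzero fixed locus are those of the sectors. -/
theorem sum_range_div_eq_sum_sectors {N : ℕ} {d : ℕ} {w : Fin N → ℕ} (hd : 0 < d)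
    (hw : ∀ j, 0 < w j) (hdvd : ∀ j, w j ∣ d) (Y : ℚ → ℂ)
    (hY : ∀ n, fixedDim w n = 0 → Y n = 0) :
    ∑ c ∈ range d, Y ((c : ℚ) / d) = ∑ f ∈ sectors w, Y (sectorExponent f 0) := by
  have hd' : (0 : ℚ) < d := by exact_mod_cast hd
  have hinv : ∀ f : ℚ, 0 ≤ f → f < 1 → Int.fract (1 - Int.fract (1 - f)) = f := by
    intro f h0 h1
    rw [show 1 - Int.fract (1 - f) = f + ((⌊1 - f⌋ : ℤ) : ℚ) by rw [Int.fract]; ring,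
      Int.fract_add_intCast, Int.fract_eq_self.2 ⟨h0, h1⟩]
  symm
  refine Finset.sum_bij_ne_zero (fun f _ _ => ⌈sectorExponent f 0 * (d : ℚ)⌉₊) ?_ ?_ ?_ ?_
  · intro f hf _
    obtain ⟨a, ha⟩ := exists_sectorExponent_mul_eq hw hdvd hf 0
    have h1 : sectorExponent f 0 < 1 := by rw [sectorExponent_zero]; exact Int.fract_lt_one _
    rw [ha, Nat.ceil_natCast, mem_range]
    have : (a : ℚ) < d := by rw [← ha]; nlinarith
    exact_mod_cast this
  · intro f hf _ g hg _ h
    obtain ⟨a, ha⟩ := exists_sectorExponent_mul_eq hw hdvd hf 0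
    obtain ⟨b, hb⟩ := exists_sectorExponent_mul_eq hw hdvd hg 0
    rw [ha, hb, Nat.ceil_natCast, Nat.ceil_natCast] at h
    have h1 : sectorExponent f 0 = sectorExponent g 0 := by
      refine mul_right_cancel₀ hd'.ne' ?_
      rw [ha, hb, h]
    rw [sectorExponent_zero, sectorExponent_zero] at h1
    have hf' := ((mem_sectors_iff hw).1 hf).1
    have hg' := ((mem_sectors_iff hw).1 hg).1
    rw [← hinv f hf'.1 hf'.2, ← hinv g hg'.1 hg'.2, h1]
  · intro c hc hne
    have hpos : 0 < fixedDim w ((c : ℚ) / d) := Nat.pos_of_ne_zero fun h => hne (hY _ h)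
    have hc' : (c : ℚ) < d := by exact_mod_cast mem_range.1 hc
    have h0 : 0 ≤ (c : ℚ) / d := by positivity
    have h1 : (c : ℚ) / d < 1 := by rwa [div_lt_one hd']
    have hself : sectorExponent (Int.fract (1 - (c : ℚ) / d)) 0 = (c : ℚ) / d := by
      rw [sectorExponent_zero, hinv _ h0 h1]
    refine ⟨Int.fract (1 - (c : ℚ) / d), ?_, ?_, ?_⟩
    · refine (mem_sectors_iff hw).2 ⟨⟨Int.fract_nonneg _, Int.fract_lt_one _⟩, ?_⟩
      rwa [← fixedDim_sectorExponent w _ 0, hself]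
    · rwa [hself]
    · rw [hself, div_mul_cancel₀ _ hd'.ne', Nat.ceil_natCast]
  · intro f hf _
    obtain ⟨a, ha⟩ := exists_sectorExponent_mul_eq hw hdvd hf 0
    rw [ha, Nat.ceil_natCast, ← ha, mul_div_cancel_right₀ _ hd'.ne']

theorem sum_range_mul_eq (F : ℕ → ℂ) (d M : ℕ) :
    ∑ t ∈ range (d * M), F t = ∑ m ∈ range M, ∑ c ∈ range d, F (d * m + c) := by
  induction M with
  | zero => simp
  | succ M ih => rw [Nat.mul_succ, Finset.sum_range_add, ih, Finset.sum_range_succ]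

theorem sum_ambient_eq {N : ℕ} (w : Fin N → ℕ) (g : ℚ → ℕ → ℂ) :
    ∑ p : (Σ f : sectors w, Fin (fixedDim w (f : ℚ) - 1)), g (p.1 : ℚ) p.2 =
      ∑ f ∈ sectors w, ∑ i ∈ range (fixedDim w f - 1), g f i := by
  rw [Fintype.sum_sigma, ← Finset.sum_coe_sort (sectors w)]
  refine Finset.sum_congr rfl fun f _ => ?_
  rw [Finset.sum_range]

/-- Convergence of the Gromov-Witten I-function. -/
theorem summable_smallIGWTerm {N : ℕ} {d : ℕ} {w : Fin N → ℕ} (hd : 0 < d)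
    (hw : ∀ j, 0 < w j) (hdvd : ∀ j, w j ∣ d) (hr : d < ∑ j, w j) {f : ℚ} (hf : f ∈ sectors w)
    (x : ℂ) (i : ℕ) : Summable fun m : ℕ =>
      PowerSeries.coeff i (smallIGWTerm d w x 1 (sectorExponent f m)) := by
  simp_rw [coeff_smallIGWTerm]
  exact (isRapid_sectorSeries hd hw hdvd hr hf).summable i _ x

/-- Closing the contour of the Barnes integral to the right. -/
theorem barnesIntegral_eq_sum_smallIGW {N : ℕ} {d k : ℕ} {w : Fin N → ℕ} (hd : 0 < d)
    (hw : ∀ j, 0 < w j) (hdvd : ∀ j, w j ∣ d) (hr : d < ∑ j, w j) (hk : k ∈ narrowSet d w) {x : ℂ}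
    (hx : |x.im - sectorCenter d w| ≤ sectorRadius d w) :
    barnesIntegral d w (unityRoot d k) x (-(1 / (2 * d))) =
      -∑ p, connectionCoeff d w k (sectorExponent (p.1 : ℚ) 0) p.2 * smallIGW d w x 1 p := by
  have hd' : (0 : ℝ) < d := by exact_mod_cast hd
  have hdQ : (d : ℚ) ≠ 0 := by exact_mod_cast hd.ne'
  set B := barnesIntegral d w (unityRoot d k) x with hB
  -- The residue at `n`; it is zero unless `n` is the exponent of a sector.
  set X : ℚ → ℂ := fun n => ∑ i ∈ range (fixedDim w n - 1),
    connectionCoeff d w k n i * PowerSeries.coeff i (smallIGWTerm d w x 1 n) with hX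
  have hcross : ∀ t : ℕ, B (((t + 1 : ℕ) : ℝ) / d - 1 / (2 * d)) - B ((t : ℝ) / d - 1 / (2 * d)) =
      X ((t : ℚ) / d) := by
    intro t
    have h := barnesIntegral_sub_of_sector hd hw hdvd hk hx (n := (t : ℚ) / d) (a := t)
      (by positivity) (div_mul_cancel₀ _ hdQ)
    refine Eq.trans ?_ h
    congr 2
    · push_cast; field_simp; ring
    · push_cast; ring
  have htel : ∀ M : ℕ, B (M - 1 / (2 * d)) - B (-(1 / (2 * d))) =
      ∑ m ∈ range M, ∑ f ∈ sectors w, X (sectorExponent f m) := by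
    intro M
    have h1 := Finset.sum_range_sub (fun t : ℕ => B ((t : ℝ) / d - 1 / (2 * d))) (d * M)
    rw [Finset.sum_congr rfl fun t _ => hcross t, sum_range_mul_eq] at h1
    have e1 : ((d * M : ℕ) : ℝ) / d - 1 / (2 * d) = M - 1 / (2 * d) := by
      push_cast; field_simp
    have e2 : ((0 : ℕ) : ℝ) / d - 1 / (2 * d) = -(1 / (2 * d)) := by simp
    rw [e1, e2] at h1
    rw [← h1]
    refine Finset.sum_congr rfl fun m _ => ?_
    have h2 := sum_range_div_eq_sum_sectors hd hw hdvd (fun n => X (n + m)) (fun n hn => by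
      have : fixedDim w (n + m) = 0 := by
        rw [← hn]; unfold fixedDim; simp_rw [fract_mul_add_natCast]
      simp only [hX, this]
      simp)
    simp_rw [sectorExponent_eq_add _ m]
    rw [← h2]
    refine Finset.sum_congr rfl fun c _ => ?_
    congr 1
    push_cast; field_simp; ring
  have hlim := (tendsto_barnesIntegral_atTop hd hw hdvd hr (unityRoot_pow hd k) hx).sub_const
    (B (-(1 / (2 * d))))
  have hsum : HasSum (fun m : ℕ => ∑ f ∈ sectors w, X (sectorExponent f m))
      (∑ p, connectionCoeff d w k (sectorExponent (p.1 : ℚ) 0) p.2 * smallIGW d w x 1 p) := by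
    have h1 : ∀ m : ℕ, ∑ f ∈ sectors w, X (sectorExponent f m) =
        ∑ p : (Σ f : sectors w, Fin (fixedDim w (f : ℚ) - 1)),
          connectionCoeff d w k (sectorExponent (p.1 : ℚ) 0) p.2 *
          PowerSeries.coeff (p.2 : ℕ) (smallIGWTerm d w x 1 (sectorExponent (p.1 : ℚ) m)) := by
      intro m
      rw [sum_ambient_eq w fun f i => connectionCoeff d w k (sectorExponent f 0) i *
        PowerSeries.coeff i (smallIGWTerm d w x 1 (sectorExponent f m))]
      refine Finset.sum_congr rfl fun f _ => ?_
      simp only [hX, fixedDim_sectorExponent]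
      refine Finset.sum_congr rfl fun i _ => ?_
      rw [sectorExponent_eq_add f m, connectionCoeff_add_natCast _ _ _ (sectorExponent_nonneg f 0)]
    simp_rw [h1]
    exact hasSum_sum fun p _ =>
      ((summable_smallIGWTerm hd hw hdvd hr p.1.2 x p.2).hasSum).mul_left _
  have h2 := tendsto_nhds_unique (hlim.congr htel) hsum.tendsto_sum_nat
  rw [← h2]
  ring

/-! ### The Barnes integral in terms of the FJRW I-function -/

/-- Closing the contour of the Barnes integral to the left. -/
theorem barnesIntegral_eq_sum_add {N : ℕ} {d k : ℕ} {w : Fin N → ℕ} (hd : 0 < d)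
    (hw : ∀ j, 0 < w j) (hdvd : ∀ j, w j ∣ d) (hk : k < d) {x : ℂ}
    (hx : |x.im - sectorCenter d w| ≤ sectorRadius d w) (M : ℕ) :
    barnesIntegral d w (unityRoot d k) x (-(1 / (2 * d))) =
      ∑ n ∈ range M, (if n % d = k then (Complex.I * unityRoot d k)⁻¹ *
        (gammaRatio d w (-((n + 1) / d)) * Complex.exp (-((n + 1) / d) * x)) else 0) +
      barnesIntegral d w (unityRoot d k) x (-(M / d) - 1 / (2 * d)) := by
  have hd' : (0 : ℝ) < d := by exact_mod_cast hd
  induction M with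
  | zero => simp
  | succ M ih =>
    rw [ih, Finset.sum_range_succ, add_assoc]
    congr 1
    have h := barnesIntegral_sub_of_narrow hd hw hdvd k hx (s₀ := -((M + 1) / d)) (a := -(M + 1))
      (by push_cast; field_simp) (fun j m h => by
        have h1 : (0 : ℝ) < w j := by exact_mod_cast hw j
        have h2 : (0 : ℝ) ≤ m := m.cast_nonneg
        have h3 : (w j : ℝ) * -((M + 1) / d) < 0 :=
          mul_neg_of_pos_of_neg h1 (neg_neg_of_pos (by positivity))
        linarith)
    have e1 : -(((M : ℝ) + 1) / d) + 1 / (2 * d) = -(M / d) - 1 / (2 * d) := by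
      field_simp; ring
    rw [e1, sub_eq_iff_eq_add] at h
    rw [h]
    have hiff : (d : ℤ) ∣ -((M : ℤ) + 1) + k + 1 ↔ M % d = k := by
      rw [show -((M : ℤ) + 1) + k + 1 = k - M by ring, ← Nat.modEq_iff_dvd]
      unfold Nat.ModEq
      rw [Nat.mod_eq_of_lt hk]
    simp only [hiff]
    congr 1
    · split_ifs
      · push_cast; rfl
      · rfl
    · push_cast; rfl

/-- The `l`-independent factor relating the coefficients of the FJRW I-function to the residues of
the Barnes integrand. -/
def fjrwNormalization {N : ℕ} (d : ℕ) (w : Fin N → ℕ) (k : ℕ) : ℂ :=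
  Complex.exp (Real.pi * Complex.I * fanoIndex d w * ((k + 1) / d)) * -(-1) ^ k *
    ∏ j, ((-1) ^ ⌊charge d w j * (k : ℚ)⌋₊ *
      (Complex.Gamma ((charge d w j + Int.fract (charge d w j * (k : ℚ)) : ℚ) : ℂ))⁻¹)

theorem fjrwNormalization_ne_zero {N : ℕ} {d : ℕ} {w : Fin N → ℕ} (hd : 0 < d)
    (hw : ∀ j, 0 < w j) (k : ℕ) : fjrwNormalization d w k ≠ 0 := by
  refine mul_ne_zero (mul_ne_zero (Complex.exp_ne_zero _)
    (neg_ne_zero.2 (pow_ne_zero _ (by norm_num)))) (Finset.prod_ne_zero_iff.2 fun j _ =>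
      mul_ne_zero (pow_ne_zero _ (by norm_num)) (inv_ne_zero
        (Complex.Gamma_ne_zero_of_re_pos ?_)))
  rw [Complex.ratCast_re]
  have h1 : 0 < charge d w j := by
    have := hw j
    unfold charge
    positivity
  have h2 := Int.fract_nonneg (charge d w j * (k : ℚ))
  exact_mod_cast add_pos_of_pos_of_nonneg h1 h2

/-- The coefficients of the FJRW I-function are the values of `gammaRatio` at `-(dl + k + 1) / d`,
up to a factor independent of `l`. -/
theorem smallIFJRWCoeff_eq {N : ℕ} {d : ℕ} {w : Fin N → ℕ} (hd : 0 < d) (k l : ℕ) :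
    smallIFJRWCoeff d w (-1) k l =
      fjrwNormalization d w k * gammaRatio d w (-(((d * l + k : ℕ) + 1) / d)) := by
  have hdC : (d : ℂ) ≠ 0 := by exact_mod_cast hd.ne'
  have hdQ : (d : ℚ) ≠ 0 := by exact_mod_cast hd.ne'
  set m : ℕ := d * l + k with hm
  have hfloor : ∀ j, ⌊charge d w j * (m : ℚ)⌋₊ = w j * l + ⌊charge d w j * (k : ℚ)⌋₊ := by
    intro j
    have : charge d w j * (m : ℚ) = charge d w j * (k : ℚ) + ((w j * l : ℕ) : ℚ) := by
      rw [hm]; unfold charge; push_cast; field_simp; ring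
    rw [this, Nat.floor_add_natCast (by unfold charge; positivity), add_comm]
  have hGamma : ∀ j, Complex.Gamma (-((w j : ℂ) * -(((m : ℕ) + 1) / d))) =
      Complex.Gamma ((charge d w j * ((m + 1 : ℕ) : ℚ) : ℚ) : ℂ) := fun j => by
    congr 1
    unfold charge
    push_cast
    field_simp
  have hfact : Complex.Gamma (-((d : ℂ) * -(((m : ℕ) + 1) / d))) = (m.factorial : ℂ) := by
    rw [← Complex.Gamma_nat_eq_factorial]
    congr 1
    field_simp
  have hexp : Complex.exp (Real.pi * Complex.I * fanoIndex d w * ((k + 1) / d)) *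
      Complex.exp (Real.pi * Complex.I * fanoIndex d w * (-(((m : ℕ) + 1) / d))) =
      ((∏ j, (-1 : ℂ) ^ (w j * l)) * (-1) ^ (d * l)) := by
    have h1 : ((∏ j, (-1 : ℂ) ^ (w j * l)) * (-1) ^ (d * l)) =
        Complex.exp (-(l * (Real.pi * Complex.I * fanoIndex d w))) := by
      have h2 : (-(l * (Real.pi * Complex.I * fanoIndex d w)) : ℂ) =
          l * (-(Real.pi * Complex.I * fanoIndex d w)) := by ring
      rw [h2, Complex.exp_nat_mul, Complex.exp_neg, exp_pi_I_mul_fanoIndex, mul_inv,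
        ← Finset.prod_inv_distrib, mul_pow, ← Finset.prod_pow]
      simp_rw [← inv_pow, ← pow_mul]
      norm_num
    rw [h1, ← Complex.exp_add]
    congr 1
    rw [hm]
    push_cast
    field_simp
    ring
  have hneg : ∀ n : ℕ, ((-1 : ℂ) ^ n)⁻¹ = (-1) ^ n := fun n => by rw [← inv_pow]; norm_num
  unfold smallIFJRWCoeff fjrwNormalization gammaRatio
  simp_rw [hGamma]
  rw [hfact, ← hm]
  simp_rw [hfloor, pow_add, div_eq_mul_inv (_ * Complex.Gamma _)]
  rw [Finset.prod_mul_distrib, Finset.prod_mul_distrib, Finset.prod_mul_distrib,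
    Finset.prod_mul_distrib, div_eq_mul_inv, mul_inv, hneg, hm, pow_add]
  rw [← hm]
  linear_combination (-(-1 : ℂ) ^ k * (m.factorial : ℂ)⁻¹ *
    (∏ j, (-1 : ℂ) ^ ⌊charge d w j * (k : ℚ)⌋₊) *
    (∏ j, Complex.Gamma ((charge d w j * ((m + 1 : ℕ) : ℚ) : ℚ) : ℂ)) *
    ∏ j, (Complex.Gamma ((charge d w j + Int.fract (charge d w j * (k : ℚ)) : ℚ) : ℂ))⁻¹) * -hexp

theorem smallIFJRWCoeff_ne_zero {N : ℕ} {d : ℕ} {w : Fin N → ℕ} (hd : 0 < d)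
    (hw : ∀ j, 0 < w j) (k l : ℕ) : smallIFJRWCoeff d w (-1) k l ≠ 0 := by
  rw [smallIFJRWCoeff_eq hd]
  refine mul_ne_zero (fjrwNormalization_ne_zero hd hw k) (gammaRatio_ne_zero hd hw ?_)
  have h : (-((((d * l + k : ℕ) : ℂ) + 1) / d)) =
      ((-((((d * l + k : ℕ) : ℝ) + 1) / d) : ℝ) : ℂ) := by push_cast; rfl
  have hd' : (0 : ℝ) < d := by exact_mod_cast hd
  rw [h, Complex.ofReal_re]
  exact neg_neg_of_pos (by positivity)

/-! ### Asymptotic expansions in a sector -/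

theorem tendsto_re_atInftyInSector (a b : ℝ) :
    Tendsto Complex.re (atInftyInSector a b) atTop :=
  tendsto_comap.mono_left inf_le_left

theorem eventually_mem_atInftyInSector (a b : ℝ) :
    ∀ᶠ x in atInftyInSector a b, a < x.im ∧ x.im < b :=
  mem_inf_of_right (mem_principal_self _)

theorem atInftyInSector_neBot {a b : ℝ} (h : a < b) : (atInftyInSector a b).NeBot := by
  have ht : Tendsto (fun t : ℝ => (t : ℂ) + ((a + b) / 2 : ℝ) * Complex.I) atTop
      (atInftyInSector a b) := by
    refine tendsto_inf.2 ⟨tendsto_comap_iff.2 ?_, tendsto_principal.2 (Eventually.of_forall ?_)⟩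
    · refine tendsto_id.congr fun t => ?_
      simp
    · intro t
      simp only [Set.mem_ofPred_eq, Complex.add_im, Complex.ofReal_im, Complex.mul_im,
        Complex.ofReal_re, Complex.I_im, mul_one, Complex.I_re, mul_zero, add_zero, zero_add]
      constructor <;> linarith
  exact ht.neBot

theorem isLittleO_of_norm_le_exp {E : Type*} [NormedAddCommGroup E] {F : Filter ℂ}
    (hF : Tendsto Complex.re F atTop) {g : ℂ → E} {ψ : ℂ → ℂ} {C s t : ℝ} (hst : s < t)
    (hg : ∀ᶠ x in F, ‖g x‖ ≤ C * Real.exp (-t * x.re))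
    (hψ : ∀ x, ‖ψ x‖ = Real.exp (-s * x.re)) : g =o[F] ψ := by
  have h1 : g =O[F] fun x => Real.exp (-t * x.re) :=
    IsBigO.of_bound C (hg.mono fun x hx => by rwa [Real.norm_eq_abs, Real.abs_exp])
  have h2 : (fun x : ℂ => Real.exp (-t * x.re)) =o[F] fun x => Real.exp (-s * x.re) := by
    rw [Real.isLittleO_exp_comp_exp_comp]
    have := hF.const_mul_atTop (sub_pos.2 hst)
    refine this.congr fun x => ?_
    ring
  refine (h1.trans_isLittleO h2).trans_isBigO (IsBigO.of_bound 1 (Eventually.of_forall fun x => ?_))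
  rw [hψ, Real.norm_eq_abs, Real.abs_exp, one_mul]

theorem exp_pow_eq (d n : ℕ) (x : ℂ) :
    Complex.exp (-(x / d)) ^ (n + 1) = Complex.exp (-((n + 1) / d) * x) := by
  rw [← Complex.exp_nat_mul]
  congr 1
  push_cast
  ring

theorem norm_exp_pow (d n : ℕ) (x : ℂ) :
    ‖Complex.exp (-(x / d)) ^ (n + 1)‖ = Real.exp (-((n + 1) / d) * x.re) := by
  rw [exp_pow_eq, Complex.norm_exp]
  congr 1
  have : (-(((n : ℂ) + 1) / d)) = ((-(((n : ℝ) + 1) / d) : ℝ) : ℂ) := by push_cast; rfl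
  rw [this, Complex.re_ofReal_mul]

/-- An asymptotic expansion of zero is zero. -/
theorem IsAsymptoticExpansion.eq_zero {α E : Type*} [NormedAddCommGroup E] [NormedSpace ℂ E]
    {F : Filter α} [F.NeBot] {ψ : ℕ → α → ℂ} {a : ℕ → E} (hψ : ∀ n x, ψ n x ≠ 0)
    (h : IsAsymptoticExpansion F ψ a fun _ => 0) (n : ℕ) : a n = 0 := by
  induction n using Nat.strong_induction_on with
  | _ n ih =>
    have h1 := h.2 n
    have h2 : (fun x => (0 : E) - ∑ i ∈ range (n + 1), ψ i x • a i) = fun x => -(ψ n x • a n) := by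
      funext x
      rw [Finset.sum_range_succ, Finset.sum_eq_zero, zero_add, zero_sub]
      intro i hi
      rw [ih i (mem_range.1 hi), smul_zero]
    rw [h2, isLittleO_neg_left] at h1
    by_contra hne
    have hpos := norm_pos_iff.2 hne
    obtain ⟨x, hx⟩ := (h1.bound (half_pos hpos)).exists
    rw [norm_smul] at hx
    have := norm_pos_iff.2 (hψ n x)
    nlinarith

theorem IsAsymptoticExpansion.map {α E G : Type*} [NormedAddCommGroup E] [NormedSpace ℂ E]
    [NormedAddCommGroup G] [NormedSpace ℂ G]
    {F : Filter α} {ψ : ℕ → α → ℂ} {a : ℕ → E} {g : α → E} (h : IsAsymptoticExpansion F ψ a g)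
    (μ : E →L[ℂ] G) : IsAsymptoticExpansion F ψ (fun n => μ (a n)) fun x => μ (g x) := by
  refine ⟨h.1, fun m => ?_⟩
  refine ((μ.isBigO_comp _ F).trans_isLittleO (h.2 m)).congr_left fun x => ?_
  simp

/-! ### The linear map -/

/-- The linear map `L_GW`: the matrix of Laurent coefficients which expresses the Barnes integrals
through the components of the Gromov-Witten I-function, normalized to match the FJRW I-function. -/
def connectionMap {N : ℕ} (d : ℕ) (w : Fin N → ℕ) : AmbientSpace w →ₗ[ℂ] NarrowSpace d w :=
  LinearMap.pi fun k => ∑ p : (Σ f : sectors w, Fin (fixedDim w (f : ℚ) - 1)),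
    (-(fjrwNormalization d w k * (Complex.I * unityRoot d k)) *
      connectionCoeff d w k (sectorExponent (p.1 : ℚ) 0) p.2) • LinearMap.proj p

theorem smallIFJRW_apply {N : ℕ} {d : ℕ} {w : Fin N → ℕ} (hd : 0 < d) (n : ℕ)
    (k : narrowSet d w) : smallIFJRW d w (-1) n k =
      if n % d = (k : ℕ) then
        fjrwNormalization d w k * gammaRatio d w (-((n + 1) / d)) else 0 := by
  unfold smallIFJRW
  split_ifs with h
  · rw [smallIFJRWCoeff_eq hd, ← h, Nat.div_add_mod]
  · rfl

/-- The remainder of the asymptotic expansion is a Barnes integral over a line further to the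
left. -/
theorem connectionMap_smallIGW_sub {N : ℕ} {d : ℕ} {w : Fin N → ℕ} (hd : 0 < d)
    (hw : ∀ j, 0 < w j) (hdvd : ∀ j, w j ∣ d) (hr : d < ∑ j, w j) (k : narrowSet d w) {x : ℂ}
    (hx : |x.im - sectorCenter d w| ≤ sectorRadius d w) (M : ℕ) :
    (connectionMap d w (smallIGW d w x 1) -
      ∑ n ∈ range M, Complex.exp (-(x / d)) ^ (n + 1) • smallIFJRW d w (-1) n) k =
      fjrwNormalization d w k * (Complex.I * unityRoot d k) *
        barnesIntegral d w (unityRoot d k) x (-(M / d) - 1 / (2 * d)) := by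
  have hk := k.2
  have h1 := barnesIntegral_eq_sum_smallIGW hd hw hdvd hr hk hx
  rw [barnesIntegral_eq_sum_add hd hw hdvd (mem_range.1 (mem_filter.1 hk).1) hx M] at h1
  have hI : Complex.I * unityRoot d k ≠ 0 := mul_ne_zero Complex.I_ne_zero (Complex.exp_ne_zero _)
  have h2 : connectionMap d w (smallIGW d w x 1) k =
      fjrwNormalization d w k * (Complex.I * unityRoot d k) *
        -∑ p, connectionCoeff d w k (sectorExponent (p.1 : ℚ) 0) p.2 * smallIGW d w x 1 p := by
    unfold connectionMap
    rw [LinearMap.pi_apply, LinearMap.sum_apply, ← Finset.sum_neg_distrib, Finset.mul_sum]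
    refine Finset.sum_congr rfl fun p _ => ?_
    rw [LinearMap.smul_apply, LinearMap.proj_apply, smul_eq_mul]
    ring
  have h3 : (∑ n ∈ range M, Complex.exp (-(x / d)) ^ (n + 1) • smallIFJRW d w (-1) n) k =
      fjrwNormalization d w k * (Complex.I * unityRoot d k) *
      ∑ n ∈ range M, (if n % d = (k : ℕ) then (Complex.I * unityRoot d k)⁻¹ *
        (gammaRatio d w (-((n + 1) / d)) * Complex.exp (-((n + 1) / d) * x)) else 0) := by
    rw [Finset.sum_apply, Finset.mul_sum]
    refine Finset.sum_congr rfl fun n _ => ?_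
    rw [Pi.smul_apply, smallIFJRW_apply hd, smul_eq_mul, exp_pow_eq]
    split_ifs
    · generalize Complex.I * unityRoot d k = Z at hI ⊢
      field_simp
    · simp
  rw [Pi.sub_apply, h2, h3, ← h1]
  ring

/-- The remainder after the term of order `(m + 1) / d` is a Barnes integral half a step
`1 / (2d)` further to the left. -/
theorem isAsymptoticExpansion_connectionMap {N : ℕ} {d : ℕ} {w : Fin N → ℕ} (hd : 0 < d)
    (hw : ∀ j, 0 < w j) (hdvd : ∀ j, w j ∣ d) (hr : d < ∑ j, w j) :
    IsAsymptoticExpansion (atInftyInSector (sectorCenter d w - sectorRadius d w)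
        (sectorCenter d w + sectorRadius d w))
      (fun n x => Complex.exp (-(x / (d : ℂ))) ^ (n + 1)) (smallIFJRW d w (-1))
      fun x => connectionMap d w (smallIGW d w x 1) := by
  have hd' : (0 : ℝ) < d := by exact_mod_cast hd
  refine ⟨fun n => ?_, fun m => isLittleO_pi.2 fun k => ?_⟩
  · refine isLittleO_of_norm_le_exp (C := 1) (tendsto_re_atInftyInSector _ _)
      (s := (n + 1) / d) (t := ((n + 1 : ℕ) + 1) / d) ?_ (Eventually.of_forall fun x => ?_)
      fun x => norm_exp_pow d n x
    · push_cast
      gcongr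
      linarith
    · rw [norm_exp_pow, one_mul]
  · have hσ : ∀ z : ℤ, (d : ℝ) * (-((m + 1 : ℕ) / d) - 1 / (2 * d)) ≠ z := fun z hz => by
      field_simp at hz
      have : -(2 * ((m + 1 : ℕ) : ℤ) + 1) = 2 * z := by
        have h : (-(2 * ((m + 1 : ℕ) : ℝ) + 1)) = 2 * z := by rw [← hz]; push_cast; ring
        exact_mod_cast h
      omega
    obtain ⟨C, hC⟩ := exists_norm_barnesIntegral_le hd hw hdvd (unityRoot_pow hd k) hσ
    refine isLittleO_of_norm_le_exp
      (C := ‖fjrwNormalization d w k * (Complex.I * unityRoot d k)‖ * C)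
      (tendsto_re_atInftyInSector _ _) (s := (m + 1) / d) (t := (m + 1 : ℕ) / d + 1 / (2 * d))
      ?_ ?_ fun x => norm_exp_pow d m x
    · push_cast
      have : 0 < 1 / (2 * (d : ℝ)) := by positivity
      linarith
    · filter_upwards [eventually_mem_atInftyInSector _ _] with x hx
      have hx' : |x.im - sectorCenter d w| ≤ sectorRadius d w :=
        abs_le.2 ⟨by linarith, by linarith⟩
      rw [connectionMap_smallIGW_sub hd hw hdvd hr k hx', norm_mul, mul_assoc]
      refine mul_le_mul_of_nonneg_left ((hC x hx').trans (le_of_eq ?_)) (norm_nonneg _)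
      congr 2
      ring

/-- Every linear map as in the theorem is surjective, since the coefficients of the FJRW I-function
span the narrow state space. -/
theorem range_eq_top_of_isAsymptoticExpansion {N : ℕ} {d : ℕ} {w : Fin N → ℕ} (hd : 0 < d)
    (hw : ∀ j, 0 < w j) {a b : ℝ} (hab : a < b) {L : AmbientSpace w →ₗ[ℂ] NarrowSpace d w}
    (hL : IsAsymptoticExpansion (atInftyInSector a b)
      (fun n x => Complex.exp (-(x / (d : ℂ))) ^ (n + 1)) (smallIFJRW d w (-1))
      fun x => L (smallIGW d w x 1)) : LinearMap.range L = ⊤ := by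
  have := atInftyInSector_neBot hab
  by_contra hne
  obtain ⟨μ, hμ0, hμ⟩ := Submodule.exists_le_ker_of_lt_top _ (lt_top_iff_ne_top.2 hne)
  refine hμ0 ?_
  have h1 : ∀ n, μ (smallIFJRW d w (-1) n) = 0 := fun n => by
    have h2 := hL.map (LinearMap.toContinuousLinearMap μ)
    have h3 : (fun x => LinearMap.toContinuousLinearMap μ (L (smallIGW d w x 1))) =
        fun _ => 0 := funext fun x => hμ (LinearMap.mem_range_self L _)
    rw [h3] at h2
    exact h2.eq_zero (fun n x => pow_ne_zero _ (Complex.exp_ne_zero _)) n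
  refine LinearMap.pi_ext' fun k => LinearMap.ext_ring ?_
  have h2 : smallIFJRW d w (-1) k = smallIFJRWCoeff d w (-1) k 0 • Pi.single k (1 : ℂ) := by
    funext k'
    have hk := mem_range.1 (mem_filter.1 k.2).1
    unfold smallIFJRW
    rw [Nat.mod_eq_of_lt hk, Nat.div_eq_of_lt hk, Pi.smul_apply, smul_eq_mul]
    by_cases h : k' = k
    · subst h; simp
    · rw [if_neg (fun h' => h (Subtype.ext h'.symm)), Pi.single_eq_of_ne h, mul_zero]
  have h3 := h1 k
  rw [h2, map_smul, smul_eq_zero] at h3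
  simpa using h3.resolve_left (smallIFJRWCoeff_ne_zero hd hw k 0)

/-! ### Flat functions on a strip and their Laplace transforms -/

/-- The entire function `y` decays faster than `e^{σ Re x}` for every `σ < 0`, uniformly in closed
substrips of `a < Im x < b`; at `Re x → -∞` this allows every growth rate. -/
def IsFlat (a b : ℝ) (y : ℂ → ℂ) : Prop :=
  Differentiable ℂ y ∧ ∀ σ < 0, ∀ a' b', a < a' → b' < b →
    ∃ C : ℝ, ∀ x : ℂ, a' ≤ x.im → x.im ≤ b' → ‖y x‖ ≤ C * Real.exp (σ * x.re)

theorem IsFlat.add {a b : ℝ} {y u : ℂ → ℂ} (hy : IsFlat a b y) (hu : IsFlat a b u) :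
    IsFlat a b (y + u) := by
  refine ⟨hy.1.add hu.1, fun σ hσ a' b' ha hb => ?_⟩
  obtain ⟨C, hC⟩ := hy.2 σ hσ a' b' ha hb
  obtain ⟨D, hD⟩ := hu.2 σ hσ a' b' ha hb
  refine ⟨C + D, fun x h1 h2 => (norm_add_le _ _).trans ?_⟩
  rw [add_mul]
  exact add_le_add (hC x h1 h2) (hD x h1 h2)

theorem IsFlat.const_mul {a b : ℝ} {y : ℂ → ℂ} (hy : IsFlat a b y) (c : ℂ) :
    IsFlat a b (fun x => c * y x) := by
  refine ⟨hy.1.const_mul c, fun σ hσ a' b' ha hb => ?_⟩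
  obtain ⟨C, hC⟩ := hy.2 σ hσ a' b' ha hb
  refine ⟨‖c‖ * C, fun x h1 h2 => ?_⟩
  rw [norm_mul, mul_assoc]
  exact mul_le_mul_of_nonneg_left (hC x h1 h2) (norm_nonneg c)

theorem IsFlat.deriv {a b : ℝ} {y y' : ℂ → ℂ} (hy : IsFlat a b y) (hy' : Differentiable ℂ y')
    (h : ∀ x, HasDerivAt y (y' x) x) : IsFlat a b y' := by
  refine ⟨hy', fun σ hσ a' b' ha hb => ?_⟩
  obtain ⟨δ, hδ, h1, h2⟩ : ∃ δ : ℝ, 0 < δ ∧ a < a' - δ ∧ b' + δ < b := by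
    refine ⟨min ((a' - a) / 2) ((b - b') / 2), lt_min (by linarith) (by linarith), ?_, ?_⟩
    · linarith [min_le_left ((a' - a) / 2) ((b - b') / 2)]
    · linarith [min_le_right ((a' - a) / 2) ((b - b') / 2)]
  obtain ⟨C, hC⟩ := hy.2 σ hσ _ _ h1 h2
  refine ⟨|C| * Real.exp (-σ * δ) / δ, fun x h3 h4 => ?_⟩
  rw [← (h x).deriv]
  refine (Complex.norm_deriv_le_of_forall_mem_sphere_norm_le hδ hy.1.diffContOnCl
    (C := |C| * Real.exp (-σ * δ) * Real.exp (σ * x.re)) fun z hz => ?_).trans (le_of_eq (by ring))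
  have hz' : ‖z - x‖ = δ := by simpa [dist_eq_norm] using hz
  have hre := abs_le.1 ((Complex.abs_re_le_norm (z - x)).trans hz'.le)
  have him := abs_le.1 ((Complex.abs_im_le_norm (z - x)).trans hz'.le)
  rw [Complex.sub_re] at hre
  rw [Complex.sub_im] at him
  refine (hC z (by linarith) (by linarith)).trans ?_
  rw [mul_assoc, ← Real.exp_add]
  refine mul_le_mul (le_abs_self C) (Real.exp_le_exp.2 ?_) (Real.exp_pos _).le (abs_nonneg C)
  nlinarith

theorem IsFlat.id_mul {a b : ℝ} {y : ℂ → ℂ} (hy : IsFlat a b y) :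
    IsFlat a b (fun x => x * y x) := by
  refine ⟨differentiable_id.mul hy.1, fun σ hσ a' b' ha hb => ?_⟩
  obtain ⟨C, hC⟩ := hy.2 (σ - 1) (by linarith) a' b' ha hb
  obtain ⟨D, hD⟩ := hy.2 (σ / 2) (by linarith) a' b' ha hb
  set K := |a'| + |b'| with hK
  have hκ : 0 < -σ / 2 := by linarith
  refine ⟨(1 + K) * |C| + (1 / (-σ / 2) + K) * |D|, fun x h1 h2 => ?_⟩
  have him : |x.im| ≤ K := abs_le.2
    ⟨by linarith [neg_abs_le a', abs_nonneg b'], by linarith [le_abs_self b', abs_nonneg a']⟩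
  have hx := (Complex.norm_le_abs_re_add_abs_im x).trans (add_le_add_right him _)
  have hK0 : 0 ≤ K := by positivity
  rw [norm_mul]
  rcases le_total 0 x.re with h | h
  · have hx1 : ‖x‖ ≤ (1 + K) * Real.exp x.re := by
      rw [abs_of_nonneg h] at hx
      have := Real.add_one_le_exp x.re
      nlinarith [Real.one_le_exp h]
    calc _ ≤ (1 + K) * Real.exp x.re * (|C| * Real.exp ((σ - 1) * x.re)) := by
          gcongr
          exact (hC x h1 h2).trans (mul_le_mul_of_nonneg_right (le_abs_self C) (Real.exp_pos _).le)
      _ = (1 + K) * |C| * Real.exp (σ * x.re) := by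
          rw [show σ * x.re = x.re + (σ - 1) * x.re by ring, Real.exp_add]; ring
      _ ≤ _ := by
          gcongr
          have : 0 ≤ (1 / (-σ / 2) + K) * |D| := by positivity
          linarith
  · have hx1 : ‖x‖ ≤ (1 / (-σ / 2) + K) * Real.exp (σ / 2 * x.re) := by
      rw [abs_of_nonpos h] at hx
      have e : σ / 2 * x.re = (-σ / 2) * (-x.re) := by ring
      have h3 := Real.add_one_le_exp (σ / 2 * x.re)
      have h4 : 1 ≤ Real.exp (σ / 2 * x.re) := Real.one_le_exp (by nlinarith)
      have h5 : -x.re ≤ 1 / (-σ / 2) * Real.exp (σ / 2 * x.re) := by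
        rw [one_div, le_inv_mul_iff₀ hκ]
        linarith
      nlinarith
    calc _ ≤ (1 / (-σ / 2) + K) * Real.exp (σ / 2 * x.re) * (|D| * Real.exp (σ / 2 * x.re)) := by
          gcongr
          exact (hD x h1 h2).trans (mul_le_mul_of_nonneg_right (le_abs_self D) (Real.exp_pos _).le)
      _ = (1 / (-σ / 2) + K) * |D| * Real.exp (σ * x.re) := by
          rw [show σ * x.re = σ / 2 * x.re + σ / 2 * x.re by ring, Real.exp_add]; ring
      _ ≤ _ := by
          gcongr
          have : 0 ≤ (1 + K) * |C| := by positivity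
          linarith

/-- The bounds with exponents just below `A` and just above `B` make the Laplace integrals converge
uniformly for `A ≤ Re s ≤ B`. -/
theorem IsFlat.exists_norm_mul_exp_le {a b : ℝ} {y : ℂ → ℂ} (hy : IsFlat a b y) (A : ℝ) {B : ℝ}
    (hB : B < 0) {a' b' : ℝ} (ha : a < a') (hb : b' < b) :
    ∃ C κ : ℝ, 0 ≤ C ∧ 0 < κ ∧ ∀ s x : ℂ, A ≤ s.re → s.re ≤ B → a' ≤ x.im → x.im ≤ b' →
      ‖y x * Complex.exp (-(s * x))‖ ≤ C * Real.exp (x.im * s.im) * Real.exp (-(κ * |x.re|)) := by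
  -- The margin keeps `B + κ` negative.
  set κ := -B / 2 with hκ
  have hκ0 : 0 < κ := by linarith
  by_cases hAB : A ≤ B
  swap
  · exact ⟨0, κ, le_rfl, hκ0, fun s x h1 h2 => absurd (h1.trans h2) hAB⟩
  obtain ⟨C, hC⟩ := hy.2 (A - κ) (by linarith) a' b' ha hb
  obtain ⟨D, hD⟩ := hy.2 (B + κ) (by linarith) a' b' ha hb
  refine ⟨|C| + |D|, κ, by positivity, hκ0, fun s x h1 h2 h3 h4 => ?_⟩
  have e : ‖Complex.exp (-(s * x))‖ = Real.exp (x.im * s.im) * Real.exp (-(s.re * x.re)) := by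
    rw [Complex.norm_exp, ← Real.exp_add]
    congr 1
    simp
    ring
  rw [norm_mul, e]
  rcases le_total 0 x.re with h | h
  · rw [abs_of_nonneg h]
    calc _ ≤ |C| * Real.exp ((A - κ) * x.re) *
          (Real.exp (x.im * s.im) * Real.exp (-(s.re * x.re))) := by
          gcongr
          exact (hC x h3 h4).trans (mul_le_mul_of_nonneg_right (le_abs_self C) (Real.exp_pos _).le)
      _ = |C| * Real.exp (x.im * s.im) * Real.exp ((A - κ) * x.re + -(s.re * x.re)) := by
          rw [Real.exp_add]; ring
      _ ≤ _ := by
          gcongr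
          · linarith [abs_nonneg D]
          · nlinarith
  · rw [abs_of_nonpos h]
    calc _ ≤ |D| * Real.exp ((B + κ) * x.re) *
          (Real.exp (x.im * s.im) * Real.exp (-(s.re * x.re))) := by
          gcongr
          exact (hD x h3 h4).trans (mul_le_mul_of_nonneg_right (le_abs_self D) (Real.exp_pos _).le)
      _ = |D| * Real.exp (x.im * s.im) * Real.exp ((B + κ) * x.re + -(s.re * x.re)) := by
          rw [Real.exp_add]; ring
      _ ≤ _ := by
          gcongr
          · linarith [abs_nonneg C]
          · nlinarith

/-- The bilateral Laplace transform of `y` along the horizontal line `Im x = θ`. -/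
def laplace (y : ℂ → ℂ) (θ : ℝ) (s : ℂ) : ℂ :=
  ∫ t : ℝ, y (t + θ * Complex.I) * Complex.exp (-(s * (t + θ * Complex.I)))

theorem line_re (θ t : ℝ) : ((t : ℂ) + θ * Complex.I).re = t := by simp

theorem line_im (θ t : ℝ) : ((t : ℂ) + θ * Complex.I).im = θ := by simp

theorem IsFlat.continuous_line {a b : ℝ} {y : ℂ → ℂ} (hy : IsFlat a b y) (θ : ℝ) (s : ℂ) :
    Continuous fun t : ℝ => y (t + θ * Complex.I) * Complex.exp (-(s * (t + θ * Complex.I))) := by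
  have := hy.1.continuous
  fun_prop

theorem IsFlat.exists_norm_line_le {a b : ℝ} {y : ℂ → ℂ} (hy : IsFlat a b y) (A : ℝ) {B : ℝ}
    (hB : B < 0) {θ : ℝ} (hθ : θ ∈ Set.Ioo a b) :
    ∃ C κ : ℝ, 0 ≤ C ∧ 0 < κ ∧ ∀ s : ℂ, A ≤ s.re → s.re ≤ B → ∀ t : ℝ,
      ‖y (t + θ * Complex.I) * Complex.exp (-(s * (t + θ * Complex.I)))‖ ≤
        C * Real.exp (θ * s.im) * Real.exp (-(κ * |t|)) := by
  obtain ⟨C, κ, hC, hκ, h⟩ := hy.exists_norm_mul_exp_le A hB hθ.1 hθ.2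
  refine ⟨C, κ, hC, hκ, fun s h1 h2 t => ?_⟩
  have := h s (t + θ * Complex.I) h1 h2 (line_im θ t).ge (line_im θ t).le
  rwa [line_re, line_im] at this

theorem IsFlat.integrable_line {a b : ℝ} {y : ℂ → ℂ} (hy : IsFlat a b y) {θ : ℝ}
    (hθ : θ ∈ Set.Ioo a b) {s : ℂ} (hs : s.re < 0) : MeasureTheory.Integrable fun t : ℝ =>
      y (t + θ * Complex.I) * Complex.exp (-(s * (t + θ * Complex.I))) := by
  obtain ⟨C, κ, -, hκ, h⟩ := hy.exists_norm_line_le s.re hs hθ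
  exact ((integrable_exp_neg_mul_abs hκ).const_mul _).mono'
    (hy.continuous_line θ s).aestronglyMeasurable (Eventually.of_forall (h s le_rfl le_rfl))

theorem IsFlat.exists_norm_laplace_le {a b : ℝ} {y : ℂ → ℂ} (hy : IsFlat a b y) (A : ℝ) {B : ℝ}
    (hB : B < 0) {θ : ℝ} (hθ : θ ∈ Set.Ioo a b) :
    ∃ C : ℝ, 0 ≤ C ∧ ∀ s : ℂ, A ≤ s.re → s.re ≤ B →
      ‖laplace y θ s‖ ≤ C * Real.exp (θ * s.im) := by
  obtain ⟨C, κ, hC, hκ, h⟩ := hy.exists_norm_line_le A hB hθ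
  refine ⟨C * ∫ t : ℝ, Real.exp (-(κ * |t|)), mul_nonneg hC
    (MeasureTheory.integral_nonneg fun t => (Real.exp_pos _).le), fun s h1 h2 => ?_⟩
  refine (MeasureTheory.norm_integral_le_of_norm_le
    ((integrable_exp_neg_mul_abs hκ).const_mul _) (Eventually.of_forall (h s h1 h2))).trans
    (le_of_eq ?_)
  rw [MeasureTheory.integral_const_mul]
  ring

theorem IsFlat.differentiableAt_laplace {a b : ℝ} {y : ℂ → ℂ} (hy : IsFlat a b y) {θ : ℝ}
    (hθ : θ ∈ Set.Ioo a b) {s : ℂ} (hs : s.re < 0) : DifferentiableAt ℂ (laplace y θ) s := by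
  obtain ⟨C, κ, hC, hκ, h⟩ := hy.id_mul.exists_norm_line_le (s.re - 1) (B := s.re / 2)
    (by linarith) hθ
  set S : Set ℂ := {u | s.re - 1 < u.re ∧ u.re < s.re / 2 ∧ |u.im| < |s.im| + 1} with hS
  have hopen : S ∈ 𝓝 s := by
    have h1 : ContinuousAt Complex.re s := Complex.continuous_re.continuousAt
    have h2 : ContinuousAt (fun u : ℂ => |u.im|) s := by fun_prop
    filter_upwards [h1.eventually_const_lt (show s.re - 1 < s.re by linarith),
      h1.eventually_lt_const (show s.re < s.re / 2 by linarith),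
      h2.eventually_lt_const (show |s.im| < |s.im| + 1 by linarith)] with u a1 a2 a3
    exact ⟨a1, a2, a3⟩
  have key := hasDerivAt_integral_of_dominated_loc_of_deriv_le (μ := MeasureTheory.volume)
    (F := fun (s : ℂ) (t : ℝ) =>
      y (t + θ * Complex.I) * Complex.exp (-(s * (t + θ * Complex.I))))
    (F' := fun (s : ℂ) (t : ℝ) => -(((t : ℂ) + θ * Complex.I) * y (t + θ * Complex.I) *
      Complex.exp (-(s * (t + θ * Complex.I)))))
    (bound := fun t => C * Real.exp (|θ| * (|s.im| + 1)) * Real.exp (-(κ * |t|))) hopen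
    (Eventually.of_forall fun u => (hy.continuous_line θ u).aestronglyMeasurable)
    (hy.integrable_line hθ hs) (hy.id_mul.continuous_line θ s).neg.aestronglyMeasurable
    (Eventually.of_forall fun t u hu => ?_) ((integrable_exp_neg_mul_abs hκ).const_mul _)
    (Eventually.of_forall fun t u _ => ?_)
  · exact key.2.differentiableAt
  · rw [norm_neg]
    refine (h u hu.1.le hu.2.1.le t).trans ?_
    have h1 : θ * u.im ≤ |θ| * (|s.im| + 1) := by
      refine (le_abs_self _).trans ?_
      rw [abs_mul]
      exact mul_le_mul_of_nonneg_left hu.2.2.le (abs_nonneg θ)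
    exact mul_le_mul_of_nonneg_right (mul_le_mul_of_nonneg_left (Real.exp_le_exp.2 h1) hC)
      (Real.exp_pos _).le
  · have h1 : HasDerivAt (fun u : ℂ => Complex.exp (-(u * (t + θ * Complex.I))))
        (Complex.exp (-(u * (t + θ * Complex.I))) * -(1 * (t + θ * Complex.I))) u :=
      (((hasDerivAt_id u).mul_const _).neg).cexp
    refine (h1.const_mul _).congr_deriv ?_
    ring

/-- The Laplace transform of a flat function does not depend on the line of integration. -/
theorem IsFlat.laplace_eq_of_lt {a b : ℝ} {y : ℂ → ℂ} (hy : IsFlat a b y) {θ₁ θ₂ : ℝ}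
    (h₁ : a < θ₁) (h₂ : θ₂ < b) (h₁₂ : θ₁ < θ₂) {s : ℂ} (hs : s.re < 0) :
    laplace y θ₁ s = laplace y θ₂ s := by
  set δ := (θ₂ - θ₁) / 2 with hδ
  set c := (θ₁ + θ₂) / 2 with hc
  have hδ0 : 0 < δ := by linarith
  obtain ⟨C, κ, hC, hκ, h⟩ := hy.exists_norm_mul_exp_le s.re hs h₁ h₂
  set g : ℂ → ℂ := fun z => y (c * Complex.I - Complex.I * z) *
    Complex.exp (-(s * (c * Complex.I - Complex.I * z))) with hg
  have hgd : Differentiable ℂ g := by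
    have := hy.1
    fun_prop
  have hline : ∀ σ τ : ℝ, (c : ℂ) * Complex.I - Complex.I * (σ + τ * Complex.I) =
      τ + ((c - σ : ℝ) : ℂ) * Complex.I := fun σ τ => by
    push_cast
    linear_combination (-(τ : ℂ)) * Complex.I_sq
  have hv : VanishesAtStripEnds δ g := by
    intro ε hε
    set E := Real.exp ((|θ₁| + |θ₂|) * |s.im|)
    have hlim : Tendsto (fun T : ℝ => C * E * Real.exp (-(κ * T))) atTop (𝓝 0) := by
      have h1 : Tendsto (fun T : ℝ => Real.exp (-(κ * T))) atTop (𝓝 0) :=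
        Real.tendsto_exp_neg_atTop_nhds_zero.comp (tendsto_id.const_mul_atTop hκ)
      simpa using h1.const_mul (C * E)
    filter_upwards [hlim.eventually_le_const hε, eventually_ge_atTop 0] with T hT hT0 σ hσ
    have hσ' := abs_le.1 hσ
    have main : ∀ τ : ℝ, |τ| = T → ‖g (σ + τ * Complex.I)‖ ≤ ε := by
      intro τ hτ
      have h3 : θ₁ ≤ c - σ := by rw [hc]; linarith
      have h4 : c - σ ≤ θ₂ := by rw [hc]; linarith
      have := h s (τ + ((c - σ : ℝ) : ℂ) * Complex.I) le_rfl le_rfl (by rwa [line_im])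
        (by rwa [line_im])
      simp only [hg, hline]
      refine this.trans (le_trans ?_ hT)
      rw [line_im, line_re, hτ]
      gcongr
      refine Real.exp_le_exp.2 ((le_abs_self _).trans ?_)
      rw [abs_mul]
      refine mul_le_mul_of_nonneg_right (abs_le.2 ⟨?_, ?_⟩) (abs_nonneg _)
      · linarith [neg_abs_le θ₁, abs_nonneg θ₂]
      · linarith [le_abs_self θ₂, abs_nonneg θ₁]
    exact ⟨main T (abs_of_nonneg hT0), main (-T) (by rw [abs_neg, abs_of_nonneg hT0])⟩
  have hlim : ∀ σ : ℝ, c - σ ∈ Set.Ioo a b →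
      Tendsto (fun T => verticalIntegral g σ T) atTop (𝓝 (laplace y (c - σ) s)) := by
    intro σ hσ
    refine (MeasureTheory.intervalIntegral_tendsto_integral
      (hy.integrable_line hσ hs) tendsto_neg_atTop_atBot tendsto_id).congr fun T => ?_
    unfold verticalIntegral
    refine intervalIntegral.integral_congr fun τ _ => ?_
    simp only [hg, hline]
  have e1 : c - δ = θ₁ := by rw [hc, hδ]; ring
  have e2 : c - -δ = θ₂ := by rw [hc, hδ]; ring
  have l1 := hlim δ (by rw [e1]; exact ⟨h₁, by linarith⟩)
  have l2 := hlim (-δ) (by rw [e2]; exact ⟨by linarith, h₂⟩)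
  rw [e1] at l1
  rw [e2] at l2
  exact sub_eq_zero.1 (tendsto_nhds_unique (l1.sub l2)
    (tendsto_verticalIntegral_sub_of_holomorphic hδ0 hgd.differentiableOn hv))

theorem IsFlat.laplace_eq {a b : ℝ} {y : ℂ → ℂ} (hy : IsFlat a b y) {θ₁ θ₂ : ℝ}
    (h₁ : θ₁ ∈ Set.Ioo a b) (h₂ : θ₂ ∈ Set.Ioo a b) {s : ℂ} (hs : s.re < 0) :
    laplace y θ₁ s = laplace y θ₂ s := by
  rcases lt_trichotomy θ₁ θ₂ with h | h | h
  · exact hy.laplace_eq_of_lt h₁.1 h₂.2 h hs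
  · rw [h]
  · exact (hy.laplace_eq_of_lt h₂.1 h₁.2 h hs).symm

/-- Integration by parts. -/
theorem IsFlat.laplace_deriv {a b : ℝ} {y y' : ℂ → ℂ} (hy : IsFlat a b y) (hy' : IsFlat a b y')
    (h : ∀ x, HasDerivAt y (y' x) x) {θ : ℝ} (hθ : θ ∈ Set.Ioo a b) {s : ℂ} (hs : s.re < 0) :
    laplace y' θ s = s * laplace y θ s := by
  have h1 : ∀ t : ℝ, HasDerivAt
      (fun t : ℝ => y (t + θ * Complex.I) * Complex.exp (-(s * (t + θ * Complex.I))))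
      (y' (t + θ * Complex.I) * Complex.exp (-(s * (t + θ * Complex.I))) -
        s * (y (t + θ * Complex.I) * Complex.exp (-(s * (t + θ * Complex.I))))) t := by
    intro t
    have hl : HasDerivAt (fun t : ℝ => (t : ℂ) + θ * Complex.I) 1 t :=
      (Complex.ofRealCLM.hasDerivAt (x := t)).add_const _
    have h2 := (h (t + θ * Complex.I)).comp_of_eq t hl rfl
    have h3 := ((hl.const_mul s).neg).cexp
    refine (h2.mul h3).congr_deriv ?_
    simp only [Function.comp, Pi.neg_apply]
    ring
  have h2 := (hy.integrable_line hθ hs).const_mul s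
  have h3 := MeasureTheory.integral_eq_zero_of_hasDerivAt_of_integrable h1
    ((hy'.integrable_line hθ hs).sub h2) (hy.integrable_line hθ hs)
  rw [MeasureTheory.integral_sub (hy'.integrable_line hθ hs) h2,
    MeasureTheory.integral_const_mul] at h3
  exact sub_eq_zero.1 h3

theorem laplace_exp_mul (y : ℂ → ℂ) (θ : ℝ) (s : ℂ) :
    laplace (fun x => Complex.exp x * y x) θ s = laplace y θ (s - 1) := by
  unfold laplace
  congr 1
  funext t
  rw [show -((s - 1) * (t + θ * Complex.I)) = (t + θ * Complex.I) + -(s * (t + θ * Complex.I)) by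
    ring, Complex.exp_add]
  ring

/-- A flat function whose Laplace transform vanishes is zero. -/
theorem IsFlat.eq_zero_of_laplace_eq_zero {a b : ℝ} (hab : a < b) {y : ℂ → ℂ} (hy : IsFlat a b y)
    (h : ∀ θ ∈ Set.Ioo a b, ∀ s : ℂ, s.re < 0 → laplace y θ s = 0) : y = 0 := by
  have h1 : ∀ x : ℂ, a < x.im → x.im < b → y x = 0 := by
    intro x hxa hxb
    set g : ℝ → ℂ := fun t => y (t + x.im * Complex.I) *
      Complex.exp (-(((-1 : ℝ) : ℂ) * (t + x.im * Complex.I))) with hg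
    have hF : FourierTransform.fourier g = 0 := by
      funext ξ
      have h2 := h x.im ⟨hxa, hxb⟩ (((-1 : ℝ) : ℂ) + (2 * Real.pi * ξ : ℝ) * Complex.I)
        (by rw [line_re]; norm_num)
      have h3 : FourierTransform.fourier g ξ =
          Complex.exp ((2 * Real.pi * ξ : ℝ) * Complex.I * (x.im * Complex.I)) *
          laplace y x.im (((-1 : ℝ) : ℂ) + (2 * Real.pi * ξ : ℝ) * Complex.I) := by
        rw [Real.fourier_real_eq_integral_exp_smul]
        unfold laplace
        rw [← MeasureTheory.integral_const_mul]
        congr 1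
        funext t
        have hcomm : ∀ A B E : ℂ, A * (B * E) = B * (A * E) := fun A B E => by ring
        rw [hg, smul_eq_mul, hcomm, hcomm (Complex.exp ((2 * Real.pi * ξ : ℝ) * _ * _)),
          ← Complex.exp_add, ← Complex.exp_add]
        congr 2
        push_cast
        ring
      rw [h3, h2, mul_zero]
      rfl
    have hint : MeasureTheory.Integrable g :=
      hy.integrable_line ⟨hxa, hxb⟩ (s := ((-1 : ℝ) : ℂ)) (by norm_num)
    have hinv := (hy.continuous_line x.im ((-1 : ℝ) : ℂ)).fourierInv_fourier_eq hint
      (by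
        change MeasureTheory.Integrable (FourierTransform.fourier g)
        rw [hF]; exact MeasureTheory.integrable_zero _ _ _)
    change FourierTransformInv.fourierInv (FourierTransform.fourier g) = g at hinv
    have h0 : g x.re = 0 := by
      rw [← hinv, hF, Real.fourierInv_eq']
      simp
    rw [hg] at h0
    simp only [Complex.re_add_im] at h0
    exact (mul_eq_zero.1 h0).resolve_right (Complex.exp_ne_zero _)
  have han : AnalyticOnNhd ℂ y Set.univ := fun x _ => hy.1.analyticAt x
  refine han.eq_of_eventuallyEq (fun x _ => analyticAt_const) (z₀ := ((a + b) / 2 : ℝ) * Complex.I)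
    ?_
  have hc : ContinuousAt Complex.im (((a + b) / 2 : ℝ) * Complex.I) :=
    Complex.continuous_im.continuousAt
  have him : (((a + b) / 2 : ℝ) * Complex.I).im = (a + b) / 2 := by simp
  filter_upwards [hc.eventually_const_lt (u := a) (by rw [him]; linarith),
    hc.eventually_lt_const (u := b) (by rw [him]; linarith)] with x ha hb
  exact h1 x ha hb

/-! ### Flat solutions of the hypergeometric equation -/

/-- A function on the left half plane with period `1` extends to an entire function. -/
theorem exists_periodic_extension {p : ℂ → ℂ} (hd : ∀ s : ℂ, s.re < 0 → DifferentiableAt ℂ p s)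
    (hp : ∀ s : ℂ, s.re < 0 → p (s - 1) = p s) :
    ∃ q : ℂ → ℂ, Differentiable ℂ q ∧ Function.Periodic q 1 ∧ ∀ s : ℂ, s.re < 0 → q s = p s := by
  have h1 : ∀ (n : ℕ) (s : ℂ), s.re < 0 → p (s - n) = p s := by
    intro n s hs
    induction n with
    | zero => simp
    | succ n ih =>
      rw [← ih, ← hp (s - n)]
      · congr 1; push_cast; ring
      · have : (0 : ℝ) ≤ n := n.cast_nonneg
        simp only [Complex.sub_re, Complex.natCast_re]
        linarith
  have h2 : ∀ (m n : ℕ) (s : ℂ), s.re < m → s.re < n → p (s - m) = p (s - n) := by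
    intro m n s hm hn
    rcases le_total m n with h | h
    · obtain ⟨e, rfl⟩ := Nat.exists_eq_add_of_le h
      rw [← h1 e (s - m) (by simpa using hm)]
      congr 1; push_cast; ring
    · obtain ⟨e, rfl⟩ := Nat.exists_eq_add_of_le h
      rw [← h1 e (s - n) (by simpa using hn)]
      congr 1; push_cast; ring
  have hlt : ∀ s : ℂ, s.re < (⌊|s.re|⌋₊ + 1 : ℕ) := fun s => by
    push_cast
    exact (le_abs_self _).trans_lt (Nat.lt_floor_add_one _)
  have h3 : ∀ (n : ℕ) (s : ℂ), s.re < n → p (s - (⌊|s.re|⌋₊ + 1 : ℕ)) = p (s - n) :=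
    fun n s hn => h2 _ _ s (hlt s) hn
  refine ⟨fun s => p (s - (⌊|s.re|⌋₊ + 1 : ℕ)), fun s => ?_, fun s => ?_, fun s hs => ?_⟩
  · have hev : (fun s => p (s - (⌊|s.re|⌋₊ + 1 : ℕ))) =ᶠ[𝓝 s]
        fun u => p (u - (⌊|s.re|⌋₊ + 1 : ℕ)) := by
      filter_upwards [Complex.continuous_re.continuousAt.eventually_lt_const (hlt s)] with u hu
      exact h3 _ u hu
    refine DifferentiableAt.congr_of_eventuallyEq ?_ hev
    refine DifferentiableAt.comp s (hd _ ?_) (by fun_prop)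
    have := hlt s
    rw [Complex.sub_re, Complex.natCast_re]
    linarith
  · simp only
    obtain ⟨n, hn⟩ := exists_nat_gt s.re
    rw [h3 n s hn, h3 (n + 1) (s + 1) (by simpa using hn)]
    congr 1; push_cast; ring
  · have := h3 0 s (by simpa using hs)
    rwa [Nat.cast_zero, sub_zero] at this

/-- Liouville's theorem for a function on the cylinder: the bound says that
`q(s) e^{iπs}` decays at both ends. -/
theorem eq_zero_of_periodic_of_norm_le {q : ℂ → ℂ} (hq : Differentiable ℂ q)
    (hper : Function.Periodic q 1) {C κ : ℝ} (hκ : 0 < κ)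
    (hb : ∀ s : ℂ, -2 ≤ s.re → s.re ≤ -1 → 1 ≤ |s.im| →
      ‖q s‖ ≤ C * Real.exp (Real.pi * s.im - κ * |s.im|)) : q = 0 := by
  set H : ℂ → ℂ := fun s => q s * Complex.exp (Real.pi * Complex.I * s) with hH
  have hHd : Differentiable ℂ H := by fun_prop
  have hexp : ∀ s : ℂ, ‖Complex.exp (Real.pi * Complex.I * s)‖ = Real.exp (-(Real.pi * s.im)) := by
    intro s
    rw [Complex.norm_exp]
    congr 1
    simp
  have hnorm : ∀ (s : ℂ) (n : ℤ), ‖H (s - n)‖ = ‖H s‖ := by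
    intro s n
    have h1 := hper.sub_zsmul_eq n (x := s)
    rw [zsmul_one] at h1
    simp only [hH]
    rw [norm_mul, norm_mul, h1, hexp, hexp]
    simp
  have hbH : ∀ s : ℂ, -2 ≤ s.re → s.re ≤ -1 → 1 ≤ |s.im| →
      ‖H s‖ ≤ C * Real.exp (-(κ * |s.im|)) := by
    intro s h1 h2 h3
    simp only [hH]
    rw [norm_mul, hexp]
    refine (mul_le_mul_of_nonneg_right (hb s h1 h2 h3) (Real.exp_pos _).le).trans (le_of_eq ?_)
    rw [mul_assoc, ← Real.exp_add]
    congr 2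
    ring
  obtain ⟨B, hB⟩ := (IsCompact.reProdIm (isCompact_Icc (a := (-2 : ℝ)) (b := -1))
    (isCompact_Icc (a := (-1 : ℝ)) (b := 1))).exists_bound_of_continuousOn
    hHd.continuous.continuousOn
  have hbdd : ∀ s, ‖H s‖ ≤ |C| + B := by
    intro s
    rw [← hnorm s (⌊s.re⌋ + 2)]
    set u := s - ((⌊s.re⌋ + 2 : ℤ) : ℂ) with hu
    have hre : u.re = s.re - ⌊s.re⌋ - 2 := by
      rw [hu, Complex.sub_re, Complex.intCast_re]; push_cast; ring
    have h1 : -2 ≤ u.re := by rw [hre]; linarith [Int.floor_le s.re]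
    have h2 : u.re ≤ -1 := by rw [hre]; linarith [Int.lt_floor_add_one s.re]
    have hB0 : 0 ≤ B := (norm_nonneg _).trans (hB (-1) (by
      rw [Complex.mem_reProdIm]; constructor <;> norm_num))
    rcases le_total 1 |u.im| with h | h
    · refine (hbH u h1 h2 h).trans ?_
      have h3 : Real.exp (-(κ * |u.im|)) ≤ 1 := Real.exp_le_one_iff.2 (by
        have := abs_nonneg u.im
        nlinarith)
      have h4 : C * Real.exp (-(κ * |u.im|)) ≤ |C| * 1 :=
        mul_le_mul (le_abs_self C) h3 (Real.exp_pos _).le (abs_nonneg C)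
      linarith
    · have := hB u (by rw [Complex.mem_reProdIm]; exact ⟨⟨h1, h2⟩, abs_le.1 h⟩)
      linarith [abs_nonneg C]
  have hconst := hHd.apply_eq_apply_of_bounded (isBounded_iff_forall_norm_le.2
    ⟨_, by rintro _ ⟨s, rfl⟩; exact hbdd s⟩)
  have hlim : Tendsto (fun T : ℝ => C * Real.exp (-(κ * T))) atTop (𝓝 0) := by
    have h1 : Tendsto (fun T : ℝ => Real.exp (-(κ * T))) atTop (𝓝 0) :=
      Real.tendsto_exp_neg_atTop_nhds_zero.comp (tendsto_id.const_mul_atTop hκ)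
    simpa using h1.const_mul C
  funext s
  have h0 : ‖H s‖ ≤ 0 := by
    refine ge_of_tendsto hlim ?_
    filter_upwards [eventually_ge_atTop 1] with T hT
    have hT0 : |T| = T := abs_of_nonneg (by linarith)
    rw [hconst s (((-1 : ℝ) : ℂ) + T * Complex.I)]
    have := hbH (((-1 : ℝ) : ℂ) + T * Complex.I) (by rw [line_re]; norm_num)
      (by rw [line_re]) (by rwa [line_im, hT0])
    rwa [line_im, hT0] at this
  exact (mul_eq_zero.1 (norm_le_zero_iff.1 h0)).resolve_right (Complex.exp_ne_zero _)

/-- Flatness passes from `y` to all `P(q d/dq) y`. -/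
theorem IsFlat.of_linearMap {a b : ℝ} {F : Polynomial ℂ →ₗ[ℂ] (ℂ → ℂ)}
    (hder : ∀ P x, HasDerivAt (F P) (F (Polynomial.X * P) x) x) (h1 : IsFlat a b (F 1))
    (P : Polynomial ℂ) : IsFlat a b (F P) := by
  induction P using Polynomial.induction_on' with
  | add P Q hP hQ => rw [map_add]; exact hP.add hQ
  | monomial k c =>
    rw [← mul_one c, ← smul_eq_mul, ← Polynomial.smul_monomial, map_smul]
    refine IsFlat.const_mul ?_ c
    induction k with
    | zero => simpa using h1
    | succ k ih =>
      rw [← Polynomial.X_mul_monomial]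
      exact ih.deriv (fun x => (hder _ x).differentiableAt) (hder _)

theorem laplace_linearMap {a b : ℝ} {F : Polynomial ℂ →ₗ[ℂ] (ℂ → ℂ)}
    (hder : ∀ P x, HasDerivAt (F P) (F (Polynomial.X * P) x) x) (h1 : IsFlat a b (F 1))
    {θ : ℝ} (hθ : θ ∈ Set.Ioo a b) {s : ℂ} (hs : s.re < 0) (P : Polynomial ℂ) :
    laplace (F P) θ s = P.eval s * laplace (F 1) θ s := by
  induction P using Polynomial.induction_on' with
  | add P Q hP hQ =>
    rw [Polynomial.eval_add, add_mul, ← hP, ← hQ, map_add]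
    unfold laplace
    rw [← MeasureTheory.integral_add ((h1.of_linearMap hder P).integrable_line hθ hs)
      ((h1.of_linearMap hder Q).integrable_line hθ hs)]
    congr 1
    funext t
    rw [Pi.add_apply, add_mul]
  | monomial k c =>
    have hk : laplace (F (Polynomial.monomial k 1)) θ s = s ^ k * laplace (F 1) θ s := by
      induction k with
      | zero => simp
      | succ k ih =>
        rw [← Polynomial.X_mul_monomial, (h1.of_linearMap hder _).laplace_deriv
          (h1.of_linearMap hder _) (hder _) hθ hs, ih, pow_succ']
        ring
    rw [Polynomial.eval_monomial, mul_assoc, ← hk, ← mul_one c, ← smul_eq_mul c 1,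
      ← Polynomial.smul_monomial, map_smul]
    unfold laplace
    rw [smul_eq_mul, mul_one, ← MeasureTheory.integral_const_mul]
    congr 1
    funext t
    rw [Pi.smul_apply, smul_eq_mul, mul_assoc]

theorem one_le_fanoIndex {N : ℕ} {d : ℕ} {w : Fin N → ℕ} (hr : d < ∑ j, w j) :
    1 ≤ fanoIndex d w := by
  have : (d : ℝ) + 1 ≤ ∑ j, (w j : ℝ) := by exact_mod_cast hr
  unfold fanoIndex
  linarith

/-- A solution of the hypergeometric differential equation that is flat in a sector of opening more
than `π r` vanishes: its Laplace transform satisfies the recurrence of `gammaRatio`, and the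
periodic quotient of the two is too small at both ends of the cylinder. The linear map `F` stands
for `P ↦ P(q d/dq) y`. -/
theorem eq_zero_of_isFlat {N : ℕ} {d : ℕ} {w : Fin N → ℕ} (hd : 0 < d)
    (hw : ∀ j, 0 < w j) (hdvd : ∀ j, w j ∣ d) (hr : d < ∑ j, w j)
    {F : Polynomial ℂ →ₗ[ℂ] (ℂ → ℂ)}
    (hder : ∀ P x, HasDerivAt (F P) (F (Polynomial.X * P) x) x)
    (hode : ∀ x, F (weightPoly w) x = Complex.exp x * F (degreePoly d) x)
    (hflat : IsFlat (sectorCenter d w - sectorRadius d w) (sectorCenter d w + sectorRadius d w)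
      (F 1)) : F 1 = 0 := by
  have hr1 := one_le_fanoIndex hr
  have hpi := Real.pi_pos
  set c := sectorCenter d w with hc
  set ρ := sectorRadius d w with hρ
  set ρ' : ℝ := Real.pi / 2 * fanoIndex d w + Real.pi / 4 with hρ'
  have hρ0 : 0 < ρ' := by positivity
  have hρρ : ρ' < ρ := by rw [hρ, hρ', sectorRadius]; linarith
  have hmid : c ∈ Set.Ioo (c - ρ) (c + ρ) := ⟨by linarith, by linarith⟩
  have hlow : c - ρ' ∈ Set.Ioo (c - ρ) (c + ρ) := ⟨by linarith, by linarith⟩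
  have hupp : c + ρ' ∈ Set.Ioo (c - ρ) (c + ρ) := ⟨by linarith, by linarith⟩
  set M := laplace (F 1) c with hM
  have hG0 : ∀ s : ℂ, s.re < 0 → gammaRatio d w s ≠ 0 := fun s => gammaRatio_ne_zero hd hw
  have hneg : ∀ (e : ℕ) (s : ℂ), 0 < e → s.re < 0 → ∀ i : ℕ, (e : ℂ) * s - i ≠ 0 := by
    intro e s he hs i h
    have h1 := congrArg Complex.re h
    have he' : (0 : ℝ) < e := by exact_mod_cast he
    have hi : (0 : ℝ) ≤ i := i.cast_nonneg
    simp at h1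
    nlinarith
  have hrec : ∀ s : ℂ, s.re < 0 →
      (weightPoly w).eval s * M s = (degreePoly d).eval (s - 1) * M (s - 1) := by
    intro s hs
    have hs1 : (s - 1).re < 0 := by simp; linarith
    rw [hM, ← laplace_linearMap hder hflat hmid hs, ← laplace_linearMap hder hflat hmid hs1,
      ← laplace_exp_mul]
    congr 1
    funext x
    exact hode x
  have hper : ∀ s : ℂ, s.re < 0 →
      M (s - 1) * (gammaRatio d w (s - 1))⁻¹ = M s * (gammaRatio d w s)⁻¹ := by
    intro s hs
    have hs1 : (s - 1).re < 0 := by simp; linarith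
    have h1 := gammaRatio_recurrence (w := w) hd hdvd (s := s)
      (fun i _ h => hneg d s hd hs i (sub_eq_zero.2 h))
    have h2 : (weightPoly w).eval s ≠ 0 := by
      rw [eval_weightPoly]
      exact Finset.prod_ne_zero_iff.2 fun j _ => Finset.prod_ne_zero_iff.2 fun i _ =>
        hneg _ s (hw j) hs i
    have h3 : (degreePoly d).eval (s - 1) ≠ 0 := by
      rw [eval_degreePoly_sub_one]
      exact Finset.prod_ne_zero_iff.2 fun i _ => hneg _ s hd hs i
    have h4 := hrec s hs
    rw [← div_eq_mul_inv, ← div_eq_mul_inv, div_eq_div_iff (hG0 _ hs1) (hG0 _ hs)]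
    refine mul_left_cancel₀ (mul_ne_zero h2 h3) ?_
    linear_combination ((degreePoly d).eval (s - 1) * M (s - 1)) * h1 -
      ((degreePoly d).eval (s - 1) * gammaRatio d w (s - 1)) * h4
  -- The quotient of the two solutions of the recurrence is periodic.
  obtain ⟨q, hqd, hqp, hq⟩ := exists_periodic_extension
    (p := fun s => M s * (gammaRatio d w s)⁻¹) (fun s hs => by
      refine (hflat.differentiableAt_laplace hmid hs).mul (DifferentiableAt.inv
        (differentiableAt_gammaRatio d fun j m h => ?_) (hG0 s hs))
      exact hneg _ s (hw j) hs m (sub_eq_zero.2 h)) hper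
  obtain ⟨C₁, hC₁, h₁⟩ := hflat.exists_norm_laplace_le (-2) (B := -1) (by norm_num) hlow
  obtain ⟨C₂, hC₂, h₂⟩ := hflat.exists_norm_laplace_le (-2) (B := -1) (by norm_num) hupp
  obtain ⟨C₃, hC₃, h₃⟩ := exists_norm_gammaRatio_le (w := w) hd hw 2 (ε := Real.pi / 8)
    (by positivity)
  -- The lower line of integration is used for `Im s ≥ 0`, the upper one for `Im s ≤ 0`.
  have hMb : ∀ s : ℂ, -2 ≤ s.re → s.re ≤ -1 →
      ‖M s‖ ≤ (C₁ + C₂) * Real.exp (c * s.im - ρ' * |s.im|) := by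
    intro s a1 a2
    have hs : s.re < 0 := by linarith
    rcases le_total 0 s.im with h | h
    · rw [hM, hflat.laplace_eq hmid hlow hs, abs_of_nonneg h, ← sub_mul]
      refine (h₁ s a1 a2).trans ?_
      gcongr
      linarith
    · rw [hM, hflat.laplace_eq hmid hupp hs, abs_of_nonpos h]
      refine (h₂ s a1 a2).trans ?_
      rw [show c * s.im - ρ' * -s.im = (c + ρ') * s.im by ring]
      gcongr
      linarith
  have hq0 : q = 0 := by
    refine eq_zero_of_periodic_of_norm_le hqd hqp (C := (C₁ + C₂) * C₃) (κ := Real.pi / 8)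
      (by positivity) fun s a1 a2 a3 => ?_
    rw [hq s (by linarith), norm_mul]
    have h5 := (h₃ s (abs_le.2 ⟨by push_cast; linarith, by push_cast; linarith⟩) a3).2
    refine (mul_le_mul (hMb s a1 a2) h5 (norm_nonneg _) (by positivity)).trans (le_of_eq ?_)
    rw [mul_mul_mul_comm, ← Real.exp_add]
    congr 2
    rw [hc, hρ', sectorCenter]
    ring
  refine hflat.eq_zero_of_laplace_eq_zero (by linarith) fun θ hθ s hs => ?_
  rw [hflat.laplace_eq hθ hmid hs]
  have h6 := hq s hs
  rw [hq0] at h6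
  exact (mul_eq_zero.1 h6.symm).resolve_right (inv_ne_zero (hG0 s hs))

/-! ### The hypergeometric equation of the I-function -/

theorem sectorExponent_add_one (f : ℚ) (m : ℕ) :
    sectorExponent f (m + 1) = sectorExponent f m + 1 := by
  unfold sectorExponent
  push_cast
  ring

/-- The factors by which the hypergeometric products grow when `n` increases by `1`. -/
def stepFactor (c : ℕ) (n : ℚ) : PowerSeries ℂ :=
  ∏ i ∈ range c, (PowerSeries.C (c : ℂ) * PowerSeries.X
    + PowerSeries.C ((((n + 1) * (c : ℚ) - (i : ℚ) : ℚ) : ℂ)))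

theorem hypergeometricFactor_add_one (c : ℕ) {n : ℚ} (hn : 0 ≤ n) :
    hypergeometricFactor c (n + 1) 1 = stepFactor c n * hypergeometricFactor c n 1 := by
  have h : ⌈(n + 1) * (c : ℚ)⌉₊ = c + ⌈n * (c : ℚ)⌉₊ := by
    rw [add_mul, one_mul, Nat.ceil_add_natCast (by positivity), add_comm]
  unfold hypergeometricFactor stepFactor
  rw [h, Finset.prod_range_add]
  simp only [mul_one]
  congr 1
  refine Finset.prod_congr rfl fun i _ => ?_
  congr 3
  push_cast
  ring

theorem constantCoeff_stepFactor_ne_zero (c : ℕ) {n : ℚ} (hn : 0 ≤ n) :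
    PowerSeries.constantCoeff (stepFactor c n) ≠ 0 := by
  unfold stepFactor
  rw [map_prod]
  refine Finset.prod_ne_zero_iff.2 fun i hi => ?_
  have hi' : (i : ℚ) < c := by exact_mod_cast mem_range.1 hi
  have h : (n + 1) * (c : ℚ) - i ≠ 0 := by
    have : 0 ≤ n * (c : ℚ) := by positivity
    linarith
  rw [map_add, map_mul, PowerSeries.constantCoeff_X, mul_zero, zero_add,
    PowerSeries.constantCoeff_C]
  exact_mod_cast h

theorem aeval_weightPoly {N : ℕ} (w : Fin N → ℕ) (Z : PowerSeries ℂ) :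
    Polynomial.aeval Z (weightPoly w) =
      ∏ j, ∏ i ∈ range (w j), (PowerSeries.C (w j : ℂ) * Z - PowerSeries.C (i : ℂ)) := by
  simp [weightPoly, map_prod]

theorem aeval_degreePoly (d : ℕ) (Z : PowerSeries ℂ) :
    Polynomial.aeval Z (degreePoly d) =
      ∏ i ∈ range d, (PowerSeries.C (d : ℂ) * Z + PowerSeries.C ((i : ℂ) + 1)) := by
  simp [degreePoly, map_prod]

theorem aeval_weightPoly_eq_stepFactor {N : ℕ} (w : Fin N → ℕ) (n : ℚ) :
    Polynomial.aeval (PowerSeries.C ((n : ℂ) + 1) + PowerSeries.X) (weightPoly w) =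
      ∏ j, stepFactor (w j) n := by
  rw [aeval_weightPoly]
  refine Finset.prod_congr rfl fun j _ => Finset.prod_congr rfl fun i _ => ?_
  rw [mul_add, ← map_mul, add_sub_right_comm, ← map_sub, add_comm]
  congr 2
  push_cast
  ring

theorem aeval_degreePoly_eq_stepFactor (d : ℕ) (n : ℚ) :
    Polynomial.aeval (PowerSeries.C (n : ℂ) + PowerSeries.X) (degreePoly d) = stepFactor d n := by
  rw [aeval_degreePoly, ← Finset.prod_range_reflect]
  refine Finset.prod_congr rfl fun i hi => ?_
  have h : i + 1 ≤ d := mem_range.1 hi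
  rw [mul_add, ← map_mul, add_right_comm, ← map_add, add_comm]
  congr 2
  rw [Nat.sub_sub, add_comm 1 i, Nat.cast_sub h]
  push_cast
  ring

/-- The recurrence of the coefficients of the I-function, as an identity of power series in `P`. -/
theorem weightPoly_mul_sectorSeries_succ {N : ℕ} (d : ℕ) (w : Fin N → ℕ) (f : ℚ) (m : ℕ) :
    Polynomial.aeval (PowerSeries.C ((sectorExponent f 0 : ℂ) + (m + 1 : ℕ)) + PowerSeries.X)
        (weightPoly w) * sectorSeries d w f (m + 1) =
      Polynomial.aeval (PowerSeries.C ((sectorExponent f 0 : ℂ) + m) + PowerSeries.X)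
        (degreePoly d) * sectorSeries d w f m := by
  have hn := sectorExponent_nonneg f m
  have e : (sectorExponent f 0 : ℂ) + m = (sectorExponent f m : ℚ) := by
    rw [sectorExponent_eq_add f m]; push_cast; rfl
  have e' : (sectorExponent f 0 : ℂ) + (m + 1 : ℕ) = (sectorExponent f m : ℚ) + 1 := by
    rw [← e]; push_cast; ring
  rw [e, e', aeval_weightPoly_eq_stepFactor, aeval_degreePoly_eq_stepFactor]
  unfold sectorSeries
  rw [sectorExponent_add_one]
  set n := sectorExponent f m
  simp_rw [hypergeometricFactor_add_one _ hn, PowerSeries.mul_inv_rev]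
  rw [Finset.prod_mul_distrib]
  have h : (∏ j, stepFactor (w j) n) * ∏ j, (stepFactor (w j) n)⁻¹ = 1 := by
    rw [← Finset.prod_mul_distrib]
    exact Finset.prod_eq_one fun j _ =>
      PowerSeries.mul_inv_cancel _ (constantCoeff_stepFactor_ne_zero _ hn)
  linear_combination (stepFactor d n * hypergeometricFactor d n 1 *
    ∏ j, (hypergeometricFactor (w j) n 1)⁻¹) * h

/-- The exponents of the differential equation at `q = 0`: `n + P`, with multiplicity `N_f`. -/
theorem X_pow_dvd_aeval_weightPoly {N : ℕ} {w : Fin N → ℕ} (hw : ∀ j, 0 < w j) {n : ℚ}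
    (h0 : 0 ≤ n) (h1 : n < 1) :
    PowerSeries.X ^ fixedDim w n ∣
      Polynomial.aeval (PowerSeries.C (n : ℂ) + PowerSeries.X) (weightPoly w) := by
  rw [aeval_weightPoly, fixedDim, ← Finset.prod_const]
  refine dvd_trans (Finset.prod_dvd_prod_of_dvd _ _ fun j hj => ?_)
    (Finset.prod_dvd_prod_of_subset _ _ _ (filter_subset _ _))
  have hfr := (mem_filter.1 hj).2
  have hc := ceil_eq_of_fract_eq_zero h0 hfr
  have hw' : (0 : ℚ) < w j := by exact_mod_cast hw j
  refine dvd_trans ?_ (Finset.dvd_prod_of_mem _ (a := ⌈n * (w j : ℚ)⌉₊) (mem_range.2 ?_))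
  · refine ⟨PowerSeries.C (w j : ℂ), ?_⟩
    have hc' : ((⌈n * (w j : ℚ)⌉₊ : ℕ) : ℂ) = n * w j := by exact_mod_cast hc
    rw [hc', mul_add, ← map_mul, mul_comm (w j : ℂ), add_sub_cancel_left, mul_comm]
  · have : (⌈n * (w j : ℚ)⌉₊ : ℚ) < w j := by rw [hc]; nlinarith
    exact_mod_cast this

/-- The hypergeometric differential equation. The lowest term of the left side vanishes modulo
`P^{N_f}` by `X_pow_dvd_aeval_weightPoly`. -/
theorem expSum_weightPoly_eq {N : ℕ} {d : ℕ} {w : Fin N → ℕ} (hd : 0 < d)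
    (hw : ∀ j, 0 < w j) (hdvd : ∀ j, w j ∣ d) (hr : d < ∑ j, w j) {f : ℚ} (hf : f ∈ sectors w)
    {i : ℕ} (hi : i < fixedDim w f) (x : ℂ) :
    expSum i (sectorExponent f 0)
        (Polynomial.aeval (eulerOp (sectorExponent f 0)) (weightPoly w) (sectorSeries d w f)) x =
      Complex.exp x * expSum i (sectorExponent f 0)
        (Polynomial.aeval (eulerOp (sectorExponent f 0)) (degreePoly d)
          (sectorSeries d w f)) x := by
  have hU := isRapid_sectorSeries hd hw hdvd hr hf
  have h1 : sectorExponent f 0 < 1 := by rw [sectorExponent_zero]; exact Int.fract_lt_one _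
  unfold expSum
  rw [((hU.aeval_eulerOp _ _).summable i _ x).tsum_eq_zero_add, ← tsum_mul_left]
  have h0 : PowerSeries.coeff i (Polynomial.aeval (eulerOp (sectorExponent f 0)) (weightPoly w)
      (sectorSeries d w f) 0 * expSeries x) = 0 := by
    rw [aeval_eulerOp_apply, Nat.cast_zero, add_zero, mul_assoc]
    have h2 := X_pow_dvd_aeval_weightPoly hw (sectorExponent_nonneg f 0) h1
    rw [fixedDim_sectorExponent] at h2
    exact PowerSeries.X_pow_dvd_iff.1 (dvd_mul_of_dvd_left h2 _) i hi
  rw [h0, zero_mul, zero_add]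
  refine tsum_congr fun m => ?_
  rw [aeval_eulerOp_apply, aeval_eulerOp_apply, weightPoly_mul_sectorSeries_succ,
    show ((sectorExponent f 0 : ℂ) + (m + 1 : ℕ)) * x =
      x + ((sectorExponent f 0 : ℂ) + m) * x by push_cast; ring, Complex.exp_add]
  ring

theorem IsRapid.expSum_add {U V : ℕ → PowerSeries ℂ} (hU : IsRapid U) (hV : IsRapid V) (i : ℕ)
    (n₀ : ℚ) (x : ℂ) : expSum i n₀ (U + V) x = expSum i n₀ U x + expSum i n₀ V x := by
  unfold expSum
  rw [← (hU.summable i n₀ x).tsum_add (hV.summable i n₀ x)]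
  refine tsum_congr fun m => ?_
  rw [Pi.add_apply, add_mul, map_add, add_mul]

theorem expSum_smul (c : ℂ) (U : ℕ → PowerSeries ℂ) (i : ℕ) (n₀ : ℚ) (x : ℂ) :
    expSum i n₀ (c • U) x = c * expSum i n₀ U x := by
  unfold expSum
  rw [← tsum_mul_left]
  refine tsum_congr fun m => ?_
  rw [Pi.smul_apply, smul_mul_assoc, PowerSeries.coeff_smul, smul_eq_mul, mul_assoc]

/-- A linear combination of the components of the I-function generates a module over the
polynomials in `q d/dq` in which the hypergeometric equation holds. -/
theorem exists_linearMap_smallIGW {N : ℕ} {d : ℕ} {w : Fin N → ℕ} (hd : 0 < d)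
    (hw : ∀ j, 0 < w j) (hdvd : ∀ j, w j ∣ d) (hr : d < ∑ j, w j) (c : AmbientSpace w) :
    ∃ F : Polynomial ℂ →ₗ[ℂ] (ℂ → ℂ),
      (∀ P x, HasDerivAt (F P) (F (Polynomial.X * P) x) x) ∧
      (∀ x, F (weightPoly w) x = Complex.exp x * F (degreePoly d) x) ∧
      ∀ x, F 1 x = ∑ p, c p * smallIGW d w x 1 p := by
  have hU : ∀ p : (Σ f : sectors w, Fin (fixedDim w (f : ℚ) - 1)),
      IsRapid (sectorSeries d w (p.1 : ℚ)) := fun p => isRapid_sectorSeries hd hw hdvd hr p.1.2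
  refine ⟨
    { toFun := fun P x => ∑ p : (Σ f : sectors w, Fin (fixedDim w (f : ℚ) - 1)),
        c p * expSum p.2 (sectorExponent (p.1 : ℚ) 0)
          (Polynomial.aeval (eulerOp (sectorExponent (p.1 : ℚ) 0)) P
            (sectorSeries d w (p.1 : ℚ))) x
      map_add' := fun P Q => ?_
      map_smul' := fun a P => ?_ }, fun P x => ?_, fun x => ?_, fun x => ?_⟩
  · funext x
    rw [Pi.add_apply, ← Finset.sum_add_distrib]
    refine Finset.sum_congr rfl fun p _ => ?_
    rw [map_add, LinearMap.add_apply, ((hU p).aeval_eulerOp _ P).expSum_add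
      ((hU p).aeval_eulerOp _ Q), mul_add]
  · funext x
    rw [Pi.smul_apply, smul_eq_mul, Finset.mul_sum]
    refine Finset.sum_congr rfl fun p _ => ?_
    rw [map_smul, LinearMap.smul_apply, expSum_smul]
    simp only [RingHom.id_apply]
    ring
  · refine HasDerivAt.fun_sum fun p _ => HasDerivAt.const_mul _ ?_
    refine (((hU p).aeval_eulerOp _ P).hasDerivAt_expSum p.2 _ x).congr_deriv ?_
    rw [map_mul, Polynomial.aeval_X, Module.End.mul_apply]
  · change ∑ p, c p * _ = Complex.exp x * ∑ p, c p * _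
    rw [Finset.mul_sum]
    refine Finset.sum_congr rfl fun p _ => ?_
    rw [expSum_weightPoly_eq hd hw hdvd hr p.1.2 (by omega)]
    ring
  · change ∑ p, c p * _ = _
    refine Finset.sum_congr rfl fun p _ => ?_
    rw [map_one, Module.End.one_apply, smallIGW_eq_expSum]

/-! ### Linear independence of the components of the I-function -/

/-- Continuation along a loop around `q = 0`. -/
def monodromy : Module.End ℂ (ℂ → ℂ) :=
  LinearMap.funLeft ℂ ℂ fun x => x + 2 * Real.pi * Complex.I

section Monodromy

variable {n₀ : ℚ} {U : ℕ → PowerSeries ℂ}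

theorem IsRapid.monodromy_sub_expSum (hU : IsRapid U) (n₀ : ℚ) (i : ℕ) :
    (monodromy - Complex.exp (n₀ * (2 * Real.pi * Complex.I)) • 1) (expSum i n₀ U) =
      Complex.exp (n₀ * (2 * Real.pi * Complex.I)) • ∑ j ∈ range i,
        ((2 * Real.pi * Complex.I) ^ (i - j) / ((i - j).factorial : ℂ)) • expSum j n₀ U := by
  funext x
  rw [LinearMap.sub_apply, LinearMap.smul_apply, Module.End.one_apply, Pi.sub_apply]
  change expSum i n₀ U (x + 2 * Real.pi * Complex.I) - _ = _
  rw [hU.expSum_add_two_pi_I, Finset.Nat.sum_antidiagonal_eq_sum_range_succ_mk,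
    Finset.sum_range_succ, Pi.smul_apply, Pi.smul_apply, Finset.sum_apply]
  simp [mul_add]

theorem IsRapid.monodromy_sub_pow_expSum_eq_zero (hU : IsRapid U) (n₀ : ℚ) {i m : ℕ} (h : i < m) :
    ((monodromy - Complex.exp (n₀ * (2 * Real.pi * Complex.I)) • 1) ^ m) (expSum i n₀ U) = 0 := by
  induction i using Nat.strong_induction_on generalizing m with
  | _ i ih =>
    obtain ⟨m, rfl⟩ : ∃ k, m = k + 1 := ⟨m - 1, by omega⟩
    rw [pow_succ, Module.End.mul_apply, hU.monodromy_sub_expSum, map_smul, map_sum,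
      Finset.sum_eq_zero, smul_zero]
    intro j hj
    have hj' := mem_range.1 hj
    rw [map_smul, ih j hj' (by omega), smul_zero]

/-- The monodromy is a single Jordan block on the components of one sector. -/
theorem IsRapid.monodromy_sub_pow_expSum (hU : IsRapid U) (n₀ : ℚ) (i : ℕ) :
    ((monodromy - Complex.exp (n₀ * (2 * Real.pi * Complex.I)) • 1) ^ i) (expSum i n₀ U) =
      (Complex.exp (n₀ * (2 * Real.pi * Complex.I)) * (2 * Real.pi * Complex.I)) ^ i •
        expSum 0 n₀ U := by
  induction i with
  | zero => simp
  | succ i ih =>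
    rw [pow_succ, Module.End.mul_apply, hU.monodromy_sub_expSum, map_smul, map_sum,
      Finset.sum_range_succ, Finset.sum_eq_zero, zero_add, map_smul, ih]
    · rw [smul_smul, smul_smul]
      congr 1
      simp
      ring
    · intro j hj
      rw [map_smul, hU.monodromy_sub_pow_expSum_eq_zero n₀ (mem_range.1 hj), smul_zero]

theorem IsRapid.eq_zero_of_sum_expSum_eq_zero (hU : IsRapid U) (n₀ : ℚ) (h0 : expSum 0 n₀ U ≠ 0)
    {n : ℕ} (c : Fin n → ℂ) (h : ∑ i : Fin n, c i • expSum i n₀ U = 0) (i : Fin n) : c i = 0 := by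
  induction n with
  | zero => exact i.elim0
  | succ n ih =>
    rw [Fin.sum_univ_castSucc] at h
    have h1 := congrArg (fun y =>
      ((monodromy - Complex.exp (n₀ * (2 * Real.pi * Complex.I)) • 1) ^ n) y) h
    rw [map_add, map_sum, Finset.sum_eq_zero, zero_add, map_smul, map_zero, Fin.val_last,
      hU.monodromy_sub_pow_expSum, smul_eq_zero, smul_eq_zero] at h1
    · have h2 : c (Fin.last n) = 0 := h1.resolve_right (not_or.2 ⟨pow_ne_zero _
        (mul_ne_zero (Complex.exp_ne_zero _) Complex.two_pi_I_ne_zero), h0⟩)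
      rw [h2, zero_smul, add_zero] at h
      refine Fin.lastCases h2 (fun j => ?_) i
      exact ih (fun j => c j.castSucc) h j
    · intro j _
      rw [map_smul, Fin.val_castSucc, hU.monodromy_sub_pow_expSum_eq_zero n₀ j.2, smul_zero]

end Monodromy

/-- At `q = 1`, the leading component of each sector is a sum of positive numbers. -/
theorem expSum_zero_sectorSeries_ne_zero {N : ℕ} {d : ℕ} {w : Fin N → ℕ} (hd : 0 < d)
    (hw : ∀ j, 0 < w j) (hdvd : ∀ j, w j ∣ d) (hr : d < ∑ j, w j) {f : ℚ} (hf : f ∈ sectors w) :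
    expSum 0 (sectorExponent f 0) (sectorSeries d w f) ≠ 0 := by
  have hq : ∀ (c : ℕ) (n : ℚ), ∃ r : ℝ, 0 < r ∧
      PowerSeries.constantCoeff (hypergeometricFactor c n 1) = r := by
    intro c n
    refine ⟨((∏ i ∈ range ⌈n * (c : ℚ)⌉₊, (n * (c : ℚ) - (i : ℚ)) : ℚ) : ℝ), ?_, ?_⟩
    · exact_mod_cast Finset.prod_pos fun i hi => sub_pos.2 (Nat.lt_ceil.1 (mem_range.1 hi))
    · unfold hypergeometricFactor
      simp [map_prod]
  choose r hr0 hr1 using hq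
  set ρ : ℕ → ℝ := fun m =>
    r d (sectorExponent f m) * ∏ j, (r (w j) (sectorExponent f m))⁻¹ with hρ
  have hρ0 : ∀ m, 0 < ρ m := fun m =>
    mul_pos (hr0 _ _) (Finset.prod_pos fun j _ => inv_pos.2 (hr0 _ _))
  have hterm : ∀ m : ℕ, PowerSeries.coeff 0 (sectorSeries d w f m * expSeries 0) *
      Complex.exp (((sectorExponent f 0 : ℂ) + m) * 0) = ρ m := by
    intro m
    have h1 : PowerSeries.constantCoeff (expSeries 0) = 1 := by
      rw [← PowerSeries.coeff_zero_eq_constantCoeff_apply, coeff_expSeries]; simp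
    rw [mul_zero, Complex.exp_zero, mul_one, PowerSeries.coeff_zero_eq_constantCoeff_apply,
      map_mul, h1, mul_one]
    unfold sectorSeries
    rw [map_mul, map_prod, hr1]
    simp only [PowerSeries.constantCoeff_inv, hr1, hρ]
    push_cast
    rfl
  have hs := (isRapid_sectorSeries hd hw hdvd hr hf).summable 0 (sectorExponent f 0) 0
  simp_rw [hterm] at hs
  intro h
  have h0 := congrFun h 0
  unfold expSum at h0
  rw [tsum_congr hterm, ← Complex.ofReal_tsum, Pi.zero_apply, Complex.ofReal_eq_zero] at h0
  exact ((Complex.summable_ofReal.1 hs).tsum_pos (fun m => (hρ0 m).le) 0 (hρ0 0)).ne' h0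

theorem exp_sectorExponent_injective {N : ℕ} {w : Fin N → ℕ} (hw : ∀ j, 0 < w j) :
    Function.Injective fun f : sectors w =>
      Complex.exp ((sectorExponent (f : ℚ) 0 : ℚ) * (2 * Real.pi * Complex.I)) := by
  intro f g h
  obtain ⟨m, hm⟩ := Complex.exp_eq_exp_iff_exists_int.1 h
  have h1 : ((sectorExponent (f : ℚ) 0 : ℚ) : ℂ) = (sectorExponent (g : ℚ) 0 : ℚ) + m :=
    mul_right_cancel₀ Complex.two_pi_I_ne_zero (by rw [hm]; ring)
  have h2 : sectorExponent (f : ℚ) 0 = sectorExponent (g : ℚ) 0 + m := by exact_mod_cast h1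
  have h3 := congrArg Int.fract h2
  rw [Int.fract_add_intCast, sectorExponent_zero, sectorExponent_zero, Int.fract_fract,
    Int.fract_fract] at h3
  obtain ⟨z, hz⟩ := Int.fract_eq_fract.1 h3
  have hf := ((mem_sectors_iff hw).1 f.2).1
  have hg := ((mem_sectors_iff hw).1 g.2).1
  refine Subtype.ext ?_
  have h4 : Int.fract (g : ℚ) = Int.fract (f : ℚ) := Int.fract_eq_fract.2 ⟨z, by rw [← hz]; ring⟩
  rwa [Int.fract_eq_self.2 hf, Int.fract_eq_self.2 hg, eq_comm] at h4

/-- The components of the I-function are linearly independent functions on the Riemann surface of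
the logarithm: the sectors are separated by the eigenvalues of the monodromy around `q = 0`, and
the powers of `P` in a sector by its nilpotent part. -/
theorem eq_zero_of_sum_smallIGW_eq_zero {N : ℕ} {d : ℕ} {w : Fin N → ℕ} (hd : 0 < d)
    (hw : ∀ j, 0 < w j) (hdvd : ∀ j, w j ∣ d) (hr : d < ∑ j, w j) (c : AmbientSpace w)
    (h : ∀ x, ∑ p, c p * smallIGW d w x 1 p = 0) : c = 0 := by
  set v : sectors w → (ℂ → ℂ) := fun f => ∑ i : Fin (fixedDim w (f : ℚ) - 1),
    c ⟨f, i⟩ • expSum i (sectorExponent (f : ℚ) 0) (sectorSeries d w (f : ℚ)) with hv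
  have hsum : ∑ f, v f = 0 := by
    funext x
    rw [Pi.zero_apply, ← h x, Fintype.sum_sigma, Finset.sum_apply]
    refine Finset.sum_congr rfl fun f _ => ?_
    simp only [hv]
    rw [Finset.sum_apply]
    refine Finset.sum_congr rfl fun i _ => ?_
    rw [Pi.smul_apply, smul_eq_mul, smallIGW_eq_expSum]
  have hind := (Module.End.independent_maxGenEigenspace monodromy).comp
    (exp_sectorExponent_injective hw)
  rw [iSupIndep_iff_finsetSum_eq_zero_imp_eq_zero] at hind
  have hzero := hind univ v (fun f _ => ?_) hsum
  · funext p
    exact (isRapid_sectorSeries hd hw hdvd hr p.1.2).eq_zero_of_sum_expSum_eq_zero _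
      (expSum_zero_sectorSeries_ne_zero hd hw hdvd hr p.1.2) (fun i => c ⟨p.1, i⟩)
      (hzero p.1 (mem_univ _)) p.2
  · refine Submodule.sum_mem _ fun i _ => Submodule.smul_mem _ _ ?_
    exact (Module.End.mem_maxGenEigenspace _ _ _).2 ⟨i + 1,
      (isRapid_sectorSeries hd hw hdvd hr f.2).monodromy_sub_pow_expSum_eq_zero _
        (Nat.lt_succ_self _)⟩

/-! ### Uniqueness -/

/-- An entire function of moderate growth at `q = 0` that is smaller than every power of `q` in a
sector at `q = ∞` is flat. -/
theorem isFlat_of_isLittleO {a b : ℝ} {d : ℕ} (hd : 0 < d) {y : ℂ → ℂ} (hy : Differentiable ℂ y)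
    (hleft : ∀ ρ : ℝ, 0 < ρ → ∃ B : ℝ, ∀ x : ℂ, x.re ≤ 0 → ‖y x‖ ≤ B * Real.exp (ρ * ‖x‖))
    (hright : ∀ m : ℕ,
      y =o[atInftyInSector a b] fun x => Complex.exp (-(x / (d : ℂ))) ^ (m + 1)) :
    IsFlat a b y := by
  refine ⟨hy, fun σ hσ a' b' ha hb => ?_⟩
  have hd' : (0 : ℝ) < d := by exact_mod_cast hd
  obtain ⟨B, hB⟩ := hleft (-σ) (by linarith)
  obtain ⟨m, hm⟩ := exists_nat_ge (-σ * d)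
  have hm' : -σ ≤ (m + 1) / d := by rw [le_div_iff₀ hd']; linarith
  obtain ⟨R, hR⟩ : ∃ R : ℝ, ∀ x : ℂ, R ≤ x.re → a < x.im → x.im < b →
      ‖y x‖ ≤ Real.exp (-((m + 1) / d) * x.re) := by
    have h1 := (hright m).bound one_pos
    simp_rw [norm_exp_pow, one_mul] at h1
    unfold atInftyInSector at h1
    rw [eventually_inf_principal, eventually_comap] at h1
    obtain ⟨R, hR⟩ := eventually_atTop.1 h1
    exact ⟨R, fun x h2 h3 h4 => hR x.re h2 x rfl ⟨h3, h4⟩⟩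
  set R' := max R 0 with hR'
  obtain ⟨D, hD⟩ := (IsCompact.reProdIm (isCompact_Icc (a := (0 : ℝ)) (b := R'))
    (isCompact_Icc (a := a') (b := b'))).exists_bound_of_continuousOn hy.continuous.continuousOn
  set K := |a'| + |b'| with hK
  refine ⟨|B| * Real.exp (-σ * K) + |D| * Real.exp (-σ * R') + 1, fun x h1 h2 => ?_⟩
  have hpos1 : 0 ≤ |B| * Real.exp (-σ * K) := by positivity
  have hpos2 : 0 ≤ |D| * Real.exp (-σ * R') := by positivity
  have him : |x.im| ≤ K := abs_le.2
    ⟨by linarith [neg_abs_le a', abs_nonneg b'], by linarith [le_abs_self b', abs_nonneg a']⟩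
  have hE := Real.exp_pos (σ * x.re)
  rcases le_total x.re 0 with h | h
  · have hx := (Complex.norm_le_abs_re_add_abs_im x).trans (add_le_add_right him _)
    rw [abs_of_nonpos h] at hx
    calc ‖y x‖ ≤ |B| * Real.exp (-σ * ‖x‖) :=
          (hB x h).trans (mul_le_mul_of_nonneg_right (le_abs_self B) (Real.exp_pos _).le)
      _ ≤ |B| * Real.exp (-σ * K + σ * x.re) := by
          gcongr
          nlinarith
      _ = |B| * Real.exp (-σ * K) * Real.exp (σ * x.re) := by rw [Real.exp_add]; ring
      _ ≤ _ := by
          gcongr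
          linarith
  · rcases le_total x.re R' with h' | h'
    · calc ‖y x‖ ≤ |D| * 1 := by
            rw [mul_one]
            exact (hD x (by rw [Complex.mem_reProdIm]; exact ⟨⟨h, h'⟩, h1, h2⟩)).trans
              (le_abs_self D)
        _ ≤ |D| * Real.exp (-σ * R' + σ * x.re) := by
            gcongr
            exact Real.one_le_exp (by nlinarith)
        _ = |D| * Real.exp (-σ * R') * Real.exp (σ * x.re) := by rw [Real.exp_add]; ring
        _ ≤ _ := by
            gcongr
            linarith
    · calc ‖y x‖ ≤ Real.exp (-((m + 1) / d) * x.re) :=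
            hR x ((le_max_left R 0).trans h') (by linarith) (by linarith)
        _ ≤ 1 * Real.exp (σ * x.re) := by
            rw [one_mul]
            gcongr
            linarith
        _ ≤ _ := by
            gcongr
            linarith

/-- The coordinates of `(L₁ - L₂) I` are flat, hence zero, and the components of `I` are linearly
independent. -/
theorem linearMap_eq_of_isAsymptoticExpansion {N : ℕ} {d : ℕ} {w : Fin N → ℕ} (hd : 0 < d)
    (hw : ∀ j, 0 < w j) (hdvd : ∀ j, w j ∣ d) (hr : d < ∑ j, w j)
    {L₁ L₂ : AmbientSpace w →ₗ[ℂ] NarrowSpace d w} {α : ℕ → NarrowSpace d w}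
    (h₁ : IsAsymptoticExpansion (atInftyInSector (sectorCenter d w - sectorRadius d w)
        (sectorCenter d w + sectorRadius d w))
      (fun n x => Complex.exp (-(x / (d : ℂ))) ^ (n + 1)) α fun x => L₁ (smallIGW d w x 1))
    (h₂ : IsAsymptoticExpansion (atInftyInSector (sectorCenter d w - sectorRadius d w)
        (sectorCenter d w + sectorRadius d w))
      (fun n x => Complex.exp (-(x / (d : ℂ))) ^ (n + 1)) α fun x => L₂ (smallIGW d w x 1)) :
    L₁ = L₂ := by
  have hlin : ∀ (k : narrowSet d w) (x : ℂ), (L₁ - L₂) (smallIGW d w x 1) k =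
      ∑ p, (L₁ - L₂) (Pi.single p 1) k * smallIGW d w x 1 p := by
    intro k x
    rw [LinearMap.pi_apply_eq_sum_univ (L₁ - L₂), Finset.sum_apply]
    refine Finset.sum_congr rfl fun p _ => ?_
    rw [Pi.smul_apply, smul_eq_mul, mul_comm]
    have h : (fun j => if p = j then (1 : ℂ) else 0) = Pi.single p 1 := by
      funext i
      simp [Pi.single_apply, eq_comm]
    rw [h]
  have hzero : ∀ k : narrowSet d w, (fun p => (L₁ - L₂) (Pi.single p 1) k) = 0 := by
    intro k
    obtain ⟨F, hder, hode, hF⟩ := exists_linearMap_smallIGW hd hw hdvd hr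
      fun p => (L₁ - L₂) (Pi.single p 1) k
    have hflat : IsFlat (sectorCenter d w - sectorRadius d w)
        (sectorCenter d w + sectorRadius d w) (F 1) := by
      refine isFlat_of_isLittleO hd (fun x => (hder 1 x).differentiableAt) (fun ρ hρ => ?_)
        fun m => ?_
      · choose B hB using fun p : (Σ f : sectors w, Fin (fixedDim w (f : ℚ) - 1)) =>
          (isRapid_sectorSeries hd hw hdvd hr p.1.2).exists_norm_expSum_le p.2
            (sectorExponent_nonneg (p.1 : ℚ) 0) hρ
        refine ⟨∑ p, ‖(L₁ - L₂) (Pi.single p 1) k‖ * B p, fun x hx => ?_⟩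
        rw [hF, Finset.sum_mul]
        refine (norm_sum_le _ _).trans (Finset.sum_le_sum fun p _ => ?_)
        rw [norm_mul, smallIGW_eq_expSum, mul_assoc]
        exact mul_le_mul_of_nonneg_left (hB p x hx) (norm_nonneg _)
      · refine (isLittleO_pi.1 ((h₁.2 m).sub (h₂.2 m)) k).congr_left fun x => ?_
        rw [hF, ← hlin]
        simp
    refine eq_zero_of_sum_smallIGW_eq_zero hd hw hdvd hr _ fun x => ?_
    rw [← hF, eq_zero_of_isFlat hd hw hdvd hr hder hode hflat]
    rfl
  refine sub_eq_zero.1 (LinearMap.pi_ext' fun p => LinearMap.ext_ring (funext fun k => ?_))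
  exact congrFun (hzero k) p

theorem existsUnique_linearMap {N : ℕ} {d : ℕ} {w : Fin N → ℕ} (hd : 0 < d)
    (hw : ∀ j, 0 < w j) (hdvd : ∀ j, w j ∣ d) (hr : d < ∑ j, w j) :
    ∃! L : AmbientSpace w →ₗ[ℂ] NarrowSpace d w,
      Module.finrank ℂ (LinearMap.range L) = Module.finrank ℂ (NarrowSpace d w) ∧
      IsAsymptoticExpansion (atInftyInSector (sectorCenter d w - sectorRadius d w)
          (sectorCenter d w + sectorRadius d w))
        (fun n x => Complex.exp (-(x / (d : ℂ))) ^ (n + 1)) (smallIFJRW d w (-1))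
        fun x => L (smallIGW d w x 1) := by
  have hL := isAsymptoticExpansion_connectionMap hd hw hdvd hr
  have hρ : 0 < sectorRadius d w := by
    have := one_le_fanoIndex hr
    unfold sectorRadius
    positivity
  refine ⟨connectionMap d w, ⟨?_, hL⟩, fun L h =>
    linearMap_eq_of_isAsymptoticExpansion hd hw hdvd hr h.2 hL⟩
  rw [range_eq_top_of_isAsymptoticExpansion hd hw (by linarith) hL, finrank_top]

/-! ### The degree of the polynomial -/

/-- A polynomial of weighted degree `0` for positive weights is constant, so that all points are
critical. -/
theorem degree_pos_of_hasUniqueSingularityAtOrigin {N : ℕ} {d : ℕ} {w : Fin N → ℕ}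
    {W : MvPolynomial (Fin N) ℂ} (hw : ∀ j, 0 < w j) (hN : 0 < N)
    (hquasi : MvPolynomial.IsWeightedHomogeneous w W d) (hsing : HasUniqueSingularityAtOrigin W) :
    0 < d := by
  rcases Nat.eq_zero_or_pos d with rfl | hd
  swap
  · exact hd
  have hconst : W = MvPolynomial.C (MvPolynomial.coeff 0 W) := by
    ext e
    rw [MvPolynomial.coeff_C]
    split_ifs with h
    · rw [h]
    · by_contra hne
      have h1 := hquasi hne
      have := Finsupp.nonTorsionWeight_of ℕ w fun j => (hw j).ne'
      exact h ((Finsupp.weight_eq_zero_iff_eq_zero w).1 h1).symm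
  have h1 : (fun _ : Fin N => (1 : ℂ)) = 0 := (hsing _).1 fun j => by
    rw [hconst, MvPolynomial.pderiv_C, map_zero]
  exact absurd (congrFun h1 ⟨0, hN⟩) one_ne_zero

end LGFano

end

theorem theorem1p3 (N d : ℕ) (w : Fin N → ℕ) (W : MvPolynomial (Fin N) ℂ)
    (hw : ∀ j, 0 < w j)
    (hgcd : Finset.univ.gcd w = 1)
    (hquasi : MvPolynomial.IsWeightedHomogeneous w W d)
    (hsing : LGFano.HasUniqueSingularityAtOrigin W)
    (hGorenstein : ∀ j, w j ∣ d)
    (hFano : LGFano.canonicalIndex d w < 0) :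
    (∀ (x : ℂ) (f : LGFano.sectors w) (i : ℕ), i < LGFano.fixedDim w (f : ℚ) - 1 →
      Summable fun m : ℕ => PowerSeries.coeff i
        (LGFano.smallIGWTerm d w x 1 (LGFano.sectorExponent (f : ℚ) m))) ∧
    ∃ a b : ℝ, a < b ∧ b - a ≤ 2 * Real.pi * (-LGFano.canonicalIndex d w : ℤ) ∧
      ∃! L : LGFano.AmbientSpace w →ₗ[ℂ] LGFano.NarrowSpace d w,
        Module.finrank ℂ (LinearMap.range L) = Module.finrank ℂ (LGFano.NarrowSpace d w) ∧
        LGFano.IsAsymptoticExpansion (LGFano.atInftyInSector a b)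
          (fun n x => Complex.exp (-(x / (d : ℂ))) ^ (n + 1))
          (LGFano.smallIFJRW d w (-1))
          (fun x => L (LGFano.smallIGW d w x 1)) := by
  have hr : d < ∑ j, w j := by
    unfold LGFano.canonicalIndex at hFano
    zify
    linarith
  have hN : 0 < N := by
    rcases Nat.eq_zero_or_pos N with rfl | h
    · simp at hr
    · exact h
  have hd := LGFano.degree_pos_of_hasUniqueSingularityAtOrigin hw hN hquasi hsing
  have h1 := LGFano.one_le_fanoIndex hr
  have hpi := Real.pi_pos
  refine ⟨fun x f i _ => LGFano.summable_smallIGWTerm hd hw hGorenstein hr f.2 x i,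
    LGFano.sectorCenter d w - LGFano.sectorRadius d w,
    LGFano.sectorCenter d w + LGFano.sectorRadius d w, ?_, ?_,
    LGFano.existsUnique_linearMap hd hw hGorenstein hr⟩
  · have : 0 < LGFano.sectorRadius d w := by unfold LGFano.sectorRadius; positivity
    linarith
  · have e : ((-LGFano.canonicalIndex d w : ℤ) : ℝ) = LGFano.fanoIndex d w := by
      unfold LGFano.canonicalIndex LGFano.fanoIndex
      push_cast
      ring
    rw [e, LGFano.sectorRadius]
    nlinarith
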